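/- **Setting.** A *seed* is a triangle in the Euclidean plane $\mathbb{E}^2$ (or an infinite region bounded by two parallel half-lines and a third side), together with a real skew-symmetric matrix $B=(b_{ij})$ indexed by the sides; the numbering of the sides is immaterial. Side $i$ is recorded by the affine function $v_i(x)=\langle a_i,x\rangle+c_i$ with $\langle a_i,a_i\rangle=2$ which is $0$ on the side and $\ge 0$ on the region; put $(v_i,v_j)=\langle a_i,a_j\rangle$. The *quiver* of the seed has the sides as vertices and an arrow $i\to j$ iff $b_{ij}>0$. Given a notion of positive affine functions, the mutation $\mu_k$ replaces $v_k$ by $-v_k$, replaces $v_i$ ($i\ne k$) by $v_i-(v_i,v_k)v_k$ if either $v_k$ is positive and $b_{ik}<0$, or $v_k$ is not positive and $b_{ik}>0$, keeps all other $v_i$, and replaces $B$ by $B'$ with $b'_{ij}=-b_{ij}$ if $k\in\{i,j\}$ and $b'_{ij}=b_{ij}+(b_{ik}|b_{kj}|+|b_{ik}|b_{kj})/2$ otherwise. Let $n\ge 2$ and $\alpha=\pi/2n$. Let $\Delta_0=A_1A_2A_3\subseteq\mathbb{E}^2$ be a triangle with angles $\alpha$, $(n-1)\alpha$, $n\alpha$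 at $A_1,A_2,A_3$, and let $a_i$ be the side opposite to $A_i$. The initial seed $(\mathbf{v}_0,B_0)$ is $\Delta_0$ with the quiver $a_1\to a_3\to a_2$, that is, $b_{13}=2\cos((n-1)\alpha)$, $b_{32}=2\cos\alpha$, $b_{12}=0$. Let $H$ be the foot of the altitude from $A_3$. The belt line $b$ is the line through $A_3$ and the mirror images of $H$ in $a_1$ and $a_2$ (these three points are collinear). An affine function $f$ is positive if $f>0$ at all points of $b$ sufficiently far in the direction from $A_3$ to the mirror image of $H$ in $a_2$ (the reference point lies infinitely far away on $b$ in the direction from the source to the sink). The exchange graph $\Gamma$ has as vertices the seeds obtained from $(\mathbf{v}_0,B_0)$ by finite sequences of mutations; two different vertices are adjacent iff they are related by one mutation. For $w\in\mathbb{E}^2$, the seed $w+(\mathbf{v},B)$ is obtained by translating the region by $w$ and keeping $B$. Let $L$ be the group of all $w\in\mathbb{E}^2$ such that $(\mathbf{v},B)\mapsto w+(\mathbf{v},B)$ is an automorphism of the graph $\Gamma$. **Theorem.** 1. Let $(n_1,n_2,n_3)$ be non-negative integers with $n_1+n_2+n_3=2n$ and $\gcd(n_1,n_2,n_3)=1$,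 and let $Q$ be a quiver with vertices $1,2,3$. Consider the vertices of $\Gamma$ whose sides can be numbered so that the quiver is $Q$ and the (finite or infinite) triangle has angle $n_i\alpha$ opposite to side $i$ for $i=1,2,3$ (an angle $0$ meaning that the two sides are parallel). These vertices lie in at most two $L$-orbits, one for each orientation: the sides $1,2,3$ follow each other counterclockwise or clockwise, and any two of these vertices with the same orientation differ by a translation by a vector in $L$. 2. $L$ is a finitely generated free abelian group, and $\operatorname{rk}_{\mathbb{Z}}(L)=\varphi(2n)/2$ or $\operatorname{rk}_{\mathbb{Z}}(L)=\varphi(2n)$, where $\varphi$ is Euler's totient function. 3. For every finite symmetric generating set $S\not\ni 0$ of $L$, the map $L\to\Gamma$, $w\mapsto w+(\mathbf{v}_0,B_0)$, is a quasi-isometry from the Cayley graph of $L$ with respect to $S$ to $\Gamma$, both with the path metric. -/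

import Mathlib

open scoped EuclideanGeometry

noncomputable section

/-- The Euclidean plane. -/
abbrev Plane : Type := EuclideanSpace ℝ (Fin 2)

/-- The three-dimensional real vector space of affine linear functions `x ↦ ⟪a, x⟫ + c` on the
plane; such a function is stored as the pair `(a, c)` of its linear part and its constant. -/
abbrev AffineForm : Type := Plane × ℝ

namespace AffineForm

/-- The value of an affine linear function at a point. -/
def eval (f : AffineForm) (x : Plane) : ℝ := inner ℝ f.1 x + f.2

/-- The degenerate symmetric bilinear form: the inner product of the linear parts. -/
def form (f g : AffineForm) : ℝ := inner ℝ f.1 g.1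

/-- The function `x ↦ f (x - w)`; its half-plane `f ≥ 0` is that of `f` translated by `w`. -/
def translate (w : Plane) (f : AffineForm) : AffineForm := (f.1, f.2 - inner ℝ f.1 w)

lemma translate_zero (f : AffineForm) : translate 0 f = f := by
  simp [translate]

lemma translate_translate (w z : Plane) (f : AffineForm) :
    translate w (translate z f) = translate (w + z) f := by
  simp only [translate, inner_add_right, Prod.mk.injEq, true_and]
  ring

end AffineForm

/-- A reference point lying infinitely far away on the line through `base` with direction `dir`,
at the end towards which `dir` points. -/
structure ReferencePoint where
  base : Plane
  dir : Plane

/-- `f` is positive if the reference point lies in the half-plane of `f`, i.e. `f` is positive at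
all points of the line that lie sufficiently far in the direction `dir`. (If `dir` is not parallel
to the boundary line of `f`, only the direction matters; otherwise this says that the
line lies in the half-plane of `f`.) -/
def ReferencePoint.IsPositive (u : ReferencePoint) (f : AffineForm) : Prop :=
  ∀ᶠ t : ℝ in Filter.atTop, 0 < f.eval (u.base + t • u.dir)

/-- A seed realised in the plane, with its sides labelled by `Fin 3`: three affine linear functions
(the domain of the seed is the intersection of their half-planes `v i ≥ 0`), and the exchange
matrix. Only seeds that arise by mutations from an honest geometric realisation are used below. -/
@[ext]
structure LabelledSeed where
  v : Fin 3 → AffineForm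
  B : Matrix (Fin 3) (Fin 3) ℝ

/-- Mutation of exchange matrices. -/
def mutateMatrix (k : Fin 3) (B : Matrix (Fin 3) (Fin 3) ℝ) : Matrix (Fin 3) (Fin 3) ℝ :=
  Matrix.of fun i j =>
    if k = i ∨ k = j then - B i j
    else B i j + (B i k * |B k j| + |B i k| * B k j) / 2

namespace LabelledSeed

open Classical in
/-- Mutation of seeds by partial reflections. -/
def mutate (u : ReferencePoint) (k : Fin 3) (s : LabelledSeed) : LabelledSeed where
  v := fun i =>
    if i = k then - s.v k
    else if (u.IsPositive (s.v k) ∧ s.B i k < 0) ∨ (¬ u.IsPositive (s.v k) ∧ 0 < s.B i k) then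
      s.v i - (s.v i).form (s.v k) • s.v k
    else s.v i
  B := mutateMatrix k s.B

/-- Translation of a seed: the triangle is translated, the exchange matrix is kept. -/
def translate (w : Plane) (s : LabelledSeed) : LabelledSeed where
  v := fun i => (s.v i).translate w
  B := s.B

/-- Renaming of the sides. -/
def relabel (σ : Equiv.Perm (Fin 3)) (s : LabelledSeed) : LabelledSeed where
  v := fun i => s.v (σ i)
  B := s.B.submatrix σ σ

/-- Labelled seeds that agree up to the numbering of their sides are identified. -/
instance setoid : Setoid LabelledSeed where
  r s t := ∃ σ : Equiv.Perm (Fin 3), t = s.relabel σ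
  iseqv :=
    { refl := fun s => ⟨1, rfl⟩
      symm := by
        rintro s t ⟨σ, rfl⟩
        refine ⟨σ⁻¹, ?_⟩
        ext <;> simp [relabel]
      trans := by
        rintro s t r ⟨σ, rfl⟩ ⟨τ, rfl⟩
        exact ⟨σ * τ, rfl⟩ }

/-- The quiver of a seed: its vertices are the sides, and there is an arrow `i ⟶ j` if and only if
the entry `B i j` is positive. -/
def quiver (s : LabelledSeed) : Digraph (Fin 3) where
  Adj i j := 0 < s.B i j

/-- The domain of a seed, the intersection of the three half-planes. -/
def domain (s : LabelledSeed) : Set Plane := {x | ∀ i, 0 ≤ (s.v i).eval x}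

/-- The interior angle of the domain opposite to the side `i`, i.e. between the two other sides.
As the linear parts of the affine functions are inward normals, it is the supplement of the angle
between the normals. It is `0` if these two sides are parallel. -/
def interiorAngle (s : LabelledSeed) (i : Fin 3) : ℝ :=
  Real.pi - InnerProductGeometry.angle (s.v (i + 1)).1 (s.v (i + 2)).1

/-- The determinant of two plane vectors. -/
def cross (a b : Plane) : ℝ := a 0 * b 1 - a 1 * b 0

/-- The orientation of a (finite or infinite) triangle with sides `0, 1, 2`: it is `1` if going
around the sides in this order is counterclockwise, and `-1` if it is clockwise. For a finite
triangle the three summands have the same sign. If two sides are parallel, one summand is `0`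
and the others have the same sign. -/
def orientation (s : LabelledSeed) : SignType :=
  SignType.sign (cross (s.v 0).1 (s.v 1).1 + cross (s.v 1).1 (s.v 2).1 + cross (s.v 2).1 (s.v 0).1)

end LabelledSeed

/-- A seed: a triangle (or infinite region) with a quiver whose vertices are the sides. -/
abbrev Seed : Type := Quotient LabelledSeed.setoid

namespace Seed

/-- Translation of seeds. -/
def translate (w : Plane) : Seed → Seed :=
  Quotient.map (LabelledSeed.translate w) (by
    rintro s t ⟨σ, rfl⟩
    exact ⟨σ, rfl⟩)

lemma translate_zero (x : Seed) : translate 0 x = x := by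
  induction x using Quotient.inductionOn with
  | h s =>
    refine congrArg (Quotient.mk _) ?_
    ext1
    · funext i
      exact AffineForm.translate_zero _
    · rfl

lemma translate_translate (w z : Plane) (x : Seed) :
    translate w (translate z x) = translate (w + z) x := by
  induction x using Quotient.inductionOn with
  | h s =>
    refine congrArg (Quotient.mk _) ?_
    ext1
    · funext i
      exact AffineForm.translate_translate _ _ _
    · rfl

/-- The seeds obtained from `s₀` by finite sequences of mutations. -/
def mutationClass (u : ReferencePoint) (s₀ : LabelledSeed) : Set Seed :=
  {x | ∃ s : LabelledSeed,
    Relation.ReflTransGen (fun s t => ∃ k, t = LabelledSeed.mutate u k s) s₀ s ∧ ⟦s⟧ = x}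

end Seed

/-- The exchange graph of `s₀`: its vertices are the seeds obtained from `s₀` by sequences of
mutations, and two different vertices are adjacent if they are related by a single mutation. -/
def exchangeGraph (u : ReferencePoint) (s₀ : LabelledSeed) :
    SimpleGraph (Seed.mutationClass u s₀) :=
  SimpleGraph.fromRel fun x y =>
    ∃ (s : LabelledSeed) (k : Fin 3), ⟦s⟧ = x.1 ∧ ⟦LabelledSeed.mutate u k s⟧ = y.1

/-- The lattice `L` of all vectors `w` such that the translation by `w` is an automorphism of the
exchange graph. -/
def translationLattice (u : ReferencePoint) (s₀ : LabelledSeed) : AddSubgroup Plane where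
  carrier := {w | ∃ φ : exchangeGraph u s₀ ≃g exchangeGraph u s₀,
    ∀ x, (φ x).1 = Seed.translate w x.1}
  zero_mem' := ⟨SimpleGraph.Iso.refl, fun x => (Seed.translate_zero _).symm⟩
  add_mem' := by
    rintro w z ⟨φ, hφ⟩ ⟨ψ, hψ⟩
    refine ⟨ψ.trans φ, fun x => ?_⟩
    rw [← Seed.translate_translate, ← hψ, ← hφ]
    rfl
  neg_mem' := by
    rintro w ⟨φ, hφ⟩
    refine ⟨φ.symm, fun x => ?_⟩
    have h := hφ (φ.symm x)
    rw [RelIso.apply_symm_apply] at h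
    rw [h, Seed.translate_translate, neg_add_cancel, Seed.translate_zero]

lemma translate_mem_mutationClass {u : ReferencePoint} {s₀ : LabelledSeed} {w : Plane}
    (hw : w ∈ translationLattice u s₀) {x : Seed} (hx : x ∈ Seed.mutationClass u s₀) :
    Seed.translate w x ∈ Seed.mutationClass u s₀ := by
  obtain ⟨φ, hφ⟩ := hw
  rw [← hφ ⟨x, hx⟩]
  exact (φ ⟨x, hx⟩).2

/-- The lattice `L` acts on the vertices of the exchange graph by translations. -/
instance translationAction (u : ReferencePoint) (s₀ : LabelledSeed) :
    AddAction (translationLattice u s₀) (Seed.mutationClass u s₀) where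
  vadd w x := ⟨Seed.translate w.1 x.1, translate_mem_mutationClass w.2 x.2⟩
  zero_vadd _ := Subtype.ext (Seed.translate_zero _)
  add_vadd _ _ _ := Subtype.ext (Seed.translate_translate _ _ _).symm

/-- `x` is represented by a finite or infinite triangle with quiver `Q` and orientation `ε` whose
angle opposite to the side `i` is `m i * α` for all `i`, for a suitable numbering of its sides. -/
def Seed.IsOfType (α : ℝ) (m : Fin 3 → ℕ) (Q : Digraph (Fin 3)) (ε : SignType) (x : Seed) : Prop :=
  ∃ s : LabelledSeed, ⟦s⟧ = x ∧ (interior s.domain).Nonempty ∧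
    (∀ i, s.interiorAngle i = m i * α) ∧ s.quiver = Q ∧ s.orientation = ε

/-- Quasi-isometries with respect to given distance functions. -/
def IsQuasiIsometry {M N : Type*} (d₁ : M → M → ℝ) (d₂ : N → N → ℝ) (f : M → N) : Prop :=
  (∃ a b : ℝ, 1 ≤ a ∧ 0 ≤ b ∧ ∀ x y,
    1 / a * d₁ x y - b ≤ d₂ (f x) (f y) ∧ d₂ (f x) (f y) ≤ a * d₁ x y + b) ∧
  ∃ c : ℝ, 0 ≤ c ∧ ∀ z, ∃ x, d₂ z (f x) ≤ c

/-- The path metric on the vertices of a graph. -/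
def graphDist {V : Type*} (G : SimpleGraph V) (x y : V) : ℝ := G.dist x y

/-- The affine function that vanishes on the side of the triangle opposite to the vertex `i`, is
positive at this vertex, and is normalised so that the square of its linear part is `2`. -/
def sideForm (T : Affine.Triangle ℝ Plane) (i : Fin 3) : AffineForm :=
  let h : Plane := T.points i - T.altitudeFoot i
  let a : Plane := (√2 / ‖h‖) • h
  (a, - inner ℝ a (T.altitudeFoot i))

/-- The initial seed, for a triangle `T` with vertices `A₁, A₂, A₃` (indexed by `0, 1, 2`) and
angles `α, (n - 1) α, n α` where `α = π / 2n`. Its quiver is `a₁ ⟶ a₃ ⟶ a₂`, where `aᵢ` is the side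
opposite to `Aᵢ`. -/
def initialSeed (n : ℕ) (T : Affine.Triangle ℝ Plane) : LabelledSeed where
  v := sideForm T
  B :=
    let α : ℝ := Real.pi / (2 * n)
    !![0, 0, 2 * Real.cos ((n - 1) * α);
       0, 0, -(2 * Real.cos α);
       -(2 * Real.cos ((n - 1) * α)), 2 * Real.cos α, 0]

/-- The reference point for a triangle with a right angle at `A₃` and quiver `a₁ ⟶ a₃ ⟶ a₂`. The
altitudes on the source `a₁` and on the sink `a₂` both have the foot `A₃`, so that the
billiard path through the feet of the altitudes runs from the foot `H` on the hypotenuse to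
`A₃` and back to `H`. Unfolding it by the reflections across `a₁` and `a₂` gives the belt line, which
passes through the mirror image of `H` in `a₁`, then `A₃`, then the mirror image of `H` in `a₂`.
The reference point lies at infinity on this line, in the direction from source to sink. -/
def initialReferencePoint (T : Affine.Triangle ℝ Plane) : ReferencePoint where
  base := T.points 2
  dir := EuclideanGeometry.reflection line[ℝ, T.points 2, T.points 0] (T.altitudeFoot 2)
    - T.points 2

/-- The initial seed as a vertex of its exchange graph. -/
def initialVertex (u : ReferencePoint) (s₀ : LabelledSeed) : Seed.mutationClass u s₀ :=
  ⟨⟦s₀⟧, s₀, Relation.ReflTransGen.refl, rfl⟩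

end

/-!
All angles of the seeds are multiples of `π / 2n`, and all belt lines coincide: a seed is determined
by its two angles `a`, `c` at the middle side, its orientation, and the position of an altitude
foot on the belt line. Mutation in the side opposite to the middle angle changes `(a, c)` by a
step of the Euclidean algorithm, so any two seeds with the same angles, quiver and orientation
differ by a translation in `L`. Moreover, for every `g < n` coprime to `2n` an infinite region with
angle `gπ / 2n` is reached, and one of its mutations is a translation by a fixed multiple of
`1 / sin² (gπ / 2n)`. Hence `L` lies between the group generated by these numbers and the real part
of the field of `2n`-th roots of unity. The numbers are Galois conjugates of each other, and their
group matrix is diagonally dominant, so both ranks are `φ(2n) / 2`. As `L` acts freely on the orbit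
of the initial seed, with finitely many orbits on a locally finite graph, the orbit map is a
quasi-isometry by the Švarc–Milnor lemma.
-/

noncomputable section

open Real

/-! ### The region of a belt line and an altitude foot -/

/-- An orthonormal frame of the plane whose first axis is the belt line, together with a unit of
length along this axis. -/
structure BeltFrame where
  base : Plane
  dir : Plane
  perp : Plane
  scale : ℝ
  dir_dir : inner ℝ dir dir = (1 : ℝ)
  perp_perp : inner ℝ perp perp = (1 : ℝ)
  dir_perp : inner ℝ dir perp = (0 : ℝ)
  scale_pos : 0 < scale

namespace BeltFrame

variable (F : BeltFrame)

lemma perp_dir : inner ℝ F.perp F.dir = (0 : ℝ) := by rw [real_inner_comm, F.dir_perp]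

lemma inner_combination (x y x' y' : ℝ) :
    inner ℝ (x • F.dir + y • F.perp) (x' • F.dir + y' • F.perp) = x * x' + y * y' := by
  simp only [inner_add_left, inner_add_right, real_inner_smul_left, real_inner_smul_right,
    F.dir_dir, F.perp_perp, F.dir_perp, F.perp_dir]
  ring

/-- The affine function with gradient `√2 (x, y)` and value `√2 c` at the origin of the frame, where
`c` is measured in the unit of length of the frame. -/
def aff (x y c : ℝ) : AffineForm :=
  (√2 • (x • F.dir + y • F.perp),
    √2 * (F.scale * c - (x * inner ℝ F.dir F.base + y * inner ℝ F.perp F.base)))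

lemma aff_sub_smul (x y c x' y' c' r : ℝ) :
    F.aff x y c - r • F.aff x' y' c' = F.aff (x - r * x') (y - r * y') (c - r * c') := by
  refine Prod.ext ?_ ?_
  · simp only [aff, Prod.fst_sub, Prod.smul_fst]
    module
  · simp only [aff, Prod.snd_sub, Prod.smul_snd, smul_eq_mul]
    ring

lemma neg_aff (x y c : ℝ) : -F.aff x y c = F.aff (-x) (-y) (-c) := by
  refine Prod.ext ?_ ?_
  · simp only [aff, Prod.fst_neg]
    module
  · simp only [aff, Prod.snd_neg]
    ring

lemma form_aff (x y c x' y' c' : ℝ) :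
    (F.aff x y c).form (F.aff x' y' c') = 2 * (x * x' + y * y') := by
  simp only [AffineForm.form, aff, real_inner_smul_left, real_inner_smul_right, inner_combination]
  rw [← mul_assoc, mul_self_sqrt zero_le_two]

lemma eval_aff (x y c t : ℝ) :
    (F.aff x y c).eval (F.base + t • F.dir) = √2 * (F.scale * c + x * t) := by
  simp only [AffineForm.eval, aff, real_inner_smul_left, inner_add_left, inner_add_right,
    real_inner_smul_right, F.dir_dir, F.perp_dir]
  ring

lemma translate_aff (x y c w : ℝ) :
    (F.aff x y c).translate ((F.scale * w) • F.dir) = F.aff x y (c - x * w) := by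
  refine Prod.ext rfl ?_
  simp only [AffineForm.translate, aff, real_inner_smul_left, inner_add_left,
    real_inner_smul_right, F.dir_dir, F.perp_dir]
  ring

/-- The normalised affine function whose zero line makes the angle `θ` with the belt line, measured
in the sense given by the sign `s`; its value at the origin of the frame is `√2 d`. -/
def line (s θ d : ℝ) : AffineForm := F.aff (sin θ) (s * cos θ) d

section line

variable {F} {s : ℝ} (θ φ d e w : ℝ)

lemma form_line (hs : s ^ 2 = 1) :
    (F.line s θ d).form (F.line s φ e) = 2 * cos (θ - φ) := by
  rw [line, line, form_aff, cos_sub]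
  linear_combination 2 * cos θ * cos φ * hs

lemma form_line_self (hs : s ^ 2 = 1) : (F.line s θ d).form (F.line s θ d) = 2 := by
  rw [form_line _ _ _ _ hs, sub_self, cos_zero, mul_one]

lemma neg_line : -F.line s θ d = F.line s (θ + π) (-d) := by
  rw [line, neg_aff, line, sin_add_pi, cos_add_pi, mul_neg]

variable {θ φ d e} in
lemma line_congr (m : ℤ) (hθ : θ = φ + m * (2 * π)) (hd : d = e) :
    F.line s θ d = F.line s φ e := by
  rw [line, line, hθ, hd, sin_add_int_mul_two_pi, cos_add_int_mul_two_pi]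

lemma line_neg_sign : F.line (-s) θ d = F.line s (π - θ) d := by
  rw [line, line, sin_pi_sub, cos_pi_sub, mul_neg, neg_mul]

lemma line_sub_smul (r : ℝ) (hr : r = 2 * cos (θ - φ)) :
    F.line s θ d - r • F.line s φ e = F.line s (2 * φ + π - θ) (d - r * e) := by
  have hangle : 2 * φ + π - θ = φ - (θ - φ) + π := by ring
  have hθ : θ = φ + (θ - φ) := by ring
  rw [line, line, aff_sub_smul, line, hangle, sin_add_pi, cos_add_pi, sin_sub φ, cos_sub φ, hr]
  congr 1
  · rw [hθ, sin_add, ← hθ]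
    ring
  · rw [hθ, cos_add, ← hθ]
    ring

lemma translate_line :
    (F.line s θ d).translate ((F.scale * w) • F.dir) = F.line s θ (d - sin θ * w) :=
  F.translate_aff _ _ _ _

end line

/-- The reference point is the positive end of the first axis. -/
def IsAdapted (u : ReferencePoint) : Prop := u.base = F.base ∧ ∃ r : ℝ, 0 < r ∧ u.dir = r • F.dir

variable {F} {u : ReferencePoint}

lemma IsAdapted.isPositive_line (hu : F.IsAdapted u) {s θ d : ℝ}
    (h : 0 < sin θ ∨ sin θ = 0 ∧ 0 < d) : u.IsPositive (F.line s θ d) := by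
  obtain ⟨hbase, r, hr, hdir⟩ := hu
  have hscale := F.scale_pos
  simp only [ReferencePoint.IsPositive, line, hbase, hdir, smul_smul, eval_aff]
  rcases h with h | ⟨h, hd⟩
  · have htop : Filter.Tendsto (fun t : ℝ => F.scale * d + sin θ * (t * r)) .atTop .atTop :=
      Filter.tendsto_atTop_add_const_left _ _
        ((Filter.tendsto_id.atTop_mul_const hr).const_mul_atTop h)
    filter_upwards [htop.eventually_gt_atTop 0] with t ht
    positivity
  · filter_upwards with t
    rw [h, zero_mul, add_zero]
    positivity

lemma IsAdapted.isPositive_translate_iff (hu : F.IsAdapted u) (f : AffineForm) (w : ℝ) :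
    u.IsPositive (f.translate (w • F.dir)) ↔ u.IsPositive f := by
  obtain ⟨-, r, hr, hdir⟩ := hu
  have himp (f : AffineForm) (w : ℝ) (hf : u.IsPositive f) :
      u.IsPositive (f.translate (w • F.dir)) := by
    have hshift := Filter.tendsto_atTop_add_const_right Filter.atTop (-(w / r)) Filter.tendsto_id
    filter_upwards [hshift.eventually hf] with t ht
    have heval : f.eval (u.base + (id t + -(w / r)) • u.dir)
        = (f.translate (w • F.dir)).eval (u.base + t • u.dir) := by
      simp only [AffineForm.eval, AffineForm.translate, hdir, inner_add_right, id,
        real_inner_smul_right]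
      field_simp
      ring
    rwa [← heval]
  refine ⟨fun h => ?_, himp f w⟩
  have hback := himp _ (-w) h
  rwa [AffineForm.translate_translate, ← add_smul, neg_add_cancel, zero_smul,
    AffineForm.translate_zero] at hback

end BeltFrame

/-! ### Mutation of labelled seeds -/

lemma ReferencePoint.not_isPositive_of_isPositive_neg {u : ReferencePoint} {f : AffineForm}
    (h : u.IsPositive (-f)) : ¬u.IsPositive f := by
  intro h'
  obtain ⟨t, hneg, hpos⟩ := (h.and h').exists
  simp only [AffineForm.eval, Prod.fst_neg, Prod.snd_neg, inner_neg_left] at hneg hpos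
  linarith

lemma ReferencePoint.isPositive_neg_iff {u : ReferencePoint} {f : AffineForm}
    (h : u.IsPositive f ∨ u.IsPositive (-f)) : u.IsPositive (-f) ↔ ¬u.IsPositive f :=
  ⟨ReferencePoint.not_isPositive_of_isPositive_neg, h.resolve_left⟩

lemma mutateMatrix_mutateMatrix (k : Fin 3) (B : Matrix (Fin 3) (Fin 3) ℝ) :
    mutateMatrix k (mutateMatrix k B) = B := by
  ext i j
  by_cases h : k = i ∨ k = j
  · simp [mutateMatrix, h]
  · simp only [mutateMatrix, Matrix.of_apply, h, or_true, true_or, if_true, if_false, abs_neg]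
    ring

lemma AffineForm.form_sub_smul_neg {f g : AffineForm} (hg : g.form g = 2) :
    AffineForm.form (f - f.form g • g) (-g) = f.form g := by
  have hexpand : AffineForm.form (f - f.form g • g) (-g) = -f.form g + f.form g * g.form g := by
    simp only [AffineForm.form, Prod.fst_sub, Prod.smul_fst, Prod.fst_neg, inner_sub_left,
      inner_neg_right, real_inner_smul_left]
    ring
  rw [hexpand, hg]
  ring

namespace LabelledSeed

variable {u : ReferencePoint}

lemma mutate_v_self (u : ReferencePoint) (k : Fin 3) (s : LabelledSeed) :
    (s.mutate u k).v k = -s.v k := if_pos rfl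

/-- The condition for the side `i` to be reflected by the mutation at `k`. -/
def IsReflected (u : ReferencePoint) (k i : Fin 3) (s : LabelledSeed) : Prop :=
  (u.IsPositive (s.v k) ∧ s.B i k < 0) ∨ (¬u.IsPositive (s.v k) ∧ 0 < s.B i k)

section

variable {k i : Fin 3} {s : LabelledSeed}

lemma mutate_v_of_isReflected (hi : i ≠ k) (h : s.IsReflected u k i) :
    (s.mutate u k).v i = s.v i - (s.v i).form (s.v k) • s.v k :=
  (if_neg hi).trans (if_pos h)

lemma mutate_v_of_not_isReflected (hi : i ≠ k) (h : ¬s.IsReflected u k i) :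
    (s.mutate u k).v i = s.v i :=
  (if_neg hi).trans (if_neg h)

lemma mutate_v_eq_self_of_isPositive (hi : i ≠ k) (hk : u.IsPositive (s.v k)) (hB : 0 ≤ s.B i k) :
    (s.mutate u k).v i = s.v i :=
  mutate_v_of_not_isReflected hi fun h => h.elim (fun h => h.2.not_ge hB) fun h => h.1 hk

lemma mutate_v_eq_self_of_not_isPositive (hi : i ≠ k) (hk : ¬u.IsPositive (s.v k))
    (hB : s.B i k ≤ 0) : (s.mutate u k).v i = s.v i :=
  mutate_v_of_not_isReflected hi fun h => h.elim (fun h => hk h.1) fun h => h.2.not_ge hB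

lemma mutate_v_of_isPositive (hi : i ≠ k) (hk : u.IsPositive (s.v k)) (hB : s.B i k ≤ 0)
    (hform : (s.v i).form (s.v k) = s.B i k) :
    (s.mutate u k).v i = s.v i - s.B i k • s.v k := by
  rcases hB.eq_or_lt with h0 | hneg
  · rw [mutate_v_eq_self_of_isPositive hi hk h0.ge, h0, zero_smul, sub_zero]
  · rw [mutate_v_of_isReflected hi (.inl ⟨hk, hneg⟩), hform]

lemma mutate_v_of_not_isPositive (hi : i ≠ k) (hk : ¬u.IsPositive (s.v k)) (hB : 0 ≤ s.B i k)
    (hform : (s.v i).form (s.v k) = -s.B i k) :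
    (s.mutate u k).v i = s.v i - (-s.B i k) • s.v k := by
  rcases hB.eq_or_lt' with h0 | hpos
  · rw [mutate_v_eq_self_of_not_isPositive hi hk h0.le, h0, neg_zero, zero_smul, sub_zero]
  · rw [mutate_v_of_isReflected hi (.inr ⟨hk, hpos⟩), hform]

end

lemma relabel_relabel (σ τ : Equiv.Perm (Fin 3)) (s : LabelledSeed) :
    (s.relabel σ).relabel τ = s.relabel (σ * τ) := rfl

lemma relabel_one (s : LabelledSeed) : s.relabel 1 = s := rfl

lemma mutate_relabel (u : ReferencePoint) (k : Fin 3) (σ : Equiv.Perm (Fin 3)) (s : LabelledSeed) :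
    (s.relabel σ).mutate u k = (s.mutate u (σ k)).relabel σ := by
  refine LabelledSeed.ext (funext fun i => ?_) ?_
  · change _ = (s.mutate u (σ k)).v (σ i)
    by_cases hi : i = k
    · rw [hi, mutate_v_self, mutate_v_self, relabel]
    · have hi' : σ i ≠ σ k := σ.injective.ne hi
      have hiff : (s.relabel σ).IsReflected u k i ↔ s.IsReflected u (σ k) (σ i) := Iff.rfl
      by_cases h : s.IsReflected u (σ k) (σ i)
      · rw [mutate_v_of_isReflected hi' h, mutate_v_of_isReflected hi (hiff.2 h), relabel]
      · rw [mutate_v_of_not_isReflected hi' h, mutate_v_of_not_isReflected hi (hiff.not.2 h),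
          relabel]
  · ext i j
    simp [mutate, relabel, mutateMatrix]

lemma mutate_translate {F : BeltFrame} (hu : F.IsAdapted u) (k : Fin 3) (w : ℝ)
    (s : LabelledSeed) :
    (s.translate (w • F.dir)).mutate u k = (s.mutate u k).translate (w • F.dir) := by
  refine LabelledSeed.ext (funext fun i => ?_) rfl
  change _ = ((s.mutate u k).v i).translate _
  by_cases hi : i = k
  · rw [hi, mutate_v_self, mutate_v_self]
    refine Prod.ext rfl ?_
    simp only [translate, AffineForm.translate, Prod.snd_neg, Prod.fst_neg, inner_neg_left]
    ring
  · have hiff : (s.translate (w • F.dir)).IsReflected u k i ↔ s.IsReflected u k i := by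
      simp only [IsReflected, translate, hu.isPositive_translate_iff]
    by_cases h : s.IsReflected u k i
    · rw [mutate_v_of_isReflected hi h, mutate_v_of_isReflected hi (hiff.2 h)]
      refine Prod.ext rfl ?_
      simp only [translate, AffineForm.translate, AffineForm.form, Prod.fst_sub, Prod.snd_sub,
        Prod.smul_fst, Prod.smul_snd, smul_eq_mul, inner_sub_left, real_inner_smul_left]
      ring
    · rw [mutate_v_of_not_isReflected hi h, mutate_v_of_not_isReflected hi (hiff.not.2 h)]
      rfl

lemma mutate_mutate {s : LabelledSeed} {k : Fin 3} (hform : (s.v k).form (s.v k) = 2)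
    (hk : u.IsPositive (-s.v k) ↔ ¬u.IsPositive (s.v k)) :
    (s.mutate u k).mutate u k = s := by
  refine LabelledSeed.ext (funext fun i => ?_) (mutateMatrix_mutateMatrix k s.B)
  by_cases hi : i = k
  · rw [hi, mutate_v_self, mutate_v_self, neg_neg]
  · have hB : (s.mutate u k).B i k = -s.B i k := by simp [mutate, mutateMatrix]
    have hiff : (s.mutate u k).IsReflected u k i ↔ s.IsReflected u k i := by
      simp only [IsReflected, mutate_v_self, hB, hk, not_not, Left.neg_neg_iff, Left.neg_pos_iff]
      exact or_comm
    by_cases h : s.IsReflected u k i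
    · rw [mutate_v_of_isReflected hi (hiff.2 h), mutate_v_self, mutate_v_of_isReflected hi h,
        AffineForm.form_sub_smul_neg hform]
      module
    · rw [mutate_v_of_not_isReflected hi (hiff.not.2 h), mutate_v_of_not_isReflected hi h]

end LabelledSeed

/-- The exchange matrix of a quiver with the weights `x`, `y`, `z` on the arrows `0 ⟶ 1`, `1 ⟶ 2`
and `0 ⟶ 2`. -/
def skewMatrix (x y z : ℝ) : Matrix (Fin 3) (Fin 3) ℝ := !![0, x, z; -x, 0, y; -z, -y, 0]

section skewMatrix

variable (x y z : ℝ)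

lemma mutateMatrix_zero_skewMatrix :
    mutateMatrix 0 (skewMatrix x y z) = skewMatrix (-x) (y + (|x| * z - x * |z|) / 2) (-z) := by
  ext i j
  fin_cases i <;> fin_cases j <;> simp [mutateMatrix, skewMatrix] <;> ring

lemma mutateMatrix_one_skewMatrix :
    mutateMatrix 1 (skewMatrix x y z) = skewMatrix (-x) (-y) (z + (x * |y| + |x| * y) / 2) := by
  ext i j
  fin_cases i <;> fin_cases j <;> simp [mutateMatrix, skewMatrix] <;> ring

lemma mutateMatrix_two_skewMatrix :
    mutateMatrix 2 (skewMatrix x y z) = skewMatrix (x + (z * |y| - |z| * y) / 2) (-y) (-z) := by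
  ext i j
  fin_cases i <;> fin_cases j <;> simp [mutateMatrix, skewMatrix] <;> ring

lemma skewMatrix_submatrix_swap_zero_one :
    (skewMatrix x y z).submatrix (Equiv.swap 0 1) (Equiv.swap 0 1) = skewMatrix (-x) z y := by
  ext i j
  fin_cases i <;> fin_cases j <;> simp [skewMatrix, Equiv.swap_apply_of_ne_of_ne]

lemma skewMatrix_submatrix_swap_one_two :
    (skewMatrix x y z).submatrix (Equiv.swap 1 2) (Equiv.swap 1 2) = skewMatrix z (-y) x := by
  ext i j
  fin_cases i <;> fin_cases j <;> simp [skewMatrix, Equiv.swap_apply_of_ne_of_ne]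

lemma skewMatrix_submatrix_finRotate :
    (skewMatrix x y z).submatrix (finRotate 3) (finRotate 3) = skewMatrix y (-z) (-x) := by
  ext i j
  fin_cases i <;> fin_cases j <;> simp [skewMatrix]

lemma skewMatrix_submatrix_finRotate_symm :
    (skewMatrix x y z).submatrix (finRotate 3).symm (finRotate 3).symm
      = skewMatrix (-z) x (-y) := by
  have hrotate := skewMatrix_submatrix_finRotate (-z) x (-y)
  rw [neg_neg, neg_neg] at hrotate
  rw [← hrotate, Matrix.submatrix_submatrix, Equiv.self_comp_symm, Matrix.submatrix_id_id]

end skewMatrix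

/-! ### Seeds along a belt line -/

lemma LabelledSeed.relabel_ext_fin {s t : LabelledSeed} {τ : Equiv.Perm (Fin 3)}
    (h₀ : s.v (τ 0) = t.v 0) (h₁ : s.v (τ 1) = t.v 1) (h₂ : s.v (τ 2) = t.v 2)
    (hB : s.B.submatrix τ τ = t.B) : s.relabel τ = t :=
  LabelledSeed.ext (funext fun i => by fin_cases i <;> assumption) hB

namespace BeltFrame

variable (F : BeltFrame) {u : ReferencePoint}

/-- The seed with angle `a` between the sides `1` and `2`, angle `c` between the sides `0` and
`1`, and angle `π - a - c` between the sides `0` and `2`, whose quiver contains the path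
`0 ⟶ 1 ⟶ 2`. The altitude on the side `0` has its foot at the point `p` of the belt line, and
`s = ± 1` determines the orientation. -/
def seed (a c s p : ℝ) : LabelledSeed where
  v := ![F.line s a (-(p * sin a)),
    F.line s (π + a - c) (cos c / sin a - p * sin (c - a)),
    F.line s (-c) (p * sin c - cos (a + c) / sin a)]
  B := skewMatrix (2 * cos c) (2 * cos a) (-(2 * cos (a + c)))

lemma seed_v_zero (a c s p : ℝ) : (F.seed a c s p).v 0 = F.line s a (-(p * sin a)) := rfl

lemma seed_v_one (a c s p : ℝ) : (F.seed a c s p).v 1 =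
    F.line s (π + a - c) (cos c / sin a - p * sin (c - a)) := rfl

lemma seed_v_two (a c s p : ℝ) : (F.seed a c s p).v 2 =
    F.line s (-c) (p * sin c - cos (a + c) / sin a) := rfl

lemma seed_B (a c s p : ℝ) : (F.seed a c s p).B =
    skewMatrix (2 * cos c) (2 * cos a) (-(2 * cos (a + c))) := rfl

lemma seed_form_self {s : ℝ} (hs : s ^ 2 = 1) (a c p : ℝ) (k : Fin 3) :
    ((F.seed a c s p).v k).form ((F.seed a c s p).v k) = 2 := by
  fin_cases k <;> exact form_line_self _ _ hs

lemma seed_translate (a c s p w : ℝ) :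
    (F.seed a c s p).translate ((F.scale * w) • F.dir) = F.seed a c s (p + w) := by
  refine LabelledSeed.ext (funext fun i => ?_) rfl
  fin_cases i <;> refine (translate_line _ _ _).trans (line_congr 0 (by simp) ?_)
  · ring
  · rw [show π + a - c = π - (c - a) by ring, sin_pi_sub]
    ring
  · rw [sin_neg]
    ring

/-- The range of the angles for which `BeltFrame.seed` occurs in a mutation class. -/
structure AdmissibleAngles (a c : ℝ) : Prop where
  pos : 0 < a
  le_pi_div_two : a ≤ π / 2
  nonneg : 0 ≤ c
  le_pi_div_two' : c ≤ π / 2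
  add_lt_pi : a + c < π
  ne_pi_div_two : c = 0 → a ≠ π / 2

namespace AdmissibleAngles

variable {a c : ℝ}

lemma sin_pos (h : AdmissibleAngles a c) : 0 < sin a :=
  sin_pos_of_pos_of_lt_pi h.pos (by linarith [h.nonneg, h.add_lt_pi])

lemma sin_add_pos (h : AdmissibleAngles a c) : 0 < sin (a + c) :=
  sin_pos_of_pos_of_lt_pi (by linarith [h.pos, h.nonneg]) h.add_lt_pi

lemma cos_nonneg (h : AdmissibleAngles a c) : 0 ≤ cos a :=
  cos_nonneg_of_mem_Icc ⟨by linarith [h.pos, pi_pos], h.le_pi_div_two⟩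

lemma cos_nonneg' (h : AdmissibleAngles a c) : 0 ≤ cos c :=
  cos_nonneg_of_mem_Icc ⟨by linarith [h.nonneg, pi_pos], h.le_pi_div_two'⟩

lemma cos_add_nonneg (h : AdmissibleAngles a c) (hac : a + c < π / 2) : 0 ≤ cos (a + c) :=
  cos_nonneg_of_mem_Icc ⟨by linarith [h.pos, h.nonneg, pi_pos], hac.le⟩

lemma cos_add_nonpos (h : AdmissibleAngles a c) (hac : π / 2 ≤ a + c) : cos (a + c) ≤ 0 :=
  cos_nonpos_of_pi_div_two_le_of_le hac (by linarith [h.add_lt_pi, pi_pos])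

end AdmissibleAngles

variable {F} {a c s : ℝ} (p : ℝ)

lemma isPositive_seed_v_zero (hu : F.IsAdapted u) (h : AdmissibleAngles a c) :
    u.IsPositive ((F.seed a c s p).v 0) :=
  hu.isPositive_line (.inl h.sin_pos)

lemma isPositive_seed_v_one (hu : F.IsAdapted u) (h : AdmissibleAngles a c) (hac : a ≤ c) :
    u.IsPositive ((F.seed a c s p).v 1) := by
  refine hu.isPositive_line ?_
  rw [show π + a - c = π - (c - a) by ring, sin_pi_sub]
  rcases hac.eq_or_lt with rfl | hlt
  · have hcos : 0 < cos a :=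
      cos_pos_of_mem_Ioo ⟨by linarith [h.pos, pi_pos], by linarith [h.add_lt_pi]⟩
    simpa using div_pos hcos h.sin_pos
  · exact .inl (sin_pos_of_pos_of_lt_pi (by linarith) (by linarith [h.pos, h.add_lt_pi]))

lemma isPositive_neg_seed_v_one (hu : F.IsAdapted u) (h : AdmissibleAngles a c) (hac : c < a) :
    u.IsPositive (-(F.seed a c s p).v 1) := by
  rw [seed_v_one, neg_line]
  refine hu.isPositive_line (.inl ?_)
  rw [show π + a - c + π = a - c + 2 * π by ring, sin_add_two_pi]
  exact sin_pos_of_pos_of_lt_pi (by linarith) (by linarith [h.nonneg, h.add_lt_pi])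

lemma isPositive_neg_seed_v_two (hu : F.IsAdapted u) (h : AdmissibleAngles a c) :
    u.IsPositive (-(F.seed a c s p).v 2) := by
  rw [seed_v_two, neg_line]
  refine hu.isPositive_line ?_
  rw [neg_add_eq_sub, sin_pi_sub]
  rcases h.nonneg.eq_or_lt with rfl | hc
  · have hcos : 0 < cos a := cos_pos_of_mem_Ioo
      ⟨by linarith [h.pos, pi_pos], h.le_pi_div_two.lt_of_ne (h.ne_pi_div_two rfl)⟩
    simpa using div_pos hcos h.sin_pos
  · exact .inl (sin_pos_of_pos_of_lt_pi hc (by linarith [h.pos, h.add_lt_pi]))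

lemma isPositive_neg_seed_v_iff (hu : F.IsAdapted u) (h : AdmissibleAngles a c) (k : Fin 3) :
    u.IsPositive (-(F.seed a c s p).v k) ↔ ¬u.IsPositive ((F.seed a c s p).v k) := by
  refine ReferencePoint.isPositive_neg_iff ?_
  fin_cases k
  · exact .inl (isPositive_seed_v_zero p hu h)
  · exact (le_or_gt a c).imp (isPositive_seed_v_one p hu h) (isPositive_neg_seed_v_one p hu h)
  · exact .inr (isPositive_neg_seed_v_two p hu h)

section mutation

variable {S : LabelledSeed} {i k : Fin 3} {θ d φ e r : ℝ}

lemma mutate_line_of_isPositive (hs : s ^ 2 = 1) (hik : i ≠ k) (hi : S.v i = F.line s θ d)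
    (hk : S.v k = F.line s φ e) (hpos : u.IsPositive (S.v k)) (hB : S.B i k = r) (hr : r ≤ 0)
    (hcos : r = 2 * cos (θ - φ)) :
    (S.mutate u k).v i = F.line s (2 * φ + π - θ) (d - r * e) := by
  have hform : (S.v i).form (S.v k) = S.B i k := by rw [hi, hk, form_line _ _ _ _ hs, hB, hcos]
  rw [LabelledSeed.mutate_v_of_isPositive hik hpos (hB.trans_le hr) hform, hB, hi, hk,
    line_sub_smul _ _ _ _ _ hcos]

lemma mutate_line_of_not_isPositive (hs : s ^ 2 = 1) (hik : i ≠ k) (hi : S.v i = F.line s θ d)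
    (hk : S.v k = F.line s φ e) (hpos : ¬u.IsPositive (S.v k)) (hB : -S.B i k = r) (hr : r ≤ 0)
    (hcos : r = 2 * cos (θ - φ)) :
    (S.mutate u k).v i = F.line s (2 * φ + π - θ) (d - r * e) := by
  have hform : (S.v i).form (S.v k) = -S.B i k := by rw [hi, hk, form_line _ _ _ _ hs, hB, hcos]
  rw [LabelledSeed.mutate_v_of_not_isPositive hik hpos (neg_nonpos.1 (hB.trans_le hr)) hform, hB,
    hi, hk, line_sub_smul _ _ _ _ _ hcos]

end mutation

lemma mutate_zero_v_one (hu : F.IsAdapted u) (h : AdmissibleAngles a c) (hs : s ^ 2 = 1) :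
    ((F.seed a c s p).mutate u 0).v 1 = F.line s (a + c) (cos c / sin a - p * sin (a + c)) := by
  rw [mutate_line_of_isPositive (r := -(2 * cos c)) hs (by decide) (seed_v_one _ _ _ _ _)
    (seed_v_zero _ _ _ _ _) (isPositive_seed_v_zero p hu h) rfl
    (by linarith [h.cos_nonneg']) (by rw [show π + a - c - a = π - c by ring, cos_pi_sub]; ring)]
  refine line_congr 0 (by ring) ?_
  rw [sin_add, sin_sub]
  ring

lemma mutate_two_v_one (hu : F.IsAdapted u) (h : AdmissibleAngles a c) (hs : s ^ 2 = 1) :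
    ((F.seed a c s p).mutate u 2).v 1 =
      F.line s (-(a + c)) (p * sin (a + c) - cos (a + (a + c)) / sin a) := by
  rw [mutate_line_of_not_isPositive (r := -(2 * cos a)) hs (by decide) (seed_v_one _ _ _ _ _)
    (seed_v_two _ _ _ _ _)
    (ReferencePoint.not_isPositive_of_isPositive_neg (isPositive_neg_seed_v_two p hu h)) rfl
    (by linarith [h.cos_nonneg])
    (by rw [show π + a - c - -c = a + π by ring, cos_add_pi]; ring)]
  refine line_congr 0 (by ring) ?_
  have hcos : cos c = cos a * cos (a + c) + sin a * sin (a + c) := by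
    rw [← cos_sub, sub_add_cancel_left, cos_neg]
  rw [cos_add a (a + c), hcos, sin_add, sin_sub]
  ring

lemma relabel_mutate_zero_source (hu : F.IsAdapted u) (h : AdmissibleAngles a c) (hs : s ^ 2 = 1)
    (hac : π / 2 ≤ a + c) :
    ((F.seed a c s p).mutate u 0).relabel (finRotate 3)
      = F.seed (π - a - c) a (-s)
          (p - 1 + cos a * cos (π - a - c) / (sin a * sin (π - a - c))) := by
  have hsin := h.sin_pos
  have hsin' := h.sin_add_pos
  have hcos := h.cos_nonneg'
  have hcos' := h.cos_add_nonpos hac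
  have hsc := sin_sq_add_cos_sq a
  have hsc' := sin_sq_add_cos_sq c
  rw [sub_sub, cos_pi_sub, sin_pi_sub]
  refine LabelledSeed.relabel_ext_fin ?_ ?_ ?_ ?_
  · refine (mutate_zero_v_one p hu h hs).trans ?_
    rw [seed_v_zero, line_neg_sign, sin_pi_sub]
    refine line_congr 0 (by ring) ?_
    field_simp
    simp only [sin_add, cos_add]
    grind
  · refine (mutate_line_of_isPositive (r := 2 * cos (a + c)) hs (by decide) (seed_v_two _ _ _ _ _)
      (seed_v_zero _ _ _ _ _) (isPositive_seed_v_zero p hu h) (neg_neg _) (by linarith)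
      (by rw [show -c - a = -(a + c) by ring, cos_neg])).trans ?_
    rw [seed_v_one, line_neg_sign, sin_pi_sub, show a - (π - (a + c)) = a + (a + c) - π by ring,
      sin_sub_pi]
    refine line_congr 1 (by ring) ?_
    field_simp
    simp only [sin_add, cos_add]
    grind
  · refine (LabelledSeed.mutate_v_self u 0 _).trans ?_
    rw [seed_v_two, line_neg_sign, seed_v_zero, neg_line, show π - (a + c) + a = π - c by ring,
      sin_pi_sub, cos_pi_sub]
    refine line_congr 0 (by ring) ?_
    field_simp
    simp only [sin_add, cos_add]
    grind
  · change (mutateMatrix 0 (skewMatrix _ _ _)).submatrix _ _ = skewMatrix _ _ _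
    rw [mutateMatrix_zero_skewMatrix, skewMatrix_submatrix_finRotate, neg_neg, neg_neg,
      abs_of_nonneg (by linarith), abs_of_nonneg (by linarith),
      show π - (a + c) + a = π - c by ring, cos_pi_sub, cos_pi_sub]
    ring_nf

lemma relabel_mutate_zero_cyclic (hu : F.IsAdapted u) (h : AdmissibleAngles a c) (hs : s ^ 2 = 1)
    (hac : a + c < π / 2) :
    ((F.seed a c s p).mutate u 0).relabel (Equiv.swap 0 1)
      = F.seed (a + c) c s (p - cos c / (sin a * sin (a + c))) := by
  have hsin := h.sin_pos
  have hsin' := h.sin_add_pos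
  have hcos := h.cos_nonneg'
  have hcos' := h.cos_add_nonneg hac
  have hsc := sin_sq_add_cos_sq a
  have hsc' := sin_sq_add_cos_sq c
  refine LabelledSeed.relabel_ext_fin ?_ ?_ ?_ ?_
  · refine (mutate_zero_v_one p hu h hs).trans (line_congr 0 (by ring) ?_)
    field_simp
    ring
  · refine (LabelledSeed.mutate_v_self u 0 _).trans ?_
    rw [seed_v_zero, neg_line, seed_v_one, sub_add_cancel_right, sin_neg]
    refine line_congr 0 (by ring) ?_
    field_simp
    ring
  · have hB : 0 ≤ (F.seed a c s p).B 2 0 := by change 0 ≤ -(-(2 * cos (a + c))); linarith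
    refine (LabelledSeed.mutate_v_eq_self_of_isPositive (by decide)
      (isPositive_seed_v_zero p hu h) hB).trans ?_
    refine line_congr 0 (by ring) ?_
    field_simp
    simp only [sin_add, cos_add]
    grind
  · change (mutateMatrix 0 (skewMatrix _ _ _)).submatrix _ _ = skewMatrix _ _ _
    rw [mutateMatrix_zero_skewMatrix, skewMatrix_submatrix_swap_zero_one, neg_neg, neg_neg,
      abs_neg, abs_of_nonneg (by linarith), abs_of_nonneg (by linarith)]
    simp only [sin_add, cos_add]
    congr 1
    grind

lemma relabel_mutate_one_left (hu : F.IsAdapted u) (h : AdmissibleAngles a c) (hs : s ^ 2 = 1)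
    (hac : a ≤ c) :
    ((F.seed a c s p).mutate u 1).relabel (Equiv.swap 1 2) = F.seed a (c - a) s p := by
  have hsin := h.sin_pos
  have hcos := h.cos_nonneg
  have hcos' := h.cos_nonneg'
  have hpos := isPositive_seed_v_one (s := s) p hu h hac
  have hsc := sin_sq_add_cos_sq a
  refine LabelledSeed.relabel_ext_fin ?_ ?_ ?_ ?_
  · have hB : 0 ≤ (F.seed a c s p).B 0 1 := by change 0 ≤ 2 * cos c; linarith
    exact LabelledSeed.mutate_v_eq_self_of_isPositive (by decide) hpos hB
  · refine (mutate_line_of_isPositive (r := -(2 * cos a)) hs (by decide) (seed_v_two _ _ _ _ _)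
      (seed_v_one _ _ _ _ _) hpos rfl (by linarith)
      (by rw [show -c - (π + a - c) = -(a + π) by ring, cos_neg, cos_add_pi]; ring)).trans ?_
    rw [seed_v_one]
    refine line_congr 1 (by ring) ?_
    field_simp
    simp only [sin_sub, cos_sub, cos_add]
    grind
  · refine (LabelledSeed.mutate_v_self u 1 _).trans ?_
    rw [seed_v_one, neg_line, seed_v_two, add_sub_cancel]
    exact line_congr 1 (by ring) (by ring)
  · change (mutateMatrix 1 (skewMatrix _ _ _)).submatrix _ _ = skewMatrix _ _ _
    rw [mutateMatrix_one_skewMatrix, skewMatrix_submatrix_swap_one_two, neg_neg, add_sub_cancel,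
      abs_of_nonneg (by linarith), abs_of_nonneg (by linarith), cos_add, cos_sub]
    congr 1
    ring

lemma relabel_mutate_one_right (hu : F.IsAdapted u) (h : AdmissibleAngles a c) (hs : s ^ 2 = 1)
    (hac : c < a) :
    ((F.seed a c s p).mutate u 1).relabel (Equiv.swap 0 1)
      = F.seed (a - c) c s (p + cos c / (sin a * sin (a - c))) := by
  have hsin := h.sin_pos
  have hsin' : 0 < sin (a - c) :=
    sin_pos_of_pos_of_lt_pi (by linarith) (by linarith [h.nonneg, h.add_lt_pi])
  have hcos := h.cos_nonneg
  have hcos' := h.cos_nonneg'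
  have hneg : sin (c - a) = -sin (a - c) := by rw [← sin_neg, neg_sub]
  have hpos := ReferencePoint.not_isPositive_of_isPositive_neg
    (isPositive_neg_seed_v_one (s := s) p hu h hac)
  have hsc := sin_sq_add_cos_sq a
  have hsc' := sin_sq_add_cos_sq c
  refine LabelledSeed.relabel_ext_fin ?_ ?_ ?_ ?_
  · refine (LabelledSeed.mutate_v_self u 1 _).trans ?_
    rw [seed_v_one, neg_line, seed_v_zero, hneg]
    refine line_congr 1 (by ring) ?_
    field_simp
    ring
  · refine (mutate_line_of_not_isPositive (r := -(2 * cos c)) hs (by decide) (seed_v_zero _ _ _ _ _)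
      (seed_v_one _ _ _ _ _) hpos rfl (by linarith)
      (by rw [show a - (π + a - c) = c - π by ring, cos_sub_pi]; ring)).trans ?_
    rw [seed_v_one]
    refine line_congr 1 (by ring) ?_
    rw [hneg, show c - (a - c) = -(a - c - c) by ring, sin_neg, sin_sub (a - c)]
    field_simp
    simp only [sin_sub, cos_sub]
    grind
  · have hB : (F.seed a c s p).B 2 1 ≤ 0 := by change -(2 * cos a) ≤ 0; linarith
    refine (LabelledSeed.mutate_v_eq_self_of_not_isPositive (by decide) hpos hB).trans ?_
    rw [seed_v_two, seed_v_two, sub_add_cancel]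
    refine line_congr 0 (by ring) ?_
    field_simp
    simp only [sin_sub, cos_add]
    grind
  · change (mutateMatrix 1 (skewMatrix _ _ _)).submatrix _ _ = skewMatrix _ _ _
    rw [mutateMatrix_one_skewMatrix, skewMatrix_submatrix_swap_zero_one, neg_neg, sub_add_cancel,
      abs_of_nonneg (by linarith), abs_of_nonneg (by linarith), cos_add, cos_sub]
    congr 1
    ring

lemma relabel_mutate_two_sink (hu : F.IsAdapted u) (h : AdmissibleAngles a c) (hs : s ^ 2 = 1)
    (hc : 0 < c) (hac : π / 2 ≤ a + c) :
    ((F.seed a c s p).mutate u 2).relabel (finRotate 3).symm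
      = F.seed c (π - a - c) (-s) (p + 1 - cos a * cos c / (sin a * sin c)) := by
  have hsin := h.sin_pos
  have hsin' : 0 < sin c := sin_pos_of_pos_of_lt_pi hc (by linarith [h.pos, h.add_lt_pi])
  have hcos := h.cos_nonneg
  have hcos' := h.cos_add_nonpos hac
  have hpos := ReferencePoint.not_isPositive_of_isPositive_neg
    (isPositive_neg_seed_v_two (s := s) p hu h)
  have hsc := sin_sq_add_cos_sq a
  have hsc' := sin_sq_add_cos_sq c
  rw [sub_sub]
  refine LabelledSeed.relabel_ext_fin ?_ ?_ ?_ ?_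
  · refine (LabelledSeed.mutate_v_self u 2 _).trans ?_
    rw [seed_v_two, neg_line, seed_v_zero, line_neg_sign]
    refine line_congr 0 (by ring) ?_
    field_simp
    simp only [cos_add]
    grind
  · refine (mutate_line_of_not_isPositive (r := 2 * cos (a + c)) hs (by decide)
      (seed_v_zero _ _ _ _ _) (seed_v_two _ _ _ _ _) hpos (neg_neg _) (by linarith)
      (by rw [sub_neg_eq_add])).trans ?_
    rw [seed_v_one, line_neg_sign, cos_pi_sub, sub_sub, sin_pi_sub]
    refine line_congr 0 (by ring) ?_
    field_simp
    simp only [sin_add, cos_add]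
    grind
  · refine (mutate_two_v_one p hu h hs).trans ?_
    rw [seed_v_two, line_neg_sign, sin_pi_sub, show c + (π - (a + c)) = π - a by ring, cos_pi_sub]
    refine line_congr (-1) (by push_cast; ring) ?_
    field_simp
    simp only [sin_add, cos_add]
    grind
  · change (mutateMatrix 2 (skewMatrix _ _ _)).submatrix _ _ = skewMatrix _ _ _
    rw [mutateMatrix_two_skewMatrix, skewMatrix_submatrix_finRotate_symm, neg_neg, neg_neg,
      abs_of_nonneg (by linarith), abs_of_nonneg (by linarith),
      show c + (π - (a + c)) = π - a by ring, cos_pi_sub, cos_pi_sub]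
    ring_nf

lemma relabel_mutate_two_cyclic (hu : F.IsAdapted u) (h : AdmissibleAngles a c) (hs : s ^ 2 = 1)
    (hac : a + c < π / 2) :
    ((F.seed a c s p).mutate u 2).relabel (Equiv.swap 1 2) = F.seed a (a + c) s p := by
  have hcos := h.cos_nonneg
  have hcos' := h.cos_add_nonneg hac
  have hpos := ReferencePoint.not_isPositive_of_isPositive_neg
    (isPositive_neg_seed_v_two (s := s) p hu h)
  have hsc := sin_sq_add_cos_sq a
  refine LabelledSeed.relabel_ext_fin ?_ ?_ ?_ ?_
  · have hB : (F.seed a c s p).B 0 2 ≤ 0 := by change -(2 * cos (a + c)) ≤ 0; linarith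
    exact LabelledSeed.mutate_v_eq_self_of_not_isPositive (by decide) hpos hB
  · refine (LabelledSeed.mutate_v_self u 2 _).trans ?_
    rw [seed_v_two, neg_line, seed_v_one, add_sub_cancel_left]
    exact line_congr 0 (by ring) (by ring)
  · exact mutate_two_v_one p hu h hs
  · change (mutateMatrix 2 (skewMatrix _ _ _)).submatrix _ _ = skewMatrix _ _ _
    rw [mutateMatrix_two_skewMatrix, skewMatrix_submatrix_swap_one_two, neg_neg, abs_neg,
      abs_of_nonneg (by linarith), abs_of_nonneg (by linarith)]
    simp only [sin_add, cos_add]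
    congr 1 <;> grind

end BeltFrame

/-! ### States -/

/-- The angle of which all angles of the seeds are multiples. -/
def unitAngle (n : ℕ) : ℝ := π / (2 * n)

section unitAngle

variable {n : ℕ}

lemma mul_unitAngle (hn : n ≠ 0) : n * unitAngle n = π / 2 := by
  rw [unitAngle]
  field_simp

lemma unitAngle_pos (hn : n ≠ 0) : 0 < unitAngle n := by
  rw [unitAngle]
  positivity

lemma mul_unitAngle_le_iff (hn : n ≠ 0) {k l : ℕ} : k * unitAngle n ≤ l * unitAngle n ↔ k ≤ l := by
  rw [mul_le_mul_iff_left₀ (unitAngle_pos hn), Nat.cast_le]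

lemma mul_unitAngle_lt_iff (hn : n ≠ 0) {k l : ℕ} : k * unitAngle n < l * unitAngle n ↔ k < l := by
  rw [mul_lt_mul_iff_left₀ (unitAngle_pos hn), Nat.cast_lt]

lemma two_mul_mul_unitAngle (hn : n ≠ 0) : (2 * n : ℕ) * unitAngle n = π := by
  rw [Nat.cast_mul, Nat.cast_two, mul_assoc, mul_unitAngle hn, mul_div_cancel₀ _ two_ne_zero]

lemma sub_sub_mul_unitAngle (hn : n ≠ 0) {a c : ℕ} (h : a + c ≤ 2 * n) :
    (2 * n - a - c : ℕ) * unitAngle n = π - a * unitAngle n - c * unitAngle n := by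
  rw [Nat.sub_sub, Nat.cast_sub h, sub_mul, two_mul_mul_unitAngle hn, Nat.cast_add, add_mul,
    sub_sub]

lemma cos_mul_unitAngle_pos_iff (hn : n ≠ 0) {k : ℕ} (hk : k ≤ 2 * n) :
    0 < cos (k * unitAngle n) ↔ k < n := by
  have hk' : k * unitAngle n ≤ π := by
    rwa [← two_mul_mul_unitAngle hn, mul_unitAngle_le_iff hn]
  have hk₀ : 0 ≤ k * unitAngle n := mul_nonneg k.cast_nonneg (unitAngle_pos hn).le
  rw [← mul_unitAngle_lt_iff hn, mul_unitAngle hn]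
  refine ⟨fun hcos => not_le.1 fun hle => ?_, fun hlt => ?_⟩
  · exact hcos.not_ge (cos_nonpos_of_pi_div_two_le_of_le hle (by linarith [pi_pos]))
  · exact cos_pos_of_mem_Ioo ⟨by linarith [pi_pos], hlt⟩

lemma cos_mul_unitAngle_neg_iff (hn : n ≠ 0) {k : ℕ} (hk : k ≤ 2 * n) :
    cos (k * unitAngle n) < 0 ↔ n < k := by
  have h := cos_mul_unitAngle_pos_iff hn (Nat.sub_le (2 * n) k)
  rw [Nat.cast_sub hk, sub_mul, two_mul_mul_unitAngle hn, cos_pi_sub, Left.neg_pos_iff] at h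
  rw [h]
  lia

lemma sin_mul_unitAngle_pos {k : ℕ} (hk₀ : 0 < k) (hk : k < 2 * n) :
    0 < sin (k * unitAngle n) := by
  have hn : n ≠ 0 := by lia
  refine sin_pos_of_pos_of_lt_pi (mul_pos (mod_cast hk₀) (unitAngle_pos hn)) ?_
  rwa [← two_mul_mul_unitAngle hn, mul_unitAngle_lt_iff hn]

end unitAngle

/-- The product of the cotangents of two multiples of the unit angle. -/
def cotCot (n a b : ℕ) : ℝ :=
  cos (a * unitAngle n) * cos (b * unitAngle n) / (sin (a * unitAngle n) * sin (b * unitAngle n))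

/-- The displacement of the altitude foot in the mutation of a triangle whose angles `a` and `b`,
before and after the mutation, differ by `c`. -/
def footShift (n c a b : ℕ) : ℝ :=
  cos (c * unitAngle n) / (sin (a * unitAngle n) * sin (b * unitAngle n))

/-- The combinatorial description of a seed: the parameters of `BeltFrame.seed`, with the two angles
as multiples of `π / 2n`. -/
@[ext]
structure BeltState where
  a : ℕ
  c : ℕ
  s : ℤˣ
  p : ℝ

namespace BeltState

/-- The states that occur for seeds whose angles are coprime multiples of `π / 2n`. -/
structure Admissible (n : ℕ) (D : BeltState) : Prop where
  two_le : 2 ≤ n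
  pos : 0 < D.a
  le : D.a ≤ n
  le' : D.c ≤ n
  eq_one_of_dvd : ∀ d, d ∣ D.a → d ∣ D.c → d ∣ 2 * n → d = 1

/-- The seed described by a state. -/
def toSeed (F : BeltFrame) (n : ℕ) (D : BeltState) : LabelledSeed :=
  F.seed (D.a * unitAngle n) (D.c * unitAngle n) (D.s : ℤ) D.p

/-- Translation along the belt line. -/
def shift (w : ℝ) (D : BeltState) : BeltState := ⟨D.a, D.c, D.s, D.p + w⟩

/-- Change of the orientation by a sign. -/
def flip (e : ℤˣ) (D : BeltState) : BeltState := ⟨D.a, D.c, e * D.s, D.p⟩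

/-- The effect of the mutations on states. -/
def step (n : ℕ) : Fin 3 → BeltState → BeltState
  | 0, D => if n ≤ D.a + D.c
      then ⟨2 * n - D.a - D.c, D.a, -D.s, D.p - 1 + cotCot n D.a (2 * n - D.a - D.c)⟩
      else ⟨D.a + D.c, D.c, D.s, D.p - footShift n D.c D.a (D.a + D.c)⟩
  | 1, D => if D.a ≤ D.c
      then ⟨D.a, D.c - D.a, D.s, D.p⟩
      else ⟨D.a - D.c, D.c, D.s, D.p + footShift n D.c D.a (D.a - D.c)⟩
  | 2, D => if n ≤ D.a + D.c
      then ⟨D.c, 2 * n - D.a - D.c, -D.s, D.p + 1 - cotCot n D.a D.c⟩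
      else ⟨D.a, D.a + D.c, D.s, D.p⟩

variable {n : ℕ} {D : BeltState}

lemma step_zero_of_le (h : n ≤ D.a + D.c) : D.step n 0 =
    ⟨2 * n - D.a - D.c, D.a, -D.s, D.p - 1 + cotCot n D.a (2 * n - D.a - D.c)⟩ := if_pos h

lemma step_zero_of_lt (h : D.a + D.c < n) : D.step n 0 =
    ⟨D.a + D.c, D.c, D.s, D.p - footShift n D.c D.a (D.a + D.c)⟩ := if_neg h.not_ge

lemma step_one_of_le (h : D.a ≤ D.c) : D.step n 1 = ⟨D.a, D.c - D.a, D.s, D.p⟩ := if_pos h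

lemma step_one_of_lt (h : D.c < D.a) : D.step n 1 =
    ⟨D.a - D.c, D.c, D.s, D.p + footShift n D.c D.a (D.a - D.c)⟩ := if_neg h.not_ge

lemma step_two_of_le (h : n ≤ D.a + D.c) : D.step n 2 =
    ⟨D.c, 2 * n - D.a - D.c, -D.s, D.p + 1 - cotCot n D.a D.c⟩ := if_pos h

lemma step_two_of_lt (h : D.a + D.c < n) : D.step n 2 = ⟨D.a, D.a + D.c, D.s, D.p⟩ :=
  if_neg h.not_ge

lemma step_shift (k : Fin 3) (w : ℝ) : (D.shift w).step n k = (D.step n k).shift w := by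
  match k with
  | 0 => by_cases h : n ≤ D.a + D.c <;> simp [step, shift, h] <;> ring
  | 1 => by_cases h : D.a ≤ D.c <;> simp [step, shift, h]; ring
  | 2 => by_cases h : n ≤ D.a + D.c <;> simp [step, shift, h]; ring

lemma step_flip (k : Fin 3) (e : ℤˣ) : (D.flip e).step n k = (D.step n k).flip e := by
  match k with
  | 0 | 2 => by_cases h : n ≤ D.a + D.c <;> simp [step, flip, h]
  | 1 => by_cases h : D.a ≤ D.c <;> simp [step, flip, h]

namespace Admissible

lemma ne_zero (h : D.Admissible n) : n ≠ 0 := by linarith [h.two_le]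

lemma add_lt (h : D.Admissible n) : D.a + D.c < 2 * n := by
  have htwo := h.two_le
  have hA := h.le
  have hC := h.le'
  by_contra! hle
  have hAn : n ∣ D.a := by rw [show D.a = n by lia]
  have hCn : n ∣ D.c := by rw [show D.c = n by lia]
  have hone := h.eq_one_of_dvd n hAn hCn (n.dvd_mul_left 2)
  lia

lemma lt_of_eq_zero (h : D.Admissible n) (hC : D.c = 0) : D.a < n := by
  refine h.le.lt_of_ne fun hA => ?_
  have hone := h.eq_one_of_dvd n hA.symm.dvd (hC ▸ n.dvd_zero) (n.dvd_mul_left 2)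
  linarith [h.two_le]

lemma pos_of_le (h : D.Admissible n) (hle : n ≤ D.a + D.c) : 0 < D.c := by
  by_contra! hC
  linarith [h.lt_of_eq_zero (Nat.le_zero.1 hC)]

lemma angles (h : D.Admissible n) :
    BeltFrame.AdmissibleAngles (D.a * unitAngle n) (D.c * unitAngle n) where
  pos := mul_pos (mod_cast h.pos) (unitAngle_pos h.ne_zero)
  le_pi_div_two := by rw [← mul_unitAngle h.ne_zero, mul_unitAngle_le_iff h.ne_zero]; exact h.le
  nonneg := mul_nonneg D.c.cast_nonneg (unitAngle_pos h.ne_zero).le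
  le_pi_div_two' := by rw [← mul_unitAngle h.ne_zero, mul_unitAngle_le_iff h.ne_zero]; exact h.le'
  add_lt_pi := by
    rw [← add_mul, ← Nat.cast_add, ← two_mul_mul_unitAngle h.ne_zero,
      mul_unitAngle_lt_iff h.ne_zero]
    exact h.add_lt
  ne_pi_div_two hC := by
    have hC' : D.c = 0 := mod_cast (mul_eq_zero.1 hC).resolve_right (unitAngle_pos h.ne_zero).ne'
    rw [← mul_unitAngle h.ne_zero]
    exact ((mul_unitAngle_lt_iff h.ne_zero).2 (h.lt_of_eq_zero hC')).ne

lemma shift (h : D.Admissible n) (w : ℝ) : (D.shift w).Admissible n :=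
  ⟨h.two_le, h.pos, h.le, h.le', h.eq_one_of_dvd⟩

lemma flip (h : D.Admissible n) (e : ℤˣ) : (D.flip e).Admissible n :=
  ⟨h.two_le, h.pos, h.le, h.le', h.eq_one_of_dvd⟩

lemma dvd_iff_of_dvd_sub (h : D.Admissible n) {d : ℕ} (hd : d ∣ 2 * n - D.a - D.c)
    (hdn : d ∣ 2 * n) : d ∣ D.a ↔ d ∣ D.c := by
  have hsum := Nat.dvd_sub hdn hd
  rw [show 2 * n - (2 * n - D.a - D.c) = D.a + D.c by have := h.add_lt; lia] at hsum
  exact ⟨fun hA => (Nat.dvd_add_right hA).1 hsum, fun hC => (Nat.dvd_add_left hC).1 hsum⟩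

lemma step (h : D.Admissible n) (k : Fin 3) : (D.step n k).Admissible n := by
  have hn := h.two_le
  have hpos := h.pos
  have hA := h.le
  have hC := h.le'
  have hAC := h.add_lt
  match k with
  | 0 =>
    rcases le_or_gt n (D.a + D.c) with hle | hlt
    · rw [step_zero_of_le hle]
      exact ⟨hn, by dsimp only; lia, by dsimp only; lia, hA, fun d hd hdA hdn =>
        h.eq_one_of_dvd d hdA ((h.dvd_iff_of_dvd_sub hd hdn).1 hdA) hdn⟩
    · rw [step_zero_of_lt hlt]
      exact ⟨hn, by dsimp only; lia, hlt.le, hC, fun d hd hdC =>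
        h.eq_one_of_dvd d ((Nat.dvd_add_left hdC).1 hd) hdC⟩
  | 1 =>
    rcases le_or_gt D.a D.c with hle | hlt
    · rw [step_one_of_le hle]
      exact ⟨hn, hpos, hA, by dsimp only; lia, fun d hdA hd =>
        h.eq_one_of_dvd d hdA ((Nat.dvd_sub_iff_left hle hdA).1 hd)⟩
    · rw [step_one_of_lt hlt]
      exact ⟨hn, by dsimp only; lia, by dsimp only; lia, hC, fun d hd hdC =>
        h.eq_one_of_dvd d ((Nat.dvd_sub_iff_left hlt.le hdC).1 hd) hdC⟩
  | 2 =>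
    rcases le_or_gt n (D.a + D.c) with hle | hlt
    · rw [step_two_of_le hle]
      exact ⟨hn, h.pos_of_le hle, hC, by dsimp only; lia, fun d hdC hd hdn =>
        h.eq_one_of_dvd d ((h.dvd_iff_of_dvd_sub hd hdn).2 hdC) hdC hdn⟩
    · rw [step_two_of_lt hlt]
      exact ⟨hn, hpos, hA, hlt.le, fun d hdA hd =>
        h.eq_one_of_dvd d hdA ((Nat.dvd_add_right hdA).1 hd)⟩

end Admissible

lemma sign_sq (e : ℤˣ) : ((e : ℤ) : ℝ) ^ 2 = 1 := by
  rcases Int.units_eq_one_or e with rfl | rfl <;> simp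

variable {F : BeltFrame} {u : ReferencePoint}

lemma toSeed_shift (w : ℝ) :
    (D.shift w).toSeed F n = (D.toSeed F n).translate ((F.scale * w) • F.dir) :=
  (F.seed_translate _ _ _ _ _).symm

lemma exists_relabel_mutate_eq (hu : F.IsAdapted u) (h : D.Admissible n) (k : Fin 3) :
    ∃ τ, ((D.toSeed F n).mutate u k).relabel τ = (D.step n k).toSeed F n := by
  have hn := h.ne_zero
  have hs := sign_sq D.s
  have hsum : (D.a + D.c : ℕ) * unitAngle n = D.a * unitAngle n + D.c * unitAngle n := by
    rw [Nat.cast_add, add_mul]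
  have hdiff := sub_sub_mul_unitAngle hn h.add_lt.le
  have hac : π / 2 ≤ D.a * unitAngle n + D.c * unitAngle n ↔ n ≤ D.a + D.c := by
    rw [← hsum, ← mul_unitAngle hn, mul_unitAngle_le_iff hn]
  match k with
  | 0 =>
    rcases le_or_gt n (D.a + D.c) with hle | hlt
    · refine ⟨_, (BeltFrame.relabel_mutate_zero_source D.p hu h.angles hs (hac.2 hle)).trans ?_⟩
      rw [step_zero_of_le hle]
      simp only [toSeed, cotCot, hdiff, Units.val_neg, Int.cast_neg]
    · refine ⟨_, (BeltFrame.relabel_mutate_zero_cyclic D.p hu h.angles hs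
        (not_le.1 (hac.not.2 hlt.not_ge))).trans ?_⟩
      rw [step_zero_of_lt hlt]
      simp only [toSeed, footShift, hsum]
  | 1 =>
    rcases le_or_gt D.a D.c with hle | hlt
    · refine ⟨_, (BeltFrame.relabel_mutate_one_left D.p hu h.angles hs
        ((mul_unitAngle_le_iff hn).2 hle)).trans ?_⟩
      rw [step_one_of_le hle]
      simp only [toSeed, Nat.cast_sub hle, sub_mul]
    · refine ⟨_, (BeltFrame.relabel_mutate_one_right D.p hu h.angles hs
        ((mul_unitAngle_lt_iff hn).2 hlt)).trans ?_⟩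
      rw [step_one_of_lt hlt]
      simp only [toSeed, footShift, Nat.cast_sub hlt.le, sub_mul]
  | 2 =>
    rcases le_or_gt n (D.a + D.c) with hle | hlt
    · have hC : 0 < D.c * unitAngle n := mul_pos (mod_cast h.pos_of_le hle) (unitAngle_pos hn)
      refine ⟨_, (BeltFrame.relabel_mutate_two_sink D.p hu h.angles hs hC (hac.2 hle)).trans ?_⟩
      rw [step_two_of_le hle]
      simp only [toSeed, cotCot, hdiff, Units.val_neg, Int.cast_neg]
    · refine ⟨_, (BeltFrame.relabel_mutate_two_cyclic D.p hu h.angles hs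
        (not_le.1 (hac.not.2 hlt.not_ge))).trans ?_⟩
      rw [step_two_of_lt hlt]
      simp only [toSeed, hsum]

lemma mutate_mutate_toSeed (hu : F.IsAdapted u) (h : D.Admissible n) (k : Fin 3) :
    ((D.toSeed F n).mutate u k).mutate u k = D.toSeed F n :=
  LabelledSeed.mutate_mutate (F.seed_form_self (sign_sq D.s) _ _ _ k)
    (BeltFrame.isPositive_neg_seed_v_iff D.p hu h.angles k)

/-- Two states are linked if they are related by a sequence of mutations. -/
def Linked (n : ℕ) : BeltState → BeltState → Prop :=
  Relation.EqvGen fun D D' => D.Admissible n ∧ ∃ k, D' = D.step n k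

namespace Linked

variable {D' D'' : BeltState}

lemma step (h : D.Admissible n) (k : Fin 3) : Linked n D (D.step n k) := .rel _ _ ⟨h, k, rfl⟩

lemma symm (h : Linked n D D') : Linked n D' D := Relation.EqvGen.symm _ _ h

lemma trans (h : Linked n D D') (h' : Linked n D' D'') : Linked n D D'' :=
  Relation.EqvGen.trans _ _ _ h h'

lemma shift (h : Linked n D D') (w : ℝ) : Linked n (D.shift w) (D'.shift w) := by
  induction h with
  | rel D D' h =>
    obtain ⟨h, k, rfl⟩ := h
    rw [← step_shift]
    exact step (h.shift w) k
  | refl D => exact .refl _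
  | symm _ _ _ ih => exact ih.symm
  | trans _ _ _ _ _ ih ih' => exact ih.trans ih'

lemma flip (h : Linked n D D') (e : ℤˣ) : Linked n (D.flip e) (D'.flip e) := by
  induction h with
  | rel D D' h =>
    obtain ⟨h, k, rfl⟩ := h
    rw [← step_flip]
    exact step (h.flip e) k
  | refl D => exact .refl _
  | symm _ _ _ ih => exact ih.symm
  | trans _ _ _ _ _ ih ih' => exact ih.trans ih'

lemma admissible_iff (h : Linked n D D') : D.Admissible n ↔ D'.Admissible n := by
  induction h with
  | rel D D' h =>
    obtain ⟨h, k, rfl⟩ := h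
    exact ⟨fun _ => h.step k, fun _ => h⟩
  | refl D => rfl
  | symm _ _ _ ih => exact ih.symm
  | trans _ _ _ _ _ ih ih' => exact ih.trans ih'

end Linked

end BeltState

/-! ### Seeds with the same shape -/

lemma perm_cases (τ : Equiv.Perm (Fin 3)) : τ = 1 ∨ τ = Equiv.swap 0 1 ∨ τ = Equiv.swap 1 2 ∨
    τ = Equiv.swap 0 2 ∨ τ = finRotate 3 ∨ τ = (finRotate 3).symm := by
  revert τ
  decide

lemma inner_eq_coordinates (a b : Plane) : inner ℝ a b = a 0 * b 0 + a 1 * b 1 := by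
  rw [PiLp.inner_apply, Fin.sum_univ_two]
  exact congrArg₂ _ (mul_comm _ _) (mul_comm _ _)

lemma sign_units_injective : Function.Injective fun e : ℤˣ => SignType.sign ((e : ℤ) : ℝ) := by
  intro e e' h
  rcases Int.units_eq_one_or e with rfl | rfl <;> rcases Int.units_eq_one_or e' with rfl | rfl <;>
    simp at h ⊢

namespace LabelledSeed

lemma interiorAngle_relabel (s : LabelledSeed) (τ : Equiv.Perm (Fin 3)) (i : Fin 3) :
    (s.relabel τ).interiorAngle i = s.interiorAngle (τ i) := by
  have hneighbours : (τ (i + 1) = τ i + 1 ∧ τ (i + 2) = τ i + 2) ∨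
      (τ (i + 1) = τ i + 2 ∧ τ (i + 2) = τ i + 1) := by
    revert τ i
    decide
  simp only [interiorAngle, relabel]
  rcases hneighbours with ⟨h₁, h₂⟩ | ⟨h₁, h₂⟩
  · rw [h₁, h₂]
  · rw [h₁, h₂, InnerProductGeometry.angle_comm]

lemma orientation_relabel (s : LabelledSeed) (τ : Equiv.Perm (Fin 3)) :
    (s.relabel τ).orientation =
      SignType.sign ((Equiv.Perm.sign τ : ℤ) : ℝ) * s.orientation := by
  simp only [orientation, relabel, ← sign_mul]
  congr 1
  have htwo : (-1 : Fin 3) = 2 := rfl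
  rcases perm_cases τ with rfl | rfl | rfl | rfl | rfl | rfl <;>
    simp [cross, Equiv.swap_apply_of_ne_of_ne, htwo] <;> ring

/-- The two seeds have the same angles, quiver and orientation. -/
structure SameShape (s t : LabelledSeed) : Prop where
  interiorAngle_eq : s.interiorAngle = t.interiorAngle
  quiver_eq : s.quiver = t.quiver
  orientation_eq : s.orientation = t.orientation

end LabelledSeed

namespace BeltFrame

open LabelledSeed

variable (F : BeltFrame)

lemma cross_sq : cross F.dir F.perp ^ 2 = 1 := by
  have hdir := F.dir_dir
  have hperp := F.perp_perp
  have horth := F.dir_perp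
  rw [inner_eq_coordinates] at hdir hperp horth
  rw [cross]
  linear_combination hdir * (F.perp 0 * F.perp 0 + F.perp 1 * F.perp 1) + hperp -
    (F.dir 0 * F.perp 0 + F.dir 1 * F.perp 1) * horth

lemma cross_ne_zero : cross F.dir F.perp ≠ 0 := by
  intro h
  simpa [h] using F.cross_sq

lemma cross_line (s θ φ d e : ℝ) : cross (F.line s θ d).1 (F.line s φ e).1 =
    2 * s * sin (θ - φ) * cross F.dir F.perp := by
  have hsqrt : √2 * √2 = (2 : ℝ) := mul_self_sqrt zero_le_two
  simp only [line, aff, cross, PiLp.smul_apply, PiLp.add_apply, smul_eq_mul, sin_sub]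
  linear_combination s * (sin θ * cos φ - cos θ * sin φ) *
    (F.dir 0 * F.perp 1 - F.dir 1 * F.perp 0) * hsqrt

lemma eq_zero_of_inner_eq_zero {w : Plane} (hdir : inner ℝ F.dir w = (0 : ℝ))
    (hperp : inner ℝ F.perp w = (0 : ℝ)) : w = 0 := by
  rw [inner_eq_coordinates] at hdir hperp
  have h : F.dir 0 * F.perp 1 - F.dir 1 * F.perp 0 ≠ 0 := F.cross_ne_zero
  ext i
  refine mul_left_cancel₀ h (.trans ?_ (mul_zero _).symm)
  match i with
  | 0 => linear_combination F.perp 1 * hdir - F.dir 1 * hperp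
  | 1 => linear_combination F.dir 0 * hperp - F.perp 0 * hdir

variable {F} {a c s : ℝ} (p : ℝ)

lemma norm_line (hs : s ^ 2 = 1) (θ d : ℝ) : ‖(F.line s θ d).1‖ = √2 := by
  rw [norm_eq_sqrt_real_inner]
  exact congrArg _ (form_line_self _ _ hs)

lemma pi_sub_angle_line {θ φ ψ d e : ℝ} (hs : s ^ 2 = 1) (hcos : cos (θ - φ) = -cos ψ)
    (hψ₀ : 0 ≤ ψ) (hψ : ψ ≤ π) :
    π - InnerProductGeometry.angle (F.line s θ d).1 (F.line s φ e).1 = ψ := by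
  have hform : inner ℝ (F.line s θ d).1 (F.line s φ e).1 = 2 * -cos ψ :=
    (form_line _ _ _ _ hs).trans (congrArg _ hcos)
  rw [InnerProductGeometry.angle, norm_line hs, norm_line hs, hform, mul_self_sqrt zero_le_two,
    mul_div_cancel_left₀ _ two_ne_zero, arccos_neg, arccos_cos hψ₀ hψ, sub_sub_cancel]

lemma interiorAngle_seed (hs : s ^ 2 = 1) (h : AdmissibleAngles a c) :
    (F.seed a c s p).interiorAngle = ![a, π - a - c, c] := by
  have ha := h.pos
  have hc := h.nonneg
  have hac := h.add_lt_pi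
  ext i
  fin_cases i
  · refine pi_sub_angle_line (ψ := a) hs ?_ ha.le (by linarith)
    rw [show π + a - c - -c = a + π by ring, cos_add_pi]
  · refine pi_sub_angle_line (ψ := π - a - c) hs ?_ (by linarith) (by linarith)
    rw [show -c - a = π - a - c - π by ring, cos_sub_pi]
  · refine pi_sub_angle_line (ψ := c) hs ?_ hc (by linarith)
    rw [show a - (π + a - c) = c - π by ring, cos_sub_pi]

lemma orientation_seed (h : AdmissibleAngles a c) : (F.seed a c s p).orientation =
    SignType.sign s * SignType.sign (-cross F.dir F.perp) := by
  have hsin : 0 ≤ sin c := sin_nonneg_of_nonneg_of_le_pi h.nonneg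
    (by linarith [h.le_pi_div_two', pi_pos])
  have hpos : 0 < 2 * (sin a + sin c + sin (a + c)) := by linarith [h.sin_pos, h.sin_add_pos]
  have hcross : cross ((F.seed a c s p).v 0).1 ((F.seed a c s p).v 1).1 +
      cross ((F.seed a c s p).v 1).1 ((F.seed a c s p).v 2).1 +
      cross ((F.seed a c s p).v 2).1 ((F.seed a c s p).v 0).1 =
      2 * (sin a + sin c + sin (a + c)) * (s * -cross F.dir F.perp) := by
    rw [seed_v_zero, seed_v_one, seed_v_two, cross_line, cross_line, cross_line,
      show a - (π + a - c) = c - π by ring, show π + a - c - -c = a + π by ring,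
      show -c - a = -(a + c) by ring, sin_sub_pi, sin_add_pi, sin_neg]
    ring
  rw [orientation, hcross, _root_.sign_mul, _root_.sign_pos hpos, one_mul, _root_.sign_mul]

lemma relabel_seed_pi_div_two_right (hsin : sin a ≠ 0) (hcos : cos a ≠ 0) :
    (F.seed a (π / 2) s p).relabel (Equiv.swap 0 1) = F.seed (π / 2 - a) (π / 2) (-s) p := by
  refine relabel_ext_fin ?_ ?_ ?_ ?_
  · refine (seed_v_one _ _ _ _ _).trans ?_
    rw [seed_v_zero, line_neg_sign]
    exact line_congr 0 (by ring) (by simp)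
  · refine (seed_v_zero _ _ _ _ _).trans ?_
    rw [seed_v_one, line_neg_sign, sub_sub_cancel]
    exact line_congr 0 (by ring) (by simp)
  · refine (seed_v_two _ _ _ _ _).trans ?_
    rw [seed_v_two, line_neg_sign, cos_add_pi_div_two, cos_add_pi_div_two, sin_pi_div_two_sub]
    exact line_congr (-1) (by push_cast; ring) (by field_simp)
  · refine (skewMatrix_submatrix_swap_zero_one _ _ _).trans ?_
    rw [seed_B, cos_pi_div_two, cos_add_pi_div_two, cos_add_pi_div_two, sin_pi_div_two_sub,
      cos_pi_div_two_sub, mul_zero, neg_zero, mul_neg, neg_neg, mul_neg, neg_neg]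

lemma relabel_seed_pi_div_two_left :
    (F.seed (π / 2) c s p).relabel (Equiv.swap 1 2) = F.seed (π / 2) (π / 2 - c) (-s) p := by
  refine relabel_ext_fin ?_ ?_ ?_ ?_
  · refine (seed_v_zero _ _ _ _ _).trans ?_
    rw [seed_v_zero, line_neg_sign]
    exact line_congr 0 (by ring) rfl
  · refine (seed_v_two _ _ _ _ _).trans ?_
    rw [seed_v_one, line_neg_sign, add_comm (π / 2), cos_add_pi_div_two, cos_pi_div_two_sub,
      sin_pi_div_two, sub_sub_cancel_left, sin_neg]
    exact line_congr 0 (by ring) (by ring)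
  · refine (seed_v_one _ _ _ _ _).trans ?_
    rw [seed_v_two, line_neg_sign, add_comm (π / 2), cos_add_pi_div_two, sin_pi_div_two_sub,
      sin_sub_pi_div_two, sin_pi_div_two]
    exact line_congr 0 (by ring) (by ring)
  · refine (skewMatrix_submatrix_swap_one_two _ _ _).trans ?_
    rw [seed_B, add_comm (π / 2), add_comm (π / 2), cos_add_pi_div_two, cos_add_pi_div_two,
      sin_pi_div_two_sub, cos_pi_div_two_sub, cos_pi_div_two, mul_zero, neg_zero, mul_neg, neg_neg,
      mul_neg, neg_neg]

end BeltFrame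

namespace BeltState

open LabelledSeed

variable {F : BeltFrame} {n : ℕ} {D D' : BeltState}

/-- The angles opposite to the sides, as multiples of the unit angle. -/
def angle (n : ℕ) (D : BeltState) : Fin 3 → ℕ := ![D.a, 2 * n - D.a - D.c, D.c]

/-- The adjacency relation of the quiver of a state. -/
def Arrow (n : ℕ) (D : BeltState) : Fin 3 → Fin 3 → Prop :=
  ![![False, D.c < n, n < D.a + D.c], ![False, False, D.a < n], ![D.a + D.c < n, False, False]]

namespace Admissible

lemma interiorAngle_toSeed (h : D.Admissible n) (i : Fin 3) :
    (D.toSeed F n).interiorAngle i = D.angle n i * unitAngle n := by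
  rw [toSeed, BeltFrame.interiorAngle_seed _ (sign_sq _) h.angles]
  match i with
  | 0 | 2 => rfl
  | 1 => exact (sub_sub_mul_unitAngle h.ne_zero h.add_lt.le).symm

lemma quiver_toSeed_adj (h : D.Admissible n) (i j : Fin 3) :
    (D.toSeed F n).quiver.Adj i j ↔ D.Arrow n i j := by
  change 0 < (D.toSeed F n).B i j ↔ _
  have hcosA := h.angles.cos_nonneg
  have hcosC := h.angles.cos_nonneg'
  have hA := cos_mul_unitAngle_pos_iff h.ne_zero (h.le.trans (Nat.le_mul_of_pos_left n two_pos))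
  have hC := cos_mul_unitAngle_pos_iff h.ne_zero (h.le'.trans (Nat.le_mul_of_pos_left n two_pos))
  have hpos := cos_mul_unitAngle_pos_iff h.ne_zero h.add_lt.le
  have hneg := cos_mul_unitAngle_neg_iff h.ne_zero h.add_lt.le
  rw [Nat.cast_add, add_mul] at hpos hneg
  have hneg' : 2 * cos (D.a * unitAngle n + D.c * unitAngle n) < 0 ↔ n < D.a + D.c := by
    rw [← hneg]; constructor <;> intro <;> linarith
  fin_cases i <;> fin_cases j <;> simp [toSeed, BeltFrame.seed, skewMatrix, Arrow, *]

lemma orientation_toSeed (h : D.Admissible n) : (D.toSeed F n).orientation =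
    SignType.sign ((D.s : ℤ) : ℝ) * SignType.sign (-cross F.dir F.perp) :=
  BeltFrame.orientation_seed _ h.angles

lemma relabel_toSeed_of_c_eq (h : D.Admissible n) (hC : D.c = n) :
    (D.toSeed F n).relabel (Equiv.swap 0 1) = (⟨n - D.a, n, -D.s, D.p⟩ : BeltState).toSeed F n := by
  have hlt : D.a < n := by have := h.add_lt; lia
  have hcos := (cos_mul_unitAngle_pos_iff h.ne_zero (by lia)).2 hlt
  rw [toSeed, hC, mul_unitAngle h.ne_zero,
    BeltFrame.relabel_seed_pi_div_two_right _ h.angles.sin_pos.ne' hcos.ne']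
  simp only [toSeed, Nat.cast_sub h.le, sub_mul, mul_unitAngle h.ne_zero, Units.val_neg,
    Int.cast_neg]

lemma relabel_toSeed_of_a_eq (h : D.Admissible n) (hA : D.a = n) :
    (D.toSeed F n).relabel (Equiv.swap 1 2) = (⟨n, n - D.c, -D.s, D.p⟩ : BeltState).toSeed F n := by
  rw [toSeed, hA, mul_unitAngle h.ne_zero, BeltFrame.relabel_seed_pi_div_two_left]
  simp only [toSeed, Nat.cast_sub h.le', sub_mul, mul_unitAngle h.ne_zero, Units.val_neg,
    Int.cast_neg]

lemma angle_eq_of_sameShape (h : D.Admissible n) (h' : D'.Admissible n) {τ : Equiv.Perm (Fin 3)}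
    (hshape : SameShape ((D'.toSeed F n).relabel τ) (D.toSeed F n)) (i : Fin 3) :
    D'.angle n (τ i) = D.angle n i := by
  have hangle := congrFun hshape.interiorAngle_eq i
  rw [interiorAngle_relabel, h.interiorAngle_toSeed, h'.interiorAngle_toSeed] at hangle
  exact Nat.cast_injective (mul_right_cancel₀ (unitAngle_pos h.ne_zero).ne' hangle)

lemma arrow_iff_of_sameShape (h : D.Admissible n) (h' : D'.Admissible n) {τ : Equiv.Perm (Fin 3)}
    (hshape : SameShape ((D'.toSeed F n).relabel τ) (D.toSeed F n)) (i j : Fin 3) :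
    D'.Arrow n (τ i) (τ j) ↔ D.Arrow n i j := by
  rw [← h.quiver_toSeed_adj (F := F), ← h'.quiver_toSeed_adj (F := F), ← hshape.quiver_eq]
  rfl

lemma sign_eq_of_sameShape (h : D.Admissible n) (h' : D'.Admissible n) {τ : Equiv.Perm (Fin 3)}
    (hshape : SameShape ((D'.toSeed F n).relabel τ) (D.toSeed F n)) :
    Equiv.Perm.sign τ * D'.s = D.s := by
  have horientation := hshape.orientation_eq
  rw [orientation_relabel, h.orientation_toSeed, h'.orientation_toSeed, ← mul_assoc] at horientation
  have hsign := mul_right_cancel₀ (sign_ne_zero.2 (neg_ne_zero.2 F.cross_ne_zero)) horientation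
  rw [← _root_.sign_mul, ← Int.cast_mul, ← Units.val_mul] at hsign
  exact sign_units_injective hsign

lemma perm_cases_of_angle_eq (h : D.Admissible n) (h' : D'.Admissible n)
    {τ : Equiv.Perm (Fin 3)} (hangles : ∀ i, D'.angle n (τ i) = D.angle n i)
    (harrow : ∀ i j, D'.Arrow n (τ i) (τ j) ↔ D.Arrow n i j) :
    τ = 1 ∨ (τ = Equiv.swap 0 1 ∧ D.c = n ∧ D'.c = n ∧ D.a = n - D'.a) ∨
      (τ = Equiv.swap 1 2 ∧ D.a = n ∧ D'.a = n ∧ D.c = n - D'.c) := by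
  have h₀ := hangles 0
  have h₁ := hangles 1
  have h₂ := hangles 2
  have h₀₁ := harrow 0 1
  have h₁₂ := harrow 1 2
  have h₀₂ := harrow 0 2
  have hA := h.le
  have hC := h.le'
  have hA' := h'.le
  have hC' := h'.le'
  have hlt := h.lt_of_eq_zero
  have hpos := h.pos
  have htwo : (-1 : Fin 3) = 2 := rfl
  rcases perm_cases τ with rfl | rfl | rfl | rfl | rfl | rfl <;>
    simp [angle, Arrow, Equiv.swap_apply_of_ne_of_ne, htwo] at h₀ h₁ h₂ h₀₁ h₁₂ h₀₂
  · exact .inl rfl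
  · exact .inr (.inl ⟨rfl, by lia, by lia, by lia⟩)
  · exact .inr (.inr ⟨rfl, by lia, by lia, by lia⟩)
  all_goals lia

theorem relabel_toSeed_eq (h : D.Admissible n) (h' : D'.Admissible n) {τ : Equiv.Perm (Fin 3)}
    (hshape : SameShape ((D'.toSeed F n).relabel τ) (D.toSeed F n)) :
    (D'.toSeed F n).relabel τ = (D.shift (D'.p - D.p)).toSeed F n := by
  have hangles := h.angle_eq_of_sameShape h' hshape
  have hsign := h.sign_eq_of_sameShape h' hshape
  have hp : D.p + (D'.p - D.p) = D'.p := add_sub_cancel _ _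
  rcases h.perm_cases_of_angle_eq h' hangles (h.arrow_iff_of_sameShape h' hshape) with
    rfl | ⟨rfl, hC, hC', hA⟩ | ⟨rfl, hA, hA', hC⟩
  · have hA : D'.a = D.a := hangles 0
    have hC : D'.c = D.c := hangles 2
    rw [map_one, one_mul] at hsign
    rw [relabel_one, BeltState.shift, hp, ← hA, ← hC, ← hsign]
  · rw [Equiv.Perm.sign_swap (by decide), neg_one_mul] at hsign
    rw [h'.relabel_toSeed_of_c_eq hC', BeltState.shift, hp, hA, hC, hsign]
  · rw [Equiv.Perm.sign_swap (by decide), neg_one_mul] at hsign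
    rw [h'.relabel_toSeed_of_a_eq hA', BeltState.shift, hp, hA, hC, hsign]

lemma eq_zero_of_translate_toSeed_eq (h : D.Admissible n) {w : Plane}
    (hw : (D.toSeed F n).translate w = D.toSeed F n) : w = 0 := by
  have hsq := sign_sq D.s
  have hsin := h.angles.sin_add_pos.ne'
  have hline {θ d : ℝ} (hfix : (F.line (D.s : ℤ) θ d).translate w = F.line (D.s : ℤ) θ d) :
      sin θ * inner ℝ F.dir w + (D.s : ℤ) * cos θ * inner ℝ F.perp w = (0 : ℝ) := by
    have hsnd := sub_eq_self.1 (congrArg Prod.snd hfix)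
    simp only [BeltFrame.line, BeltFrame.aff, real_inner_smul_left, inner_add_left] at hsnd
    exact (mul_eq_zero.1 hsnd).resolve_left (by norm_num)
  have h₀ := hline (congrFun (congrArg LabelledSeed.v hw) 0)
  have h₂ := hline (congrFun (congrArg LabelledSeed.v hw) 2)
  rw [sin_neg, cos_neg] at h₂
  refine F.eq_zero_of_inner_eq_zero (mul_left_cancel₀ hsin (.trans ?_ (mul_zero _).symm))
    (mul_left_cancel₀ hsin (.trans ?_ (mul_zero _).symm)) <;> rw [sin_add]
  · linear_combination cos (D.c * unitAngle n) * h₀ - cos (D.a * unitAngle n) * h₂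
  · linear_combination (D.s : ℤ) * (sin (D.c * unitAngle n) * h₀ + sin (D.a * unitAngle n) * h₂) -
      (sin (D.a * unitAngle n) * cos (D.c * unitAngle n) +
        cos (D.a * unitAngle n) * sin (D.c * unitAngle n)) * inner ℝ F.perp w * hsq

end Admissible

end BeltState

/-! ### Translations from the Euclidean algorithm -/

namespace BeltState

variable {n : ℕ} {D E E' : BeltState}

-- Mutation in the side opposite to the middle angle subtracts the smaller of the two outer angles
-- from the larger one, so that it runs the Euclidean algorithm.
lemma exists_linked_strip (h : D.Admissible n) :
    ∃ p, Linked n D ⟨Nat.gcd D.a D.c, 0, D.s, p⟩ := by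
  induction hN : D.a + D.c using Nat.strong_induction_on generalizing D with
  | _ N ih =>
    have hpos := h.pos
    have hstep := h.step 1
    have hlinked := Linked.step h 1
    rcases Nat.eq_zero_or_pos D.c with hc | hc
    · exact ⟨D.p, by rw [hc, Nat.gcd_zero_right, ← hc]; exact .refl _⟩
    rcases le_or_gt D.a D.c with hle | hlt
    · rw [step_one_of_le hle] at hstep hlinked
      obtain ⟨p, hp⟩ := ih (D.a + (D.c - D.a)) (by lia) hstep rfl
      rw [Nat.gcd_sub_self_right hle] at hp
      exact ⟨p, hlinked.trans hp⟩
    · rw [step_one_of_lt hlt] at hstep hlinked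
      obtain ⟨p, hp⟩ := ih (D.a - D.c + D.c) (by lia) hstep rfl
      rw [Nat.gcd_sub_self_left hlt.le] at hp
      exact ⟨p, hlinked.trans hp⟩

-- The state with angles `g` and the largest multiple of `g` that is at most `n` is linked to the
-- strip of angle `g`, and its mutation `0` to the strip of angle `1`.
lemma exists_linked_strip_one_of_coprime (hn : 2 ≤ n) {g : ℕ} (hpos : 0 < g) (hlt : g < n)
    (hg : Nat.Coprime g (2 * n)) : ∃ p p', Linked n ⟨g, 0, 1, p⟩ ⟨1, 0, -1, p'⟩ := by
  have hdiv := Nat.div_mul_le_self n g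
  have hdiv' := Nat.lt_div_mul_add (a := n) hpos
  have hle : n ≤ g + n / g * g := by lia
  have hE : Admissible n ⟨g, n / g * g, 1, 0⟩ :=
    ⟨hn, hpos, hlt.le, hdiv, fun d hd _ hdn => Nat.eq_one_of_dvd_coprimes hg hd hdn⟩
  have hstep := hE.step 0
  have hlinked := Linked.step hE 0
  rw [step_zero_of_le hle] at hstep hlinked
  have hgcd : Nat.gcd (2 * n - g - n / g * g) g = 1 := by
    rw [← Nat.gcd_add_mul_right_left _ _ (n / g + 1), add_one_mul,
      show 2 * n - g - n / g * g + (n / g * g + g) = 2 * n by lia]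
    exact hg.symm
  obtain ⟨p, hp⟩ := exists_linked_strip hE
  obtain ⟨p', hp'⟩ := exists_linked_strip hstep
  rw [Nat.gcd_mul_left_right] at hp
  rw [hgcd] at hp'
  exact ⟨p, p', hp.symm.trans (hlinked.trans hp')⟩

lemma exists_linked_strip_of_coprime (h : D.Admissible n) (hD : Nat.Coprime D.a D.c) {g : ℕ}
    (hpos : 0 < g) (hlt : g < n) (hg : Nat.Coprime g (2 * n)) :
    ∃ s p, Linked n D ⟨g, 0, s, p⟩ := by
  obtain ⟨p, hp⟩ := exists_linked_strip h
  obtain ⟨q, q', hq⟩ := exists_linked_strip_one_of_coprime h.two_le hpos hlt hg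
  have hq' := (hq.flip (-D.s)).shift (p - q')
  simp only [flip, shift, neg_mul_neg, mul_one, add_sub_cancel] at hq'
  rw [hD.gcd_eq_one] at hp
  exact ⟨_, _, hp.trans hq'.symm⟩

/-- The group of the translations along the belt line that preserve the class of a state under
`Linked`. -/
def shiftGroup (n : ℕ) (D : BeltState) : AddSubgroup ℝ where
  carrier := {w | Linked n D (D.shift w)}
  zero_mem' := by
    change Linked n D (D.shift 0)
    rw [shift, add_zero]
    exact .refl _
  add_mem' {w w'} hw hw' := by
    change Linked n D (D.shift (w + w'))
    have htrans := hw'.trans (hw.shift w')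
    simpa only [shift, add_assoc] using htrans
  neg_mem' {w} hw := by
    change Linked n D (D.shift (-w))
    have hsymm := hw.symm.shift (-w)
    simpa only [shift, add_neg_cancel_right] using hsymm

lemma sub_mem_shiftGroup (h : Linked n D E) (h' : Linked n D E')
    (hE : E' = E.shift (E'.p - E.p)) : E'.p - E.p ∈ shiftGroup n D := by
  rw [hE] at h'
  exact h'.trans (h.shift _).symm

-- The mutation `0` of the strip of angle `g` is a translation of it.
lemma inv_sin_sq_mem_shiftGroup (h : D.Admissible n) (hD : Nat.Coprime D.a D.c) {g : ℕ}
    (hpos : 0 < g) (hlt : g < n) (hg : Nat.Coprime g (2 * n)) :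
    1 / sin (g * unitAngle n) ^ 2 ∈ shiftGroup n D := by
  obtain ⟨s, p, hlinked⟩ := exists_linked_strip_of_coprime h hD hpos hlt hg
  have hstep := hlinked.trans (.step (hlinked.admissible_iff.1 h) 0)
  rw [step_zero_of_lt (by simpa using hlt)] at hstep
  have hmem := sub_mem_shiftGroup hlinked hstep (by simp [shift, sub_eq_add_neg])
  simpa [footShift, sq] using hmem

end BeltState

/-! ### The real part of the cyclotomic field -/

/-- The space of the real numbers in a subfield of the complex numbers. -/
def realElements (K : IntermediateField ℚ ℂ) : Submodule ℚ ℝ :=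
  K.toSubmodule.comap (Complex.ofRealAm.restrictScalars ℚ).toLinearMap

lemma mem_realElements {K : IntermediateField ℚ ℂ} {x : ℝ} : x ∈ realElements K ↔ (x : ℂ) ∈ K :=
  Iff.rfl

lemma one_mem_realElements (K : IntermediateField ℚ ℂ) : 1 ∈ realElements K := by
  rw [mem_realElements, Complex.ofReal_one]
  exact one_mem K

/-- The inclusion of the real elements of a field into the field. -/
def realElementsInclusion (K : IntermediateField ℚ ℂ) : realElements K →ₗ[ℚ] K :=
  ((Complex.ofRealAm.restrictScalars ℚ).toLinearMap ∘ₗ (realElements K).subtype).codRestrict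
    K.toSubmodule fun x => x.2

lemma realElementsInclusion_injective (K : IntermediateField ℚ ℂ) :
    Function.Injective (realElementsInclusion K) := fun _ _ h =>
  Subtype.ext (Complex.ofReal_injective (congrArg Subtype.val h))

-- If `z` is not real, then `1` and `z` are linearly independent over the real numbers, so that
-- `realElements K` and `z • realElements K` are independent subspaces of `K`.
lemma exists_injective_realElements_prod {K : IntermediateField ℚ ℂ} {z : ℂ} (hz : z ∈ K)
    (him : z.im ≠ 0) : ∃ f : realElements K × realElements K →ₗ[ℚ] K, Function.Injective f := by
  refine ⟨(realElementsInclusion K).coprod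
    (LinearMap.mulRight ℚ ⟨z, hz⟩ ∘ₗ realElementsInclusion K), ?_⟩
  rw [← LinearMap.ker_eq_bot, LinearMap.ker_eq_bot']
  rintro ⟨x, y⟩ h
  have hsum : ((x : ℝ) : ℂ) + ((y : ℝ) : ℂ) * z = 0 := congrArg Subtype.val h
  have hy : (y : ℝ) = 0 := by simpa [him] using congrArg Complex.im hsum
  have hx : (x : ℝ) = 0 := by simpa [hy] using congrArg Complex.re hsum
  exact Prod.ext (Subtype.ext hx) (Subtype.ext hy)

lemma finiteDimensional_realElements (K : IntermediateField ℚ ℂ) [FiniteDimensional ℚ K] :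
    FiniteDimensional ℚ (realElements K) :=
  FiniteDimensional.of_injective _ (realElementsInclusion_injective K)

lemma two_mul_finrank_realElements_le {K : IntermediateField ℚ ℂ} [FiniteDimensional ℚ K] {z : ℂ}
    (hz : z ∈ K) (him : z.im ≠ 0) :
    2 * Module.finrank ℚ (realElements K) ≤ Module.finrank ℚ K := by
  have := finiteDimensional_realElements K
  obtain ⟨f, hf⟩ := exists_injective_realElements_prod hz him
  rw [two_mul, ← Module.finrank_prod]
  exact LinearMap.finrank_le_finrank_of_injective hf

/-- The root of unity `exp (π I / n)` of order `2n`. -/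
def unitRoot (n : ℕ) : ℂ := Complex.exp (2 * Complex.I * unitAngle n)

/-- The field generated by the roots of unity of order `2n`. -/
def cyclotomicSubfield (n : ℕ) : IntermediateField ℚ ℂ := .adjoin ℚ {unitRoot n}

section cyclotomicSubfield

variable {n : ℕ}

lemma unitRoot_mem (n : ℕ) : unitRoot n ∈ cyclotomicSubfield n :=
  IntermediateField.mem_adjoin_simple_self ℚ _

lemma unitRoot_pow (k : ℕ) :
    unitRoot n ^ k = Complex.exp (2 * Complex.I * (k * unitAngle n)) := by
  rw [unitRoot, ← Complex.exp_nat_mul]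
  ring_nf

lemma isPrimitiveRoot_unitRoot (hn : n ≠ 0) : IsPrimitiveRoot (unitRoot n) (2 * n) := by
  convert Complex.isPrimitiveRoot_exp (2 * n) (by lia) using 1
  rw [unitRoot, unitAngle]
  push_cast
  ring_nf

lemma unitRoot_im_ne_zero (hn : 2 ≤ n) : (unitRoot n).im ≠ 0 := by
  have hexp : unitRoot n = Complex.exp (((2 : ℕ) * unitAngle n : ℝ) * Complex.I) := by
    rw [unitRoot]
    push_cast
    ring_nf
  rw [hexp, Complex.exp_ofReal_mul_I_im]
  exact (sin_mul_unitAngle_pos two_pos (by lia)).ne'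

lemma isCyclotomicExtension_cyclotomicSubfield (hn : n ≠ 0) :
    IsCyclotomicExtension {2 * n} ℚ (cyclotomicSubfield n) := by
  have : NeZero (2 * n) := ⟨by lia⟩
  have hroot := isPrimitiveRoot_unitRoot hn
  change IsCyclotomicExtension {2 * n} ℚ (cyclotomicSubfield n).toSubalgebra
  rw [cyclotomicSubfield, IntermediateField.adjoin_simple_toSubalgebra_of_isAlgebraic
    (hroot.isIntegral (by lia)).tower_top.isAlgebraic]
  exact hroot.adjoin_isCyclotomicExtension ℚ

lemma finiteDimensional_cyclotomicSubfield (hn : n ≠ 0) :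
    FiniteDimensional ℚ (cyclotomicSubfield n) :=
  have := isCyclotomicExtension_cyclotomicSubfield hn
  IsCyclotomicExtension.finiteDimensional {2 * n} ℚ _

lemma two_mul_finrank_realElements_cyclotomicSubfield_le (hn : 2 ≤ n) :
    2 * Module.finrank ℚ (realElements (cyclotomicSubfield n)) ≤ Nat.totient (2 * n) := by
  have : NeZero (2 * n) := ⟨by lia⟩
  have := finiteDimensional_cyclotomicSubfield (n := n) (by lia)
  have := isCyclotomicExtension_cyclotomicSubfield (n := n) (by lia)
  rw [← IsCyclotomicExtension.finrank (cyclotomicSubfield n)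
    (Polynomial.cyclotomic.irreducible_rat (n := 2 * n) (by lia))]
  exact two_mul_finrank_realElements_le (unitRoot_mem n) (unitRoot_im_ne_zero hn)

lemma cotCot_mem_realElements (a b : ℕ) : cotCot n a b ∈ realElements (cyclotomicSubfield n) := by
  have hpow (k : ℕ) : Complex.exp (2 * Complex.I * (k * unitAngle n)) ∈ cyclotomicSubfield n :=
    unitRoot_pow (n := n) k ▸ pow_mem (unitRoot_mem n) k
  have hone := one_mem (cyclotomicSubfield n)
  have hcot : (cotCot n a b : ℂ) =
      Complex.cot (a * unitAngle n) * Complex.cot (b * unitAngle n) := by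
    simp only [cotCot, Complex.cot]
    push_cast
    rw [div_mul_div_comm]
  rw [mem_realElements, hcot, Complex.cot_eq_exp_ratio, Complex.cot_eq_exp_ratio, div_mul_div_comm,
    mul_mul_mul_comm Complex.I, Complex.I_mul_I]
  exact div_mem (mul_mem (add_mem (hpow a) hone) (add_mem (hpow b) hone))
    (mul_mem (neg_mem hone) (mul_mem (sub_mem hone (hpow a)) (sub_mem hone (hpow b))))

lemma footShift_eq_cotCot_add_one {a b c : ℕ} (ha : sin (a * unitAngle n) ≠ 0)
    (hb : sin (b * unitAngle n) ≠ 0) (h : a + c = b ∨ b + c = a) :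
    footShift n c a b = cotCot n a b + 1 := by
  have hcos : cos (c * unitAngle n) = cos (a * unitAngle n - b * unitAngle n) := by
    rcases h with rfl | rfl
    · rw [Nat.cast_add, add_mul, sub_add_cancel_left, cos_neg]
    · rw [Nat.cast_add, add_mul, add_sub_cancel_left]
  rw [footShift, cotCot, div_add_one (mul_ne_zero ha hb), hcos, cos_sub]

end cyclotomicSubfield

namespace BeltState

variable {n : ℕ} {D D' : BeltState}

lemma Admissible.step_p_sub_mem_realElements (h : D.Admissible n) (k : Fin 3) :
    (D.step n k).p - D.p ∈ realElements (cyclotomicSubfield n) := by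
  have hone := one_mem_realElements (cyclotomicSubfield n)
  have hsin := h.angles.sin_pos.ne'
  have hsin' := (h.step k).angles.sin_pos.ne'
  match k with
  | 0 =>
    rcases le_or_gt n (D.a + D.c) with hle | hlt
    · rw [step_zero_of_le hle]
      convert sub_mem (cotCot_mem_realElements D.a (2 * n - D.a - D.c)) hone using 1
      ring
    · rw [step_zero_of_lt hlt] at hsin' ⊢
      rw [footShift_eq_cotCot_add_one hsin hsin' (.inl rfl), sub_sub_cancel_left]
      exact neg_mem (add_mem (cotCot_mem_realElements _ _) hone)
  | 1 =>
    rcases le_or_gt D.a D.c with hle | hlt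
    · rw [step_one_of_le hle, sub_self]
      exact zero_mem _
    · rw [step_one_of_lt hlt] at hsin' ⊢
      rw [footShift_eq_cotCot_add_one hsin hsin' (.inr (Nat.sub_add_cancel hlt.le)),
        add_sub_cancel_left]
      exact add_mem (cotCot_mem_realElements _ _) hone
  | 2 =>
    rcases le_or_gt n (D.a + D.c) with hle | hlt
    · rw [step_two_of_le hle]
      convert sub_mem hone (cotCot_mem_realElements D.a D.c) using 1
      ring
    · rw [step_two_of_lt hlt, sub_self]
      exact zero_mem _

lemma Linked.p_sub_mem_realElements (h : Linked n D D') :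
    D'.p - D.p ∈ realElements (cyclotomicSubfield n) := by
  induction h with
  | rel D D' h =>
    obtain ⟨h, k, rfl⟩ := h
    exact h.step_p_sub_mem_realElements k
  | refl D => rw [sub_self]; exact zero_mem _
  | symm D D' _ ih => rw [← neg_sub]; exact neg_mem ih
  | trans D D' D'' _ _ ih ih' => rw [← sub_add_sub_cancel]; exact add_mem ih' ih

end BeltState

/-! ### The rank of the lattice -/

lemma exists_algEquiv_apply_eq_pow {m : ℕ} [NeZero m] {L : Type*} [Field L] [Algebra ℚ L]
    [IsCyclotomicExtension {m} ℚ L] {z : L} (hz : z ^ m = 1) (u : (ZMod m)ˣ) :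
    ∃ σ : L ≃ₐ[ℚ] L, σ z = z ^ (u : ZMod m).val := by
  have hzeta := IsCyclotomicExtension.zeta_spec m ℚ L
  obtain ⟨σ, hσ⟩ := (IsCyclotomicExtension.autEquivPow L
    (Polynomial.cyclotomic.irreducible_rat (NeZero.pos m))).surjective u
  obtain ⟨k, -, rfl⟩ := hzeta.eq_pow_of_pow_eq_one hz
  refine ⟨σ, ?_⟩
  rw [map_pow, ← hσ, pow_right_comm]
  exact congrArg (· ^ k) (hzeta.autToPow_spec ℚ σ).symm

/-- The inverse square of the sine of a multiple of `π / 2n`, which depends only on the residue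
class of the factor modulo `2n`. -/
def invSinSq (n : ℕ) (x : ZMod (2 * n)) : ℝ := 1 / sin (x.val * unitAngle n) ^ 2

section invSinSq

variable {n : ℕ}

lemma invSinSq_nonneg (x : ZMod (2 * n)) : 0 ≤ invSinSq n x := by
  rw [invSinSq]
  positivity

lemma invSinSq_natCast (hn : n ≠ 0) (k : ℕ) :
    invSinSq n k = 1 / sin (k * unitAngle n) ^ 2 := by
  have hk : k * unitAngle n = (k % (2 * n) : ℕ) * unitAngle n + (k / (2 * n) : ℕ) * π := by
    rw [← two_mul_mul_unitAngle hn, ← mul_assoc, ← add_mul, ← Nat.cast_mul, ← Nat.cast_add,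
      Nat.mod_add_div']
  rw [invSinSq, ZMod.val_natCast, hk, sin_add_nat_mul_pi, mul_pow, ← pow_mul, mul_comm _ 2,
    pow_mul, neg_one_sq, one_pow, one_mul]

lemma invSinSq_neg (hn : n ≠ 0) (x : ZMod (2 * n)) : invSinSq n (-x) = invSinSq n x := by
  have : NeZero (2 * n) := ⟨by lia⟩
  have hx : -x = (2 * n - x.val : ℕ) := by
    rw [Nat.cast_sub x.val_le, ZMod.natCast_self, zero_sub, ZMod.natCast_zmod_val]
  rw [hx, invSinSq_natCast hn, Nat.cast_sub x.val_le, sub_mul, two_mul_mul_unitAngle hn,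
    sin_pi_sub, invSinSq]

lemma ofReal_invSinSq (x : ZMod (2 * n)) : (invSinSq n x : ℂ) =
    -4 * unitRoot n ^ x.val / (1 - unitRoot n ^ x.val) ^ 2 := by
  set w := Complex.exp (x.val * unitAngle n * Complex.I) with hw
  have hroot : unitRoot n ^ x.val = w ^ 2 := by
    rw [unitRoot_pow, hw, ← Complex.exp_nat_mul]
    push_cast
    ring_nf
  have hsin : ((w⁻¹ - w) * Complex.I / 2) ^ 2 = (1 - w ^ 2) ^ 2 / (-4 * w ^ 2) := by
    have hw₀ : w ≠ 0 := Complex.exp_ne_zero _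
    field_simp
    rw [Complex.I_sq]
    ring
  rw [hroot, invSinSq]
  push_cast
  rw [Complex.sin, neg_mul, Complex.exp_neg, ← hw, hsin, one_div_div]

-- The automorphism `ζ ↦ ζ ^ u` of the cyclotomic field maps `invSinSq n x` to `invSinSq n (x * u)`.
lemma sum_mul_invSinSq_mul_unit_eq_zero (hn : n ≠ 0) {ι : Type*} [Fintype ι] {c : ι → ℤ}
    {x : ι → ZMod (2 * n)} (h : ∑ i, c i * invSinSq n (x i) = 0) (u : (ZMod (2 * n))ˣ) :
    ∑ i, c i * invSinSq n (x i * u) = 0 := by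
  have : NeZero (2 * n) := ⟨by lia⟩
  have := isCyclotomicExtension_cyclotomicSubfield hn
  let z : cyclotomicSubfield n := ⟨unitRoot n, unitRoot_mem n⟩
  have hz : z ^ (2 * n) = 1 := Subtype.ext (isPrimitiveRoot_unitRoot hn).pow_eq_one
  let relation (y : ι → ZMod (2 * n)) : cyclotomicSubfield n :=
    ∑ i, c i * (-4 * z ^ (y i).val / (1 - z ^ (y i).val) ^ 2)
  have hrelation (y : ι → ZMod (2 * n)) :
      (relation y : ℂ) = (∑ i, c i * invSinSq n (y i) : ℝ) := by
    simp only [relation, Complex.ofReal_sum, Complex.ofReal_mul, ofReal_invSinSq]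
    simp only [AddSubmonoidClass.coe_finsetSum, MulMemClass.coe_mul, z]
    push_cast
    rfl
  obtain ⟨σ, hσ⟩ := exists_algEquiv_apply_eq_pow hz u
  have hconj : σ (relation x) = relation fun i => x i * u := by
    simp only [relation, map_sum, map_mul, map_div₀, map_neg, map_sub, map_pow, map_one,
      map_intCast, map_ofNat, hσ, ← pow_mul, ZMod.val_mul, mul_comm (x _).val,
      ← pow_eq_pow_mod _ hz]
  have hzero : relation x = 0 := by
    rw [← ZeroMemClass.coe_eq_zero, hrelation, h, Complex.ofReal_zero]
  rw [hzero, map_zero] at hconj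
  rw [← Complex.ofReal_eq_zero, ← hrelation, ← hconj, ZeroMemClass.coe_zero]

lemma sum_inv_odd_sq_le (N : ℕ) :
    ∑ m ∈ Finset.range N, 1 / (2 * m + 3 : ℝ) ^ 2 ≤ 1 / 4 - 1 / (4 * (N + 1 : ℝ)) := by
  induction N with
  | zero => norm_num
  | succ N ih =>
    have htelescope :
        1 / (2 * N + 3 : ℝ) ^ 2 ≤ 1 / (4 * (N + 1)) - 1 / (4 * (N + 1 + 1)) := by
      rw [div_sub_div _ _ (by positivity) (by positivity), div_le_div_iff₀ (by positivity)
        (by positivity)]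
      nlinarith
    rw [Finset.sum_range_succ]
    push_cast
    linarith

lemma sum_inv_sq_le_of_odd {s : Finset ℕ} (hs : ∀ k ∈ s, Odd k ∧ k ≠ 1) :
    ∑ k ∈ s, 1 / (k : ℝ) ^ 2 ≤ 1 / 4 := by
  have hsub : s ⊆ (Finset.range (s.sup id)).image fun m => 2 * m + 3 := by
    intro k hk
    obtain ⟨⟨m, rfl⟩, hm⟩ := hs k hk
    have hle : 2 * m + 1 ≤ s.sup id := Finset.le_sup (f := id) hk
    exact Finset.mem_image.2 ⟨m - 1, Finset.mem_range.2 (by lia), by lia⟩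
  refine (Finset.sum_le_sum_of_subset_of_nonneg hsub fun _ _ _ => by positivity).trans ?_
  rw [Finset.sum_image fun a _ b _ h => by simpa using h]
  have hsum := sum_inv_odd_sq_le (s.sup id)
  have hpos : (0 : ℝ) ≤ 1 / (4 * ((s.sup id : ℕ) + 1)) := by positivity
  push_cast
  linarith

lemma one_div_sin_sq_le {k : ℕ} (hk₀ : 0 < k) (hk : k ≤ n) :
    1 / sin (k * unitAngle n) ^ 2 ≤ n ^ 2 * (1 / k ^ 2 : ℝ) := by
  have hn : n ≠ 0 := by lia
  have hle : k * unitAngle n ≤ π / 2 := by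
    rwa [← mul_unitAngle hn, mul_unitAngle_le_iff hn]
  have hjordan := mul_le_sin (mul_nonneg k.cast_nonneg (unitAngle_pos hn).le) hle
  have heq : 2 / π * (k * unitAngle n) = k / n := by
    rw [unitAngle]
    field_simp
  have hpos : (0 : ℝ) < k / n := by positivity
  calc 1 / sin (k * unitAngle n) ^ 2 ≤ 1 / (k / n : ℝ) ^ 2 := by
        rw [heq] at hjordan
        gcongr
    _ = n ^ 2 * (1 / k ^ 2 : ℝ) := by field_simp

lemma sq_div_four_lt_invSinSq_one (hn : n ≠ 0) : n ^ 2 * (1 / 4) < invSinSq n 1 := by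
  have hpos := unitAngle_pos hn
  have hsin_pos : 0 < sin (unitAngle n) := by
    simpa using sin_mul_unitAngle_pos (n := n) one_pos (by lia)
  have hsin_le := sin_le hpos.le
  have hone := invSinSq_natCast hn 1
  rw [Nat.cast_one, Nat.cast_one, one_mul] at hone
  rw [hone]
  calc (n : ℝ) ^ 2 * (1 / 4) < n ^ 2 * (4 / π ^ 2) := by
        have := pi_lt_four
        gcongr ?_ * ?_
        rw [div_lt_div_iff₀ (by positivity) (by positivity)]
        nlinarith [pi_pos]
    _ = 1 / unitAngle n ^ 2 := by rw [unitAngle]; field_simp; norm_num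
    _ ≤ 1 / sin (unitAngle n) ^ 2 := by gcongr

end invSinSq

/-- The units modulo `2n` up to sign, which index the values of `invSinSq` at units. -/
abbrev UnitsModSign (n : ℕ) : Type := (ZMod (2 * n))ˣ ⧸ Subgroup.zpowers (-1 : (ZMod (2 * n))ˣ)

namespace UnitsModSign

variable {n : ℕ}

lemma mk_eq_mk_iff {u v : (ZMod (2 * n))ˣ} : (u : UnitsModSign n) = v ↔ u = v ∨ u = -v := by
  rw [QuotientGroup.eq_iff_div_mem, Subgroup.mem_zpowers_iff]
  refine ⟨?_, ?_⟩
  · rintro ⟨k, hk⟩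
    rw [eq_div_iff_mul_eq'] at hk
    rcases k.even_or_odd with hk' | hk'
    · exact .inl (by rw [← hk, hk'.neg_one_zpow, one_mul])
    · exact .inr (by rw [← hk, hk'.neg_one_zpow, neg_one_mul])
  · rintro (rfl | rfl)
    · exact ⟨0, by rw [zpow_zero, div_self']⟩
    · exact ⟨1, by rw [zpow_one, neg_div, div_self']⟩

lemma out_mk (u : (ZMod (2 * n))ˣ) :
    (u : UnitsModSign n).out = u ∨ (u : UnitsModSign n).out = -u :=
  mk_eq_mk_iff.1 (Quotient.out_eq' _)

lemma orderOf_neg_one (hn : 2 ≤ n) : orderOf (-1 : (ZMod (2 * n))ˣ) = 2 := by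
  have : Fact (2 < 2 * n) := ⟨by lia⟩
  refine orderOf_eq_prime (by rw [neg_one_sq]) fun h => ?_
  exact ZMod.neg_one_ne_one (congrArg Units.val h)

lemma two_mul_card (hn : 2 ≤ n) : 2 * Nat.card (UnitsModSign n) = Nat.totient (2 * n) := by
  have : NeZero (2 * n) := ⟨by lia⟩
  have hcard := Subgroup.card_eq_card_quotient_mul_card_subgroup
    (Subgroup.zpowers (-1 : (ZMod (2 * n))ˣ))
  rw [Nat.card_zpowers, orderOf_neg_one hn, Nat.card_eq_fintype_card, ZMod.card_units_eq_totient]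
    at hcard
  rw [hcard, mul_comm]

/-- The representative of a class in the interval from `0` to `n`. -/
def rep (q : UnitsModSign n) : ℕ := (q.out : ZMod (2 * n)).valMinAbs.natAbs

lemma rep_mk (u : (ZMod (2 * n))ˣ) :
    rep (u : UnitsModSign n) = (u : ZMod (2 * n)).valMinAbs.natAbs := by
  rcases out_mk u with h | h <;> rw [rep, h]
  rw [Units.val_neg, ZMod.natAbs_valMinAbs_neg]

lemma rep_injective (hn : n ≠ 0) : Function.Injective (rep (n := n)) := by
  have : NeZero (2 * n) := ⟨by lia⟩
  intro q q' h
  rw [← Quotient.out_eq' q, ← Quotient.out_eq' q']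
  refine mk_eq_mk_iff.2 ((ZMod.natAbs_valMinAbs_eq_natAbs_valMinAbs.1 h).imp ?_ ?_) <;>
    exact fun h => Units.ext h

lemma rep_one (hn : n ≠ 0) : rep (1 : UnitsModSign n) = 1 := by
  have hone : ((1 : ℕ) : ZMod (2 * n)).valMinAbs = (1 : ℕ) :=
    ZMod.valMinAbs_natCast_of_le_half (by lia)
  have hrep := rep_mk (1 : (ZMod (2 * n))ˣ)
  rw [Units.val_one, ← Nat.cast_one, hone] at hrep
  exact hrep

lemma natCast_rep (hn : n ≠ 0) (q : UnitsModSign n) :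
    (q.rep : ZMod (2 * n)) = q.out ∨ (q.rep : ZMod (2 * n)) = -q.out := by
  have : NeZero (2 * n) := ⟨by lia⟩
  rw [rep, ZMod.natCast_natAbs_valMinAbs]
  split_ifs
  exacts [.inl rfl, .inr rfl]

lemma coprime_rep (hn : n ≠ 0) (q : UnitsModSign n) : Nat.Coprime q.rep (2 * n) := by
  rw [← ZMod.isUnit_iff_coprime]
  rcases natCast_rep hn q with h | h <;> rw [h]
  exacts [q.out.isUnit, q.out.isUnit.neg]

lemma rep_pos (hn : n ≠ 0) (q : UnitsModSign n) : 0 < q.rep := by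
  refine Nat.pos_of_ne_zero fun h => ?_
  have hcoprime := q.coprime_rep hn
  rw [h, Nat.coprime_zero_left] at hcoprime
  lia

lemma rep_lt (hn : 2 ≤ n) (q : UnitsModSign n) : q.rep < n := by
  have : NeZero (2 * n) := ⟨by lia⟩
  have hle : q.rep ≤ 2 * n / 2 := ZMod.natAbs_valMinAbs_le _
  refine lt_of_le_of_ne (by lia) fun h => ?_
  have hone := (q.coprime_rep (by lia)).eq_one_of_dvd (by rw [h]; exact Nat.dvd_mul_left n 2)
  lia

lemma odd_rep (hn : n ≠ 0) (q : UnitsModSign n) : Odd q.rep :=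
  Nat.Coprime.odd_of_right (q.coprime_rep hn).coprime_mul_right_right

lemma invSinSq_out_mk (hn : n ≠ 0) (u : (ZMod (2 * n))ˣ) :
    invSinSq n (u : UnitsModSign n).out = invSinSq n u := by
  rcases out_mk u with h | h <;> rw [h]
  rw [Units.val_neg, invSinSq_neg hn]

lemma invSinSq_rep (hn : n ≠ 0) (q : UnitsModSign n) :
    invSinSq n q.rep = invSinSq n q.out := by
  rcases natCast_rep hn q with h | h <;> rw [h]
  rw [invSinSq_neg hn]

instance (n : ℕ) : Fintype (UnitsModSign n) := Fintype.ofFinite _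

open scoped Classical in
lemma sum_invSinSq_lt (hn : 2 ≤ n) :
    ∑ q ∈ Finset.univ.erase (1 : UnitsModSign n), invSinSq n q.out <
      invSinSq n (1 : UnitsModSign n).out := by
  have hn₀ : n ≠ 0 := by lia
  have hinj := rep_injective hn₀
  have hodd : ∀ k ∈ (Finset.univ.erase (1 : UnitsModSign n)).image rep, Odd k ∧ k ≠ 1 := by
    intro k hk
    obtain ⟨q, hq, rfl⟩ := Finset.mem_image.1 hk
    refine ⟨q.odd_rep hn₀, fun h => (Finset.mem_erase.1 hq).1 (hinj ?_)⟩
    rw [h, rep_one hn₀]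
  calc ∑ q ∈ Finset.univ.erase (1 : UnitsModSign n), invSinSq n q.out
    _ ≤ ∑ q ∈ Finset.univ.erase (1 : UnitsModSign n), n ^ 2 * (1 / q.rep ^ 2 : ℝ) := by
        refine Finset.sum_le_sum fun q _ => ?_
        rw [← q.invSinSq_rep hn₀, invSinSq_natCast hn₀]
        exact one_div_sin_sq_le (q.rep_pos hn₀) (q.rep_lt hn).le
    _ = n ^ 2 * ∑ k ∈ (Finset.univ.erase (1 : UnitsModSign n)).image rep, 1 / (k : ℝ) ^ 2 := by
        rw [Finset.sum_image hinj.injOn, Finset.mul_sum]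
    _ ≤ n ^ 2 * (1 / 4) := by
        gcongr
        exact sum_inv_sq_le_of_odd hodd
    _ < invSinSq n (1 : UnitsModSign n).out := by
        rw [← invSinSq_rep hn₀, rep_one hn₀, Nat.cast_one]
        exact sq_div_four_lt_invSinSq_one hn₀

-- The entry at the identity of the group matrix exceeds the sum of the other entries of its row.
open scoped Classical in
lemma det_invSinSq_div_ne_zero (hn : 2 ≤ n) :
    (Matrix.of fun r q : UnitsModSign n => invSinSq n (q / r).out).det ≠ 0 := by
  refine det_ne_zero_of_sum_row_lt_diag fun r => ?_
  simp only [Matrix.of_apply, norm_of_nonneg (invSinSq_nonneg _), div_self']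
  refine lt_of_eq_of_lt ?_ (sum_invSinSq_lt hn)
  refine Finset.sum_equiv (Equiv.divRight r) (fun q => ?_) fun _ _ => rfl
  simp [div_eq_one]

lemma linearIndependent_invSinSq (hn : 2 ≤ n) :
    LinearIndependent ℤ fun q : UnitsModSign n => invSinSq n q.out := by
  classical
  have hn₀ : n ≠ 0 := by lia
  rw [Fintype.linearIndependent_iff]
  intro c hc
  simp only [zsmul_eq_mul] at hc
  have hmulVec : (Matrix.of fun r q : UnitsModSign n => invSinSq n (q / r).out).mulVec
      (fun q => (c q : ℝ)) = 0 := by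
    funext r
    refine .trans (Finset.sum_congr rfl fun q _ => ?_)
      (sum_mul_invSinSq_mul_unit_eq_zero hn₀ hc r.out⁻¹)
    change invSinSq n (q / r).out * (c q : ℝ) = _
    rw [mul_comm, ← Units.val_mul, ← invSinSq_out_mk hn₀ (q.out * r.out⁻¹),
      QuotientGroup.mk_mul, QuotientGroup.mk_inv, QuotientGroup.out_eq', QuotientGroup.out_eq',
      div_eq_mul_inv]
  have hzero := Matrix.eq_zero_of_mulVec_eq_zero (det_invSinSq_div_ne_zero hn) hmulVec
  exact fun q => Int.cast_eq_zero.1 (congrFun hzero q)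

end UnitsModSign

theorem finrank_eq_totient_div_two {n : ℕ} (hn : 2 ≤ n) (Λ : AddSubgroup ℝ) [Module.Finite ℤ Λ]
    (hle : ∀ w ∈ Λ, w ∈ realElements (cyclotomicSubfield n))
    (hmem : ∀ g : ℕ, 0 < g → g < n → Nat.Coprime g (2 * n) →
      1 / sin (g * unitAngle n) ^ 2 ∈ Λ) :
    Module.finrank ℤ Λ = Nat.totient (2 * n) / 2 := by
  have hn₀ : n ≠ 0 := by lia
  have := finiteDimensional_cyclotomicSubfield hn₀
  have := finiteDimensional_realElements (cyclotomicSubfield n)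
  refine le_antisymm ?_ ?_
  · rw [Nat.le_div_iff_mul_le two_pos, mul_comm]
    refine le_trans ?_ (two_mul_finrank_realElements_cyclotomicSubfield_le hn)
    let ι : Λ →+ realElements (cyclotomicSubfield n) :=
      Λ.subtype.codRestrict (realElements (cyclotomicSubfield n)).toAddSubgroup fun w => hle w w.2
    have hι : Function.Injective ι := fun x y h =>
      Subtype.ext (congrArg (fun z : realElements (cyclotomicSubfield n) => (z : ℝ)) h)
    have hbasis : LinearIndependent ℤ (ι.toIntLinearMap ∘ Module.finBasis ℤ Λ) :=
      (Module.finBasis ℤ Λ).linearIndependent.map' _ (LinearMap.ker_eq_bot.2 hι)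
    have hcard := ((LinearIndependent.iff_fractionRing ℤ ℚ).1 hbasis).fintype_card_le_finrank
    rw [Fintype.card_fin] at hcard
    lia
  · have hval (q : UnitsModSign n) : invSinSq n q.out ∈ Λ := by
      rw [← q.invSinSq_rep hn₀, invSinSq_natCast hn₀]
      exact hmem _ (q.rep_pos hn₀) (q.rep_lt hn) (q.coprime_rep hn₀)
    have hindep : LinearIndependent ℤ fun q : UnitsModSign n => (⟨_, hval q⟩ : Λ) :=
      .of_comp Λ.subtype.toIntLinearMap (UnitsModSign.linearIndependent_invSinSq hn)
    have hcard := hindep.fintype_card_le_finrank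
    rw [← Nat.card_eq_fintype_card] at hcard
    have htwo := UnitsModSign.two_mul_card hn
    lia

/-! ### Graphs with a cobounded group action -/

open SimpleGraph in
lemma dist_le_mul_dist {V W : Type*} {G : SimpleGraph V} {H : SimpleGraph W} (hG : G.Connected)
    (hH : H.Connected) {f : V → W} {M : ℕ} (hf : ∀ x y, G.Adj x y → H.dist (f x) (f y) ≤ M)
    (x y : V) : H.dist (f x) (f y) ≤ M * G.dist x y := by
  obtain ⟨p, hp⟩ := hG.exists_walk_length_eq_dist x y
  rw [← hp]
  clear hp
  induction p with
  | nil => simp only [SimpleGraph.dist_self, zero_le]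
  | cons hadj p ih =>
    rw [Walk.length_cons, mul_add, mul_one, add_comm]
    exact hH.dist_triangle.trans (add_le_add (hf _ _ hadj) ih)

open SimpleGraph in
lemma finite_dist_le {V : Type*} {G : SimpleGraph V} (hG : G.Connected)
    (hfin : ∀ x, (G.neighborSet x).Finite) (v : V) (r : ℕ) : {x | G.dist x v ≤ r}.Finite := by
  induction r with
  | zero =>
    refine (Set.finite_singleton v).subset fun x hx => ?_
    exact hG.dist_eq_zero_iff.1 (Nat.le_zero.1 hx)
  | succ r ih =>
    refine ((Set.finite_singleton v).union (ih.biUnion fun y _ => hfin y)).subset fun x hx => ?_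
    obtain ⟨p, hp⟩ := hG.exists_walk_length_eq_dist x v
    change G.dist x v ≤ r + 1 at hx
    cases p with
    | nil => exact .inl rfl
    | cons hadj p =>
      rw [Walk.length_cons] at hp
      exact .inr (Set.mem_biUnion (show G.dist _ v ≤ r by have := dist_le p; lia) hadj.symm)

open SimpleGraph in
lemma addCayley_connected {L : Type*} [AddGroup L] {S : Set L}
    (hS : AddSubgroup.closure S = ⊤) : (addCayley S).Connected := by
  have hreach : ∀ g ∈ AddSubgroup.closure S, ∀ a, (addCayley S).Reachable a (a + g) := by
    intro g hg
    induction hg using AddSubgroup.closure_induction with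
    | mem s hs =>
      intro a
      by_cases h : a = a + s
      · rw [← h]
      · exact Adj.reachable ((addCayley_adj' S _ _).2 ⟨h, s, hs, .inl rfl⟩)
    | zero => exact fun a => by rw [add_zero]
    | add x y _ _ hx hy => exact fun a => add_assoc a x y ▸ (hx a).trans (hy _)
    | neg x _ hx =>
      intro a
      have h := (hx (a + -x)).symm
      rwa [neg_add_cancel_right] at h
  refine (connected_iff _).2 ⟨fun a b => ?_, ⟨0⟩⟩
  have h := hreach (-a + b) (hS ▸ AddSubgroup.mem_top _) a
  rwa [add_neg_cancel_left] at h

lemma dist_vadd_vadd {V L : Type*} {G : SimpleGraph V} [AddGroup L] [AddAction L V]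
    (hG : G.Connected) (hadj : ∀ (g : L) x y, G.Adj x y → G.Adj (g +ᵥ x) (g +ᵥ y)) (g : L)
    (x y : V) : G.dist (g +ᵥ x) (g +ᵥ y) = G.dist x y := by
  have hle (g : L) (x y : V) : G.dist (g +ᵥ x) (g +ᵥ y) ≤ G.dist x y := by
    have h := dist_le_mul_dist (f := (g +ᵥ ·)) hG hG
      (fun x y hxy => (SimpleGraph.dist_eq_one_iff_adj.2 (hadj g x y hxy)).le) x y
    rwa [one_mul] at h
  refine le_antisymm (hle g x y) ?_
  simpa only [neg_vadd_vadd] using hle (-g) (g +ᵥ x) (g +ᵥ y)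

lemma exists_dist_vadd_le_of_finite_orbits {V L : Type*} {G : SimpleGraph V} [AddGroup L]
    [AddAction L V] [Finite (AddAction.orbitRel.Quotient L V)] (hG : G.Connected)
    (hadj : ∀ (g : L) x y, G.Adj x y → G.Adj (g +ᵥ x) (g +ᵥ y)) (v : V) :
    ∃ c, ∀ x, ∃ g : L, G.dist x (g +ᵥ v) ≤ c := by
  obtain ⟨c, hc⟩ := (Set.finite_range fun q : AddAction.orbitRel.Quotient L V =>
    G.dist v (Quotient.out q)).bddAbove
  refine ⟨c, fun x => ?_⟩
  let q : AddAction.orbitRel.Quotient L V := Quotient.mk _ x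
  obtain ⟨g, hg⟩ : ∃ g : L, g +ᵥ Quotient.out q = x :=
    AddAction.orbitRel_apply.1 (Quotient.exact (Quotient.out_eq q).symm)
  refine ⟨g, ?_⟩
  rw [← hg, dist_vadd_vadd hG hadj, SimpleGraph.dist_comm]
  exact hc ⟨q, rfl⟩

/-- The action of `L` on a connected, locally finite graph by automorphisms is free on the orbit of
`v`, and every vertex is at distance at most `c` from this orbit. -/
structure IsGeometricAction {V : Type*} (L : Type*) [AddGroup L] [AddAction L V]
    (G : SimpleGraph V) (v : V) (c : ℕ) : Prop where
  connected : G.Connected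
  adj : ∀ (g : L) x y, G.Adj x y → G.Adj (g +ᵥ x) (g +ᵥ y)
  finite : ∀ x, (G.neighborSet x).Finite
  injective : Function.Injective fun g : L => g +ᵥ v
  cobounded : ∀ x, ∃ g : L, G.dist x (g +ᵥ v) ≤ c

namespace IsGeometricAction

variable {V L : Type*} {G : SimpleGraph V} [AddGroup L] [AddAction L V] {v : V} {c : ℕ}

lemma finite_displacement_le (h : IsGeometricAction L G v c) (r : ℕ) :
    {g : L | G.dist (g +ᵥ v) v ≤ r}.Finite :=
  (finite_dist_le h.connected h.finite v r).preimage h.injective.injOn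

lemma dist_neg_add_vadd (h : IsGeometricAction L G v c) (g g' : L) :
    G.dist ((-g' + g) +ᵥ v) v = G.dist (g +ᵥ v) (g' +ᵥ v) := by
  rw [← dist_vadd_vadd h.connected h.adj g', vadd_vadd, add_neg_cancel_left]

lemma displacement_neg_add_le (h : IsGeometricAction L G v c) {x y : V} {g g' : L} {r : ℕ}
    (hxy : G.dist x y ≤ r) (hg : G.dist x (g +ᵥ v) ≤ c) (hg' : G.dist y (g' +ᵥ v) ≤ c) :
    G.dist ((-g' + g) +ᵥ v) v ≤ 2 * c + r := by
  rw [h.dist_neg_add_vadd]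
  have hx := h.connected.dist_triangle (u := g +ᵥ v) (v := x) (w := g' +ᵥ v)
  have hy := h.connected.dist_triangle (u := x) (v := y) (w := g' +ᵥ v)
  rw [SimpleGraph.dist_comm (u := g +ᵥ v) (v := x)] at hx
  lia

theorem fg (h : IsGeometricAction L G v c) : AddGroup.FG L := by
  let E := {g : L | G.dist (g +ᵥ v) v ≤ 2 * c + 1}
  refine AddGroup.fg_iff.2 ⟨E, eq_top_iff.2 fun g _ => ?_, h.finite_displacement_le _⟩
  choose q hq using h.cobounded
  have hwalk (x y : V) (hxy : G.Reachable x y) : -q y + q x ∈ AddSubgroup.closure E := by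
    induction (SimpleGraph.reachable_iff_reflTransGen x y).1 hxy with
    | refl => rw [neg_add_cancel]; exact zero_mem _
    | @tail y z _ hyz ih =>
      have hstep : -q z + q y ∈ AddSubgroup.closure E := AddSubgroup.subset_closure
        (h.displacement_neg_add_le (SimpleGraph.dist_eq_one_iff_adj.2 hyz).le (hq y) (hq z))
      rw [← add_neg_cancel_left (q y) (q x), ← add_assoc]
      exact add_mem hstep (ih (hxy.trans hyz.reachable.symm))
  have hnear (g : L) : -q (g +ᵥ v) + g ∈ AddSubgroup.closure E := by
    refine AddSubgroup.subset_closure ?_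
    refine h.displacement_neg_add_le (x := g +ᵥ v) (r := 1) ?_ ?_ (hq (g +ᵥ v)) <;>
      simp only [SimpleGraph.dist_self, zero_le]
  have hsum := add_mem (neg_mem (hnear 0))
    (add_mem (hwalk (g +ᵥ v) ((0 : L) +ᵥ v) (h.connected _ _)) (hnear g))
  rwa [add_zero, neg_neg, add_assoc, add_neg_cancel_left, add_neg_cancel_left] at hsum

lemma exists_dist_vadd_le (h : IsGeometricAction L G v c) {S : Set L} (hfin : S.Finite)
    (hS : AddSubgroup.closure S = ⊤) :
    ∃ M : ℕ, ∀ g g', G.dist (g +ᵥ v) (g' +ᵥ v) ≤ M * (SimpleGraph.addCayley S).dist g g' := by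
  obtain ⟨M, hM⟩ := (hfin.image fun s => G.dist (s +ᵥ v) v).bddAbove
  refine ⟨M, dist_le_mul_dist (addCayley_connected hS) h.connected fun g g' hadj => ?_⟩
  obtain ⟨-, s, hs, rfl | rfl⟩ := (SimpleGraph.addCayley_adj' S _ _).1 hadj
  · rw [SimpleGraph.dist_comm, ← h.dist_neg_add_vadd, neg_add_cancel_left]
    exact hM ⟨s, hs, rfl⟩
  · rw [← h.dist_neg_add_vadd, neg_add_cancel_left]
    exact hM ⟨s, hs, rfl⟩

lemma exists_addCayley_dist_le (h : IsGeometricAction L G v c) {S : Set L}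
    (hS : AddSubgroup.closure S = ⊤) :
    ∃ K : ℕ, ∀ g g', (SimpleGraph.addCayley S).dist g g' ≤
      K * (G.dist (g +ᵥ v) (g' +ᵥ v) + 2) := by
  have hC := addCayley_connected hS
  obtain ⟨K, hK⟩ := ((h.finite_displacement_le (2 * c + 1)).image
    fun g => (SimpleGraph.addCayley S).dist g 0).bddAbove
  have hdist {g g' : L} (hg : G.dist ((-g' + g) +ᵥ v) v ≤ 2 * c + 1) :
      (SimpleGraph.addCayley S).dist g g' ≤ K := by
    have hinv := dist_vadd_vadd hC
      (fun (g : L) x y hxy => SimpleGraph.addCayley_adj_add_iff_right.2 hxy) g' (-g' + g) 0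
    rw [vadd_eq_add, vadd_eq_add, add_neg_cancel_left, add_zero] at hinv
    exact hinv ▸ hK ⟨-g' + g, hg, rfl⟩
  -- A coarse inverse of the orbit map.
  choose q hq using h.cobounded
  have hlipschitz := dist_le_mul_dist (f := q) h.connected hC fun x y hxy =>
    hdist (h.displacement_neg_add_le (SimpleGraph.dist_eq_one_iff_adj.2 hxy).le (hq x) (hq y))
  have hnear (g : L) : (SimpleGraph.addCayley S).dist g (q (g +ᵥ v)) ≤ K := by
    refine hdist (h.displacement_neg_add_le (x := g +ᵥ v) (r := 1) ?_ ?_ (hq (g +ᵥ v))) <;>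
      simp only [SimpleGraph.dist_self, zero_le]
  refine ⟨K, fun g g' => ?_⟩
  calc (SimpleGraph.addCayley S).dist g g'
    _ ≤ (SimpleGraph.addCayley S).dist g (q (g +ᵥ v)) +
          ((SimpleGraph.addCayley S).dist (q (g +ᵥ v)) (q (g' +ᵥ v)) +
            (SimpleGraph.addCayley S).dist (q (g' +ᵥ v)) g') :=
        hC.dist_triangle.trans (add_le_add_right hC.dist_triangle _)
    _ ≤ K + (K * G.dist (g +ᵥ v) (g' +ᵥ v) + K) := by
        rw [SimpleGraph.dist_comm (v := g')]
        exact add_le_add (hnear g) (add_le_add (hlipschitz _ _) (hnear g'))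
    _ = K * (G.dist (g +ᵥ v) (g' +ᵥ v) + 2) := by ring

/-- The Švarc–Milnor lemma. -/
theorem isQuasiIsometry (h : IsGeometricAction L G v c) {S : Set L} (hfin : S.Finite)
    (hS : AddSubgroup.closure S = ⊤) :
    IsQuasiIsometry (graphDist (SimpleGraph.addCayley S)) (graphDist G) fun g : L => g +ᵥ v := by
  obtain ⟨M, hM⟩ := h.exists_dist_vadd_le hfin hS
  obtain ⟨K, hK⟩ := h.exists_addCayley_dist_le hS
  refine ⟨⟨1 + K + M, 2, ?_, zero_le_two, fun g g' => ?_⟩, c, c.cast_nonneg, fun z => ?_⟩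
  · rw [add_assoc, le_add_iff_nonneg_right]
    positivity
  · have hupper : (G.dist (g +ᵥ v) (g' +ᵥ v) : ℝ) ≤ M * (SimpleGraph.addCayley S).dist g g' :=
      mod_cast hM g g'
    have hlower : ((SimpleGraph.addCayley S).dist g g' : ℝ) ≤
        K * (G.dist (g +ᵥ v) (g' +ᵥ v) + 2) := mod_cast hK g g'
    simp only [graphDist]
    constructor
    · rw [sub_le_iff_le_add, one_div, inv_mul_le_iff₀ (by positivity)]
      refine hlower.trans (mul_le_mul_of_nonneg_right ?_ (by positivity))
      linarith [M.cast_nonneg (α := ℝ)]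
    · refine hupper.trans (le_add_of_le_of_nonneg ?_ zero_le_two)
      refine mul_le_mul_of_nonneg_right ?_ (Nat.cast_nonneg _)
      linarith [K.cast_nonneg (α := ℝ)]
  · obtain ⟨g, hg⟩ := h.cobounded z
    exact ⟨g, Nat.cast_le.2 hg⟩

end IsGeometricAction

/-! ### The initial seed -/

lemma altitudeFoot_eq_of_inner_eq_zero {T : Affine.Triangle ℝ Plane} {i j k : Fin 3}
    (hijk : ({i}ᶜ : Set (Fin 3)) = {j, k}) {q : Plane}
    (hq : q ∈ line[ℝ, T.points j, T.points k])
    (h : inner ℝ (T.points i - q) (T.points j - T.points k) = (0 : ℝ)) :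
    T.altitudeFoot i = q := by
  have hrange : Set.range (T.faceOpposite i).points = {T.points j, T.points k} := by
    rw [Affine.Simplex.range_faceOpposite_points, hijk, Set.image_pair]
  rw [Affine.Simplex.altitudeFoot, Affine.Simplex.orthogonalProjectionSpan,
    EuclideanGeometry.coe_orthogonalProjection_eq_iff_mem, hrange]
  refine ⟨hq, ?_⟩
  rw [Submodule.mem_orthogonal, direction_affineSpan]
  intro v hv
  obtain ⟨r, rfl⟩ := mem_vectorSpan_pair.1 hv
  rw [real_inner_smul_left, vsub_eq_sub, vsub_eq_sub, real_inner_comm, h, mul_zero]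

lemma reflection_line_eq_of_inner_eq_zero {p q x y : Plane}
    (hmid : midpoint ℝ x y ∈ line[ℝ, p, q]) (h : inner ℝ (x - y) (q - p) = (0 : ℝ)) :
    EuclideanGeometry.reflection line[ℝ, p, q] x = y := by
  have horth : x -ᵥ midpoint ℝ x y ∈ line[ℝ, p, q].directionᗮ := by
    rw [left_vsub_midpoint]
    refine Submodule.smul_mem _ _ ((Submodule.mem_orthogonal _ _).2 fun v hv => ?_)
    rw [direction_affineSpan] at hv
    obtain ⟨r, rfl⟩ := mem_vectorSpan_pair_rev.1 hv
    rw [real_inner_smul_left, vsub_eq_sub, vsub_eq_sub, real_inner_comm, h, mul_zero]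
  have hreflection := EuclideanGeometry.reflection_orthogonal_vadd hmid horth
  rwa [vsub_vadd, neg_vsub_eq_vsub_rev, midpoint_vsub_left, ← right_vsub_midpoint, vsub_vadd]
    at hreflection

namespace BeltFrame

variable (F : BeltFrame)

/-- The point with given coordinates, in the unit of length of the frame. -/
def point (x y : ℝ) : Plane := F.base + ((F.scale * x) • F.dir + (F.scale * y) • F.perp)

lemma point_sub_point (x y x' y' : ℝ) : F.point x y - F.point x' y' =
    F.scale • ((x - x') • F.dir + (y - y') • F.perp) := by
  simp only [point]
  module

lemma inner_point_sub_point (x y x' y' z w z' w' : ℝ) :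
    inner ℝ (F.point x y - F.point x' y') (F.point z w - F.point z' w') =
      F.scale ^ 2 * ((x - x') * (z - z') + (y - y') * (w - w')) := by
  simp only [point_sub_point, real_inner_smul_left, real_inner_smul_right, inner_combination]
  ring

lemma lineMap_point (x y x' y' t : ℝ) : AffineMap.lineMap (F.point x y) (F.point x' y') t =
    F.point (x + t * (x' - x)) (y + t * (y' - y)) := by
  simp only [AffineMap.lineMap_apply_module, point]
  module

variable {F} {T : Affine.Triangle ℝ Plane}

lemma sideForm_eq_aff {i : Fin 3} {a b r x y c : ℝ} (hfoot : T.altitudeFoot i = F.point a b)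
    (hpoint : T.points i = F.point (a + r * x) (b + r * y)) (hr : 0 < r)
    (hxy : x ^ 2 + y ^ 2 = 1) (hc : c = -(x * a + y * b)) : sideForm T i = F.aff x y c := by
  have hnorm : ‖x • F.dir + y • F.perp‖ = 1 := by
    rw [norm_eq_sqrt_real_inner, F.inner_combination, ← sq, ← sq, hxy, sqrt_one]
  have hsub : T.points i - T.altitudeFoot i = (F.scale * r) • (x • F.dir + y • F.perp) := by
    rw [hfoot, hpoint, point_sub_point]
    module
  have hpos := mul_pos F.scale_pos hr
  have hnormal : (√2 / ‖T.points i - T.altitudeFoot i‖) • (T.points i - T.altitudeFoot i) =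
      √2 • (x • F.dir + y • F.perp) := by
    rw [hsub, norm_smul, hnorm, mul_one, norm_of_nonneg hpos.le, smul_smul,
      div_mul_cancel₀ _ hpos.ne']
  refine Prod.ext hnormal ?_
  change -inner ℝ ((√2 / ‖T.points i - T.altitudeFoot i‖) • (T.points i - T.altitudeFoot i))
    (T.altitudeFoot i) = _
  rw [hnormal, hfoot]
  simp only [aff, point, inner_add_left, inner_add_right,
    real_inner_smul_left, real_inner_smul_right, F.dir_dir, F.perp_perp, F.dir_perp, F.perp_dir,
    hc]
  ring

/-- In the coordinates of the frame, `T` is the right triangle with legs of slope `cot θ` and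
`- tan θ` whose right angle is at the origin and whose other vertices have abscissas `1` and
`- 1`. -/
structure IsFrameOf (F : BeltFrame) (T : Affine.Triangle ℝ Plane) (θ : ℝ) : Prop where
  sin_pos : 0 < sin θ
  cos_pos : 0 < cos θ
  points_zero : T.points 0 = F.point 1 (cos θ / sin θ)
  points_one : T.points 1 = F.point (-1) (sin θ / cos θ)
  points_two : T.points 2 = F.point 0 0

lemma exists_frame_of_orthogonal {p a b : Plane} {l θ : ℝ} (hl : 0 < l) (hsin : 0 < sin θ)
    (hcos : 0 < cos θ) (ha : ‖a‖ = l * cos θ) (hb : ‖b‖ = l * sin θ)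
    (hab : inner ℝ a b = (0 : ℝ)) :
    ∃ F : BeltFrame, ∀ x y, F.point x y = p + ((sin θ * (x * sin θ + y * cos θ)) • a +
      (cos θ * (y * sin θ - x * cos θ)) • b) := by
  have hba : inner ℝ b a = (0 : ℝ) := by rw [real_inner_comm, hab]
  have haa : inner ℝ a a = (l * cos θ) ^ 2 := by rw [real_inner_self_eq_norm_sq, ha]
  have hbb : inner ℝ b b = (l * sin θ) ^ 2 := by rw [real_inner_self_eq_norm_sq, hb]
  let F : BeltFrame :=
    { base := p
      dir := (sin θ / (l * cos θ)) • a - (cos θ / (l * sin θ)) • b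
      perp := l⁻¹ • (a + b)
      scale := l * sin θ * cos θ
      dir_dir := by
        simp only [inner_sub_left, inner_sub_right, real_inner_smul_left, real_inner_smul_right,
          haa, hbb, hab, hba]
        field_simp
        linear_combination l ^ 2 * sin_sq_add_cos_sq θ
      perp_perp := by
        simp only [inner_add_left, inner_add_right, real_inner_smul_left, real_inner_smul_right,
          haa, hbb, hab, hba]
        field_simp
        linear_combination l ^ 2 * sin_sq_add_cos_sq θ
      dir_perp := by
        simp only [inner_sub_left, inner_add_right, real_inner_smul_left, real_inner_smul_right,
          haa, hbb, hab, hba]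
        field_simp
        ring
      scale_pos := by positivity }
  refine ⟨F, fun x y => ?_⟩
  simp only [point, F]
  congr 1
  match_scalars <;> field_simp
  ring

theorem exists_isFrameOf {θ : ℝ} (hθ : ∠ (T.points 1) (T.points 0) (T.points 2) = θ)
    (hright : ∠ (T.points 0) (T.points 2) (T.points 1) = π / 2) (hsin : 0 < sin θ)
    (hcos : 0 < cos θ) : ∃ F : BeltFrame, F.IsFrameOf T θ := by
  have horth : inner ℝ (T.points 0 - T.points 2) (T.points 1 - T.points 2) = (0 : ℝ) :=
    (InnerProductGeometry.inner_eq_zero_iff_angle_eq_pi_div_two _ _).2 hright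
  rw [EuclideanGeometry.angle_comm] at hθ hright
  have hadj : ‖T.points 0 - T.points 2‖ = dist (T.points 1) (T.points 0) * cos θ := by
    rw [mul_comm, ← hθ, EuclideanGeometry.cos_angle_mul_dist_of_angle_eq_pi_div_two hright,
      dist_eq_norm]
  have hopp : ‖T.points 1 - T.points 2‖ = dist (T.points 1) (T.points 0) * sin θ := by
    rw [mul_comm, ← hθ, EuclideanGeometry.sin_angle_mul_dist_of_angle_eq_pi_div_two hright,
      dist_eq_norm]
  obtain ⟨F, hF⟩ := exists_frame_of_orthogonal (p := T.points 2)
    (dist_pos.2 (T.independent.injective.ne (by decide))) hsin hcos hadj hopp horth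
  refine ⟨F, hsin, hcos, ?_, ?_, ?_⟩
  · have hacoeff : sin θ * (1 * sin θ + cos θ / sin θ * cos θ) = 1 := by
      field_simp
      exact sin_sq_add_cos_sq θ
    have hbcoeff : cos θ * (cos θ / sin θ * sin θ - 1 * cos θ) = 0 := by
      field_simp
      ring
    rw [hF, hacoeff, hbcoeff, one_smul, zero_smul, add_zero, add_sub_cancel]
  · have hacoeff : sin θ * (-1 * sin θ + sin θ / cos θ * cos θ) = 0 := by
      field_simp
      ring
    have hbcoeff : cos θ * (sin θ / cos θ * sin θ - -1 * cos θ) = 1 := by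
      field_simp
      linear_combination sin_sq_add_cos_sq θ
    rw [hF, hacoeff, hbcoeff, one_smul, zero_smul, zero_add, add_sub_cancel]
  · rw [hF]
    module

namespace IsFrameOf

variable {θ : ℝ}

lemma altitudeFoot_zero (h : F.IsFrameOf T θ) : T.altitudeFoot 0 = F.point 0 0 := by
  refine altitudeFoot_eq_of_inner_eq_zero (j := 1) (k := 2) (by ext i; fin_cases i <;> simp) ?_ ?_
  · rw [← h.points_two]
    exact right_mem_affineSpan_pair ℝ _ _
  · rw [h.points_zero, h.points_one, h.points_two, inner_point_sub_point]
    have := h.sin_pos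
    have := h.cos_pos
    field_simp
    ring

lemma altitudeFoot_one (h : F.IsFrameOf T θ) : T.altitudeFoot 1 = F.point 0 0 := by
  refine altitudeFoot_eq_of_inner_eq_zero (j := 0) (k := 2) (by ext i; fin_cases i <;> simp) ?_ ?_
  · rw [← h.points_two]
    exact right_mem_affineSpan_pair ℝ _ _
  · rw [h.points_zero, h.points_one, h.points_two, inner_point_sub_point]
    have := h.sin_pos
    have := h.cos_pos
    field_simp
    ring

lemma altitudeFoot_two (h : F.IsFrameOf T θ) :
    T.altitudeFoot 2 = F.point (-cos (2 * θ)) (sin (2 * θ)) := by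
  have hsin := h.sin_pos
  have hcos := h.cos_pos
  refine altitudeFoot_eq_of_inner_eq_zero (j := 0) (k := 1) (by ext i; fin_cases i <;> simp) ?_ ?_
  · have hmem := AffineMap.lineMap_mem_affineSpan_pair (cos θ ^ 2) (T.points 0) (T.points 1)
    rw [h.points_zero, h.points_one, lineMap_point, ← h.points_zero, ← h.points_one] at hmem
    convert hmem using 2
    · rw [cos_two_mul]
      ring
    · rw [sin_two_mul]
      field_simp
      linear_combination sin_sq_add_cos_sq θ
  · rw [h.points_zero, h.points_one, h.points_two, inner_point_sub_point, sin_two_mul, cos_two_mul]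
    field_simp
    linear_combination 2 * F.scale ^ 2 * cos θ * sin θ * sin_sq_add_cos_sq θ

lemma isAdapted (h : F.IsFrameOf T θ) : F.IsAdapted (initialReferencePoint T) := by
  have hsin := h.sin_pos
  have hreflection : EuclideanGeometry.reflection line[ℝ, T.points 2, T.points 0]
      (T.altitudeFoot 2) = F.point 1 0 := by
    refine reflection_line_eq_of_inner_eq_zero ?_ ?_
    · have hmem := AffineMap.lineMap_mem_affineSpan_pair (sin θ ^ 2) (T.points 2) (T.points 0)
      rw [h.points_zero, h.points_two, lineMap_point, ← h.points_zero, ← h.points_two] at hmem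
      rw [h.altitudeFoot_two, midpoint, lineMap_point, invOf_eq_inv]
      convert hmem using 2
      · rw [cos_two_mul]
        linear_combination -sin_sq_add_cos_sq θ
      · rw [sin_two_mul]
        field_simp
        ring
    · rw [h.altitudeFoot_two, h.points_zero, h.points_two, inner_point_sub_point, sin_two_mul,
        cos_two_mul]
      field_simp
      ring
  refine ⟨?_, F.scale, F.scale_pos, ?_⟩
  · simp only [initialReferencePoint, h.points_two, point]
    module
  · simp only [initialReferencePoint]
    rw [hreflection, h.points_two, point_sub_point]
    module

lemma sideForm_zero (h : F.IsFrameOf T θ) : sideForm T 0 = F.line 1 θ 0 := by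
  have hsin := h.sin_pos
  refine sideForm_eq_aff (r := 1 / sin θ) h.altitudeFoot_zero ?_ (by positivity) ?_ (by ring)
  · rw [h.points_zero]
    congr 1 <;> field_simp <;> ring
  · linear_combination sin_sq_add_cos_sq θ

lemma sideForm_one (h : F.IsFrameOf T θ) : sideForm T 1 = F.line 1 (θ - π / 2) 0 := by
  have hcos := h.cos_pos
  refine sideForm_eq_aff (r := 1 / cos θ) h.altitudeFoot_one ?_ (by positivity) ?_ (by ring)
  · rw [h.points_one, sin_sub_pi_div_two, cos_sub_pi_div_two]
    congr 1 <;> field_simp <;> ring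
  · linear_combination sin_sq_add_cos_sq (θ - π / 2)

lemma sideForm_two (h : F.IsFrameOf T θ) : sideForm T 2 = F.line 1 (2 * θ + π / 2) 1 := by
  refine sideForm_eq_aff (r := 1) h.altitudeFoot_two ?_ one_pos ?_ ?_
  · rw [h.points_two, sin_add_pi_div_two, cos_add_pi_div_two]
    congr 1 <;> ring
  · linear_combination sin_sq_add_cos_sq (2 * θ + π / 2)
  · rw [sin_add_pi_div_two, cos_add_pi_div_two]
    linear_combination -sin_sq_add_cos_sq (2 * θ)

end IsFrameOf

end BeltFrame

/-- The state of the initial seed. -/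
def initialState (n : ℕ) : BeltState := ⟨1, n - 1, 1, 0⟩

lemma admissible_initialState {n : ℕ} (hn : 2 ≤ n) : (initialState n).Admissible n where
  two_le := hn
  pos := one_pos
  le := by rw [initialState]; lia
  le' := Nat.sub_le n 1
  eq_one_of_dvd _ hd _ _ := Nat.eq_one_of_dvd_one hd

lemma BeltFrame.IsFrameOf.initialSeed_eq {n : ℕ} (hn : n ≠ 0) {F : BeltFrame}
    {T : Affine.Triangle ℝ Plane} (h : F.IsFrameOf T (unitAngle n)) :
    initialSeed n T = ((initialState n).toSeed F n).relabel (Equiv.swap 1 2) := by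
  have hc : ((n - 1 : ℕ) : ℝ) * unitAngle n = π / 2 - unitAngle n := by
    rw [Nat.cast_sub (by lia), sub_mul, mul_unitAngle hn, Nat.cast_one, one_mul]
  have hc' : ((n : ℝ) - 1) * unitAngle n = π / 2 - unitAngle n := by
    rw [sub_mul, mul_unitAngle hn, one_mul]
  have hsin := h.sin_pos
  simp only [initialState, BeltState.toSeed, hc, Nat.cast_one, one_mul, Units.val_one,
    Int.cast_one]
  symm
  refine LabelledSeed.relabel_ext_fin ?_ ?_ ?_ ?_
  · rw [Equiv.swap_apply_of_ne_of_ne (by decide) (by decide), seed_v_zero]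
    exact (line_congr 0 (by simp) (by ring)).trans h.sideForm_zero.symm
  · rw [Equiv.swap_apply_left, seed_v_two]
    refine (line_congr 0 (by push_cast; ring) ?_).trans h.sideForm_one.symm
    rw [add_sub_cancel, cos_pi_div_two]
    ring
  · rw [Equiv.swap_apply_right, seed_v_one]
    refine (line_congr 0 (by push_cast; ring) ?_).trans h.sideForm_two.symm
    rw [cos_pi_div_two_sub, div_self hsin.ne']
    ring
  · rw [seed_B, skewMatrix_submatrix_swap_one_two, add_sub_cancel, cos_pi_div_two,
      mul_zero, neg_zero, skewMatrix, neg_neg, neg_zero, ← hc']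
    rfl

theorem exists_frame_initialSeed {n : ℕ} (hn : 2 ≤ n) {T : Affine.Triangle ℝ Plane}
    (h₁ : ∠ (T.points 1) (T.points 0) (T.points 2) = unitAngle n)
    (h₃ : ∠ (T.points 0) (T.points 2) (T.points 1) = n * unitAngle n) :
    ∃ F : BeltFrame, F.IsAdapted (initialReferencePoint T) ∧
      initialSeed n T = ((initialState n).toSeed F n).relabel (Equiv.swap 1 2) := by
  have hsin := sin_mul_unitAngle_pos (n := n) one_pos (by lia)
  have hcos := (cos_mul_unitAngle_pos_iff (k := 1) (n := n) (by lia) (by lia)).2 (by lia)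
  rw [Nat.cast_one, one_mul] at hsin hcos
  rw [mul_unitAngle (by lia)] at h₃
  obtain ⟨F, hF⟩ := BeltFrame.exists_isFrameOf h₁ h₃ hsin hcos
  exact ⟨F, hF.isAdapted, hF.initialSeed_eq (by lia)⟩

/-! ### The exchange graph -/

namespace LabelledSeed

lemma translate_translate (w z : Plane) (s : LabelledSeed) :
    (s.translate z).translate w = s.translate (w + z) :=
  LabelledSeed.ext (funext fun _ => AffineForm.translate_translate _ _ _) rfl

lemma translate_zero (s : LabelledSeed) : s.translate 0 = s :=
  LabelledSeed.ext (funext fun _ => AffineForm.translate_zero _) rfl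

lemma SameShape.relabel {s t : LabelledSeed} (h : SameShape s t) (τ : Equiv.Perm (Fin 3)) :
    SameShape (s.relabel τ) (t.relabel τ) where
  interiorAngle_eq := by
    funext i
    rw [interiorAngle_relabel, interiorAngle_relabel, h.interiorAngle_eq]
  quiver_eq := by
    have hadj := congrArg Digraph.Adj h.quiver_eq
    ext i j
    exact iff_of_eq (congrFun (congrFun hadj (τ i)) (τ j))
  orientation_eq := by rw [orientation_relabel, orientation_relabel, h.orientation_eq]

lemma mk_relabel (s : LabelledSeed) (τ : Equiv.Perm (Fin 3)) : (⟦s.relabel τ⟧ : Seed) = ⟦s⟧ :=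
  Quotient.sound (Setoid.symm ⟨τ, rfl⟩)

lemma exists_relabel_eq {s t : LabelledSeed} (h : (⟦s⟧ : Seed) = ⟦t⟧) : ∃ τ, t.relabel τ = s :=
  (Quotient.exact h.symm).imp fun _ => Eq.symm

lemma mk_mutate_relabel (u : ReferencePoint) (k : Fin 3) (τ : Equiv.Perm (Fin 3))
    (s : LabelledSeed) : (⟦(s.relabel τ).mutate u k⟧ : Seed) = ⟦s.mutate u (τ k)⟧ := by
  rw [mutate_relabel, mk_relabel]

end LabelledSeed

section exchangeGraph

variable {u : ReferencePoint} {s₀ : LabelledSeed}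

lemma mk_mutate_mem_mutationClass {s : LabelledSeed} (h : ⟦s⟧ ∈ Seed.mutationClass u s₀)
    (k : Fin 3) : ⟦s.mutate u k⟧ ∈ Seed.mutationClass u s₀ := by
  obtain ⟨t, ht, hts⟩ := h
  obtain ⟨τ, rfl⟩ := LabelledSeed.exists_relabel_eq hts.symm
  rw [LabelledSeed.mk_mutate_relabel]
  exact ⟨_, ht.tail ⟨τ k, rfl⟩, rfl⟩

lemma exchangeGraph_connected : (exchangeGraph u s₀).Connected := by
  have hreach (s : LabelledSeed)
      (hs : Relation.ReflTransGen (fun s t => ∃ k, t = LabelledSeed.mutate u k s) s₀ s) :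
      (exchangeGraph u s₀).Reachable (initialVertex u s₀) ⟨⟦s⟧, s, hs, rfl⟩ := by
    induction hs with
    | refl => exact .refl _
    | @tail s t hs hst ih =>
      obtain ⟨k, rfl⟩ := hst
      refine ih.trans ?_
      by_cases heq : (⟦s⟧ : Seed) = ⟦s.mutate u k⟧
      · simp only [heq, SimpleGraph.Reachable.refl]
      · exact SimpleGraph.Adj.reachable ((SimpleGraph.fromRel_adj _ _ _).2
          ⟨fun h => heq (congrArg Subtype.val h), .inl ⟨s, k, rfl, rfl⟩⟩)
  have hreach' (x : Seed.mutationClass u s₀) :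
      (exchangeGraph u s₀).Reachable (initialVertex u s₀) x := by
    obtain ⟨_, s, hs, rfl⟩ := x
    exact hreach s hs
  exact (SimpleGraph.connected_iff _).2
    ⟨fun x y => (hreach' x).symm.trans (hreach' y), ⟨initialVertex u s₀⟩⟩

lemma exchangeGraph_adj_translate {F : BeltFrame} (hu : F.IsAdapted u) (w : ℝ)
    {x y x' y' : Seed.mutationClass u s₀} (hx : x'.1 = Seed.translate (w • F.dir) x.1)
    (hy : y'.1 = Seed.translate (w • F.dir) y.1) (h : (exchangeGraph u s₀).Adj x y) :
    (exchangeGraph u s₀).Adj x' y' := by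
  have hmutate {x y x' y' : Seed.mutationClass u s₀} (hx : x'.1 = Seed.translate (w • F.dir) x.1)
      (hy : y'.1 = Seed.translate (w • F.dir) y.1) :
      (∃ (s : LabelledSeed) (k : Fin 3), ⟦s⟧ = x.1 ∧ ⟦s.mutate u k⟧ = y.1) →
      ∃ (s : LabelledSeed) (k : Fin 3), ⟦s⟧ = x'.1 ∧ ⟦s.mutate u k⟧ = y'.1 := by
    rintro ⟨s, k, hs, hk⟩
    refine ⟨s.translate (w • F.dir), k, ?_, ?_⟩
    · rw [hx, ← hs]
      rfl
    · rw [LabelledSeed.mutate_translate hu, hy, ← hk]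
      rfl
  obtain ⟨hne, hor⟩ := (SimpleGraph.fromRel_adj _ _ _).1 h
  refine (SimpleGraph.fromRel_adj _ _ _).2
    ⟨fun heq => hne (Subtype.ext ?_), hor.imp (hmutate hx hy) (hmutate hy hx)⟩
  rw [heq, hy] at hx
  have hback := congrArg (Seed.translate (-(w • F.dir))) hx
  simpa only [Seed.translate_translate, neg_add_cancel, Seed.translate_zero] using hback.symm

lemma smul_dir_mem_translationLattice {F : BeltFrame} (hu : F.IsAdapted u) {w : ℝ}
    (hw : ∀ x ∈ Seed.mutationClass u s₀, Seed.translate (w • F.dir) x ∈ Seed.mutationClass u s₀)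
    (hw' : ∀ x ∈ Seed.mutationClass u s₀,
      Seed.translate ((-w) • F.dir) x ∈ Seed.mutationClass u s₀) :
    w • F.dir ∈ translationLattice u s₀ := by
  have hleft (x : Seed) : Seed.translate ((-w) • F.dir) (Seed.translate (w • F.dir) x) = x := by
    rw [Seed.translate_translate, neg_smul, neg_add_cancel, Seed.translate_zero]
  have hright (x : Seed) : Seed.translate (w • F.dir) (Seed.translate ((-w) • F.dir) x) = x := by
    rw [Seed.translate_translate, neg_smul, add_neg_cancel, Seed.translate_zero]
  let e : Seed.mutationClass u s₀ ≃ Seed.mutationClass u s₀ :=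
    { toFun := fun x => ⟨_, hw _ x.2⟩
      invFun := fun x => ⟨_, hw' _ x.2⟩
      left_inv := fun x => Subtype.ext (hleft x)
      right_inv := fun x => Subtype.ext (hright x) }
  exact ⟨⟨e, fun {x y} => ⟨exchangeGraph_adj_translate hu (-w) (hleft x).symm (hleft y).symm,
    exchangeGraph_adj_translate hu w rfl rfl⟩⟩, fun _ => rfl⟩

lemma exchangeGraph_adj_vadd (g : translationLattice u s₀) (x y : Seed.mutationClass u s₀)
    (h : (exchangeGraph u s₀).Adj x y) : (exchangeGraph u s₀).Adj (g +ᵥ x) (g +ᵥ y) := by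
  obtain ⟨g, φ, hφ⟩ := g
  have hvadd (x) : (⟨g, φ, hφ⟩ : translationLattice u s₀) +ᵥ x = φ x := Subtype.ext (hφ x).symm
  rw [hvadd, hvadd]
  exact φ.map_rel_iff.2 h

end exchangeGraph

namespace BeltState

open LabelledSeed

variable {F : BeltFrame} {u : ReferencePoint} {n : ℕ} {D D' : BeltState}

/-- The seed described by a state, up to the numbering of its sides. -/
def vertex (F : BeltFrame) (n : ℕ) (D : BeltState) : Seed := ⟦D.toSeed F n⟧

lemma vertex_shift (w : ℝ) :
    (D.shift w).vertex F n = Seed.translate ((F.scale * w) • F.dir) (D.vertex F n) := by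
  rw [vertex, toSeed_shift]
  rfl

namespace Admissible

lemma mk_mutate_toSeed (hu : F.IsAdapted u) (h : D.Admissible n) (k : Fin 3) :
    (⟦(D.toSeed F n).mutate u k⟧ : Seed) = (D.step n k).vertex F n := by
  obtain ⟨τ, hτ⟩ := exists_relabel_mutate_eq hu h k
  rw [vertex, ← hτ, mk_relabel]

lemma exists_mk_mutate_eq (hu : F.IsAdapted u) (h : D.Admissible n) {s : LabelledSeed}
    {k : Fin 3} (hs : ⟦(D.toSeed F n).mutate u k⟧ = (⟦s⟧ : Seed)) :
    ∃ j, (⟦s.mutate u j⟧ : Seed) = D.vertex F n := by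
  obtain ⟨τ, rfl⟩ := exists_relabel_eq hs.symm
  refine ⟨τ.symm k, ?_⟩
  rw [mk_mutate_relabel, Equiv.apply_symm_apply, mutate_mutate_toSeed hu h, vertex]

lemma vertex_shift_eq_of_sameShape (h : D.Admissible n) (h' : D'.Admissible n)
    {s t : LabelledSeed} (hs : ⟦s⟧ = D.vertex F n) (ht : ⟦t⟧ = D'.vertex F n)
    (hshape : SameShape t s) : (D.shift (D'.p - D.p)).vertex F n = D'.vertex F n := by
  obtain ⟨τ, rfl⟩ := exists_relabel_eq hs
  obtain ⟨σ, rfl⟩ := exists_relabel_eq ht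
  have hshape' := hshape.relabel τ⁻¹
  rw [relabel_relabel, relabel_relabel, mul_inv_cancel, relabel_one] at hshape'
  rw [vertex, ← relabel_toSeed_eq h h' hshape', mk_relabel, vertex]

lemma eq_smul_dir_of_translate_vertex_eq (h : D.Admissible n) (h' : D'.Admissible n) {w : Plane}
    (hw : Seed.translate w (D.vertex F n) = D'.vertex F n) :
    w = (F.scale * (D'.p - D.p)) • F.dir := by
  obtain ⟨τ, hτ⟩ := exists_relabel_eq (s := (D.toSeed F n).translate w) hw
  have hshift := relabel_toSeed_eq (F := F) h h' (τ := τ) (by rw [hτ]; exact ⟨rfl, rfl, rfl⟩)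
  rw [hτ, toSeed_shift] at hshift
  have hback := congrArg (LabelledSeed.translate (-((F.scale * (D'.p - D.p)) • F.dir))) hshift
  rw [LabelledSeed.translate_translate, LabelledSeed.translate_translate, neg_add_cancel,
    LabelledSeed.translate_zero] at hback
  exact (neg_add_eq_zero.1 (h.eq_zero_of_translate_toSeed_eq hback)).symm

lemma orientation_ne_zero (h : D.Admissible n) {s : LabelledSeed} (hs : ⟦s⟧ = D.vertex F n) :
    s.orientation ≠ 0 := by
  obtain ⟨τ, rfl⟩ := exists_relabel_eq hs
  have hsign (e : ℤˣ) : SignType.sign ((e : ℤ) : ℝ) ≠ 0 :=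
    sign_ne_zero.2 (Int.cast_ne_zero.2 e.ne_zero)
  rw [orientation_relabel, h.orientation_toSeed]
  exact mul_ne_zero (hsign _) (mul_ne_zero (hsign _)
    (sign_ne_zero.2 (neg_ne_zero.2 F.cross_ne_zero)))

end Admissible

lemma Linked.vertex_mem_mutationClass_iff (hu : F.IsAdapted u) {s₀ : LabelledSeed}
    (h : Linked n D D') :
    D.vertex F n ∈ Seed.mutationClass u s₀ ↔ D'.vertex F n ∈ Seed.mutationClass u s₀ := by
  induction h with
  | rel D D' h =>
    obtain ⟨h, k, rfl⟩ := h
    refine ⟨fun hD => ?_, fun hD => ?_⟩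
    · rw [← h.mk_mutate_toSeed hu]
      exact mk_mutate_mem_mutationClass hD k
    · obtain ⟨j, hj⟩ := h.exists_mk_mutate_eq hu (h.mk_mutate_toSeed hu k)
      rw [← hj]
      exact mk_mutate_mem_mutationClass hD j
  | refl D => rfl
  | symm _ _ _ ih => exact ih.symm
  | trans _ _ _ _ _ ih ih' => exact ih.trans ih'

end BeltState

/-- Up to the numbering of its sides, `s₀` is the seed of an admissible state `D₀`, and the
reference point is the positive end of the belt line. -/
structure IsBeltSeed (F : BeltFrame) (n : ℕ) (u : ReferencePoint) (s₀ : LabelledSeed)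
    (D₀ : BeltState) : Prop where
  isAdapted : F.IsAdapted u
  admissible : D₀.Admissible n
  mk_eq : ⟦s₀⟧ = D₀.vertex F n

namespace IsBeltSeed

open LabelledSeed

variable {F : BeltFrame} {n : ℕ} {u : ReferencePoint} {s₀ : LabelledSeed} {D₀ D E : BeltState}

lemma mem_mutationClass_iff (h : IsBeltSeed F n u s₀ D₀) {x : Seed} :
    x ∈ Seed.mutationClass u s₀ ↔ ∃ D, BeltState.Linked n D₀ D ∧ D.vertex F n = x := by
  constructor
  · rintro ⟨s, hs, rfl⟩
    induction hs with
    | refl => exact ⟨D₀, .refl _, h.mk_eq.symm⟩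
    | tail _ hst ih =>
      obtain ⟨k, rfl⟩ := hst
      obtain ⟨D, hD, hs⟩ := ih
      obtain ⟨τ, rfl⟩ := exists_relabel_eq hs.symm
      have hadmissible := hD.admissible_iff.1 h.admissible
      refine ⟨D.step n (τ k), hD.trans (.step hadmissible _), ?_⟩
      rw [mk_mutate_relabel, hadmissible.mk_mutate_toSeed h.isAdapted]
  · rintro ⟨D, hD, rfl⟩
    rw [← hD.vertex_mem_mutationClass_iff h.isAdapted, ← h.mk_eq]
    exact (initialVertex u s₀).2

lemma exists_vertex_eq (h : IsBeltSeed F n u s₀ D₀) (x : Seed.mutationClass u s₀) :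
    ∃ D : BeltState, D.Admissible n ∧ BeltState.Linked n D₀ D ∧ D.vertex F n = x.1 := by
  obtain ⟨D, hD, hx⟩ := h.mem_mutationClass_iff.1 x.2
  exact ⟨D, hD.admissible_iff.1 h.admissible, hD, hx⟩

lemma translate_mem_mutationClass (h : IsBeltSeed F n u s₀ D₀) (hD : BeltState.Linked n D₀ D)
    (hE : BeltState.Linked n D₀ E) {w : ℝ} (hw : (D.shift w).vertex F n = E.vertex F n)
    {x : Seed} (hx : x ∈ Seed.mutationClass u s₀) :
    Seed.translate ((F.scale * w) • F.dir) x ∈ Seed.mutationClass u s₀ := by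
  obtain ⟨D', hD', rfl⟩ := h.mem_mutationClass_iff.1 hx
  have hlinked := (hD'.symm.trans hD).shift w
  rw [← BeltState.vertex_shift, hlinked.vertex_mem_mutationClass_iff h.isAdapted, hw]
  exact h.mem_mutationClass_iff.2 ⟨E, hE, rfl⟩

lemma smul_dir_mem_translationLattice (h : IsBeltSeed F n u s₀ D₀)
    (hD : BeltState.Linked n D₀ D) (hE : BeltState.Linked n D₀ E) {w : ℝ}
    (hw : (D.shift w).vertex F n = E.vertex F n) :
    (F.scale * w) • F.dir ∈ translationLattice u s₀ := by
  have hw' : (E.shift (-w)).vertex F n = D.vertex F n := by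
    rw [BeltState.vertex_shift, ← hw, BeltState.vertex_shift, Seed.translate_translate, ← add_smul,
      mul_neg, neg_add_cancel, zero_smul, Seed.translate_zero]
  refine _root_.smul_dir_mem_translationLattice h.isAdapted
    (fun _ => h.translate_mem_mutationClass hD hE hw) fun _ hx => ?_
  rw [← mul_neg]
  exact h.translate_mem_mutationClass hE hD hw' hx

lemma exists_vadd_eq_of_vertex_shift_eq (h : IsBeltSeed F n u s₀ D₀)
    {x y : Seed.mutationClass u s₀} (hD : BeltState.Linked n D₀ D)
    (hE : BeltState.Linked n D₀ E) (hx : D.vertex F n = x.1) (hy : E.vertex F n = y.1) {w : ℝ}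
    (hw : (D.shift w).vertex F n = E.vertex F n) :
    ∃ g : translationLattice u s₀, g +ᵥ x = y := by
  refine ⟨⟨_, h.smul_dir_mem_translationLattice hD hE hw⟩, Subtype.ext ?_⟩
  change Seed.translate _ x.1 = y.1
  rw [← hx, ← BeltState.vertex_shift, hw, hy]

lemma exists_vadd_eq_of_sameShape (h : IsBeltSeed F n u s₀ D₀) {x y : Seed.mutationClass u s₀}
    {s t : LabelledSeed} (hs : ⟦s⟧ = x.1) (ht : ⟦t⟧ = y.1) (hshape : SameShape t s) :
    ∃ g : translationLattice u s₀, g +ᵥ x = y := by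
  obtain ⟨D, hDadm, hD, hx⟩ := h.exists_vertex_eq x
  obtain ⟨E, hEadm, hE, hy⟩ := h.exists_vertex_eq y
  exact h.exists_vadd_eq_of_vertex_shift_eq hD hE hx hy
    (hDadm.vertex_shift_eq_of_sameShape hEadm (hs.trans hx.symm) (ht.trans hy.symm) hshape)

section IsOfType

variable {α : ℝ} {m : Fin 3 → ℕ} {Q : Digraph (Fin 3)} {ε : SignType}

lemma exists_vadd_eq_of_isOfType (h : IsBeltSeed F n u s₀ D₀) {x y : Seed.mutationClass u s₀}
    (hx : x.1.IsOfType α m Q ε) (hy : y.1.IsOfType α m Q ε) :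
    ∃ g : translationLattice u s₀, g +ᵥ x = y := by
  obtain ⟨s, hs, -, hsangle, hsquiver, hsorientation⟩ := hx
  obtain ⟨t, ht, -, htangle, htquiver, htorientation⟩ := hy
  exact h.exists_vadd_eq_of_sameShape hs ht ⟨funext fun i => (htangle i).trans (hsangle i).symm,
    htquiver.trans hsquiver.symm, htorientation.trans hsorientation.symm⟩

lemma eq_one_or_eq_neg_one_of_isOfType (h : IsBeltSeed F n u s₀ D₀)
    {x : Seed.mutationClass u s₀} (hx : x.1.IsOfType α m Q ε) : ε = 1 ∨ ε = -1 := by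
  obtain ⟨s, hs, -, -, -, rfl⟩ := hx
  obtain ⟨D, hD, -, hDx⟩ := h.exists_vertex_eq x
  have hne := hD.orientation_ne_zero (hs.trans hDx.symm)
  rcases SignType.trichotomy s.orientation with hneg | hzero | hone
  exacts [.inr hneg, absurd hzero hne, .inl hone]

lemma encard_orbits_isOfType_le_two (h : IsBeltSeed F n u s₀ D₀) :
    ((fun x => (Quotient.mk _ x :
        AddAction.orbitRel.Quotient (translationLattice u s₀) (Seed.mutationClass u s₀))) ''
      {x | ∃ ε, x.1.IsOfType α m Q ε}).encard ≤ 2 := by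
  set orbit := fun x => (Quotient.mk _ x :
    AddAction.orbitRel.Quotient (translationLattice u s₀) (Seed.mutationClass u s₀))
  have hone (ε) : (orbit '' {x | x.1.IsOfType α m Q ε}).encard ≤ 1 := by
    rw [Set.encard_le_one_iff]
    rintro _ _ ⟨x, hx, rfl⟩ ⟨y, hy, rfl⟩
    exact Quotient.sound (h.exists_vadd_eq_of_isOfType hy hx)
  calc (orbit '' {x | ∃ ε, x.1.IsOfType α m Q ε}).encard
      ≤ (orbit '' {x | x.1.IsOfType α m Q 1} ∪ orbit '' {x | x.1.IsOfType α m Q (-1)}).encard := by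
        refine Set.encard_le_encard ?_
        rintro _ ⟨x, ⟨ε, hx⟩, rfl⟩
        rcases h.eq_one_or_eq_neg_one_of_isOfType hx with rfl | rfl
        exacts [.inl ⟨x, hx, rfl⟩, .inr ⟨x, hx, rfl⟩]
    _ ≤ 1 + 1 := (Set.encard_union_le _ _).trans (add_le_add (hone 1) (hone (-1)))
    _ = 2 := one_add_one_eq_two

end IsOfType

lemma finite_orbits (h : IsBeltSeed F n u s₀ D₀) : Finite (AddAction.orbitRel.Quotient
    (translationLattice u s₀) (Seed.mutationClass u s₀)) := by
  choose state hadm hlinked hstate using h.exists_vertex_eq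
  let shape (q : AddAction.orbitRel.Quotient (translationLattice u s₀) (Seed.mutationClass u s₀)) :
      Set.Iic n × Set.Iic n × ℤˣ :=
    (⟨(state q.out).a, (hadm _).le⟩, ⟨(state q.out).c, (hadm _).le'⟩, (state q.out).s)
  refine Finite.of_injective shape fun q r hqr => ?_
  obtain ⟨ha, hc, hs⟩ : _ ∧ _ ∧ _ := by simpa only [shape, Prod.mk.injEq] using hqr
  have hshift : (state r.out).shift ((state q.out).p - (state r.out).p) = state q.out :=
    BeltState.ext (congrArg Subtype.val ha.symm) (congrArg Subtype.val hc.symm) hs.symm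
      (add_sub_cancel _ _)
  rw [← q.out_eq, ← r.out_eq]
  exact Quotient.sound (h.exists_vadd_eq_of_vertex_shift_eq (hlinked _) (hlinked _) (hstate _)
    (hstate _) (congrArg _ hshift))

lemma finite_neighborSet (h : IsBeltSeed F n u s₀ D₀) (x : Seed.mutationClass u s₀) :
    ((exchangeGraph u s₀).neighborSet x).Finite := by
  obtain ⟨D, -, -, hx⟩ := h.exists_vertex_eq x
  refine ((Set.finite_range fun k => (⟦(D.toSeed F n).mutate u k⟧ : Seed)).preimage
    Subtype.val_injective.injOn).subset fun y hxy => ?_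
  have hadj : (exchangeGraph u s₀).Adj x y := hxy
  rcases ((SimpleGraph.fromRel_adj _ _ _).1 hadj).2 with ⟨s, k, hs, hk⟩ | ⟨s, k, hs, hk⟩
  · obtain ⟨τ, rfl⟩ := exists_relabel_eq (hs.trans hx.symm)
    exact ⟨τ k, by rw [← hk, mk_mutate_relabel]⟩
  · obtain ⟨E, hE, -, hy⟩ := h.exists_vertex_eq y
    obtain ⟨τ, rfl⟩ := exists_relabel_eq (hs.trans hy.symm)
    rw [mk_mutate_relabel, ← hx] at hk
    obtain ⟨j, hj⟩ := hE.exists_mk_mutate_eq h.isAdapted hk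
    exact ⟨j, hj.trans hy⟩

lemma vadd_initialVertex_injective (h : IsBeltSeed F n u s₀ D₀) :
    Function.Injective fun g : translationLattice u s₀ => g +ᵥ initialVertex u s₀ := by
  intro g g' hgg'
  have hfix : Seed.translate (-g'.1 + g.1) (D₀.vertex F n) = D₀.vertex F n := by
    rw [← h.mk_eq, ← Seed.translate_translate]
    refine (congrArg (fun x => Seed.translate (-g'.1) x.1) hgg').trans ?_
    change Seed.translate _ (Seed.translate _ ⟦s₀⟧) = ⟦s₀⟧
    rw [Seed.translate_translate, neg_add_cancel, Seed.translate_zero]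
  have hzero := h.admissible.eq_smul_dir_of_translate_vertex_eq h.admissible hfix
  rw [sub_self, mul_zero, zero_smul] at hzero
  exact Subtype.ext (neg_add_eq_zero.1 hzero).symm

theorem exists_isGeometricAction (h : IsBeltSeed F n u s₀ D₀) :
    ∃ c, IsGeometricAction (translationLattice u s₀) (exchangeGraph u s₀)
      (initialVertex u s₀) c := by
  have := h.finite_orbits
  obtain ⟨c, hc⟩ := exists_dist_vadd_le_of_finite_orbits exchangeGraph_connected
    exchangeGraph_adj_vadd (initialVertex u s₀)
  exact ⟨c, exchangeGraph_connected, exchangeGraph_adj_vadd, h.finite_neighborSet,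
    h.vadd_initialVertex_injective, hc⟩

lemma finite_translationLattice (h : IsBeltSeed F n u s₀ D₀) :
    Module.Finite ℤ (translationLattice u s₀) := by
  obtain ⟨c, hc⟩ := h.exists_isGeometricAction
  exact Module.Finite.iff_addGroup_fg.2 hc.fg

end IsBeltSeed

namespace BeltFrame

variable (F : BeltFrame)

/-- The translation along the belt line by a multiple of the unit of length. -/
def beltVector : ℝ →+ Plane where
  toFun w := (F.scale * w) • F.dir
  map_zero' := by rw [mul_zero, zero_smul]
  map_add' w w' := by rw [mul_add, add_smul]

lemma beltVector_injective : Function.Injective F.beltVector := by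
  have hdir : F.dir ≠ 0 := inner_self_ne_zero.1 (F.dir_dir.trans_ne one_ne_zero)
  exact fun _ _ h => mul_left_cancel₀ F.scale_pos.ne' (smul_left_injective ℝ hdir h)

end BeltFrame

namespace IsBeltSeed

variable {F : BeltFrame} {n : ℕ} {u : ReferencePoint} {s₀ : LabelledSeed} {D₀ : BeltState}

lemma exists_linked_of_mem_translationLattice (h : IsBeltSeed F n u s₀ D₀) {w : Plane}
    (hw : w ∈ translationLattice u s₀) :
    ∃ D, BeltState.Linked n D₀ D ∧ F.beltVector (D.p - D₀.p) = w := by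
  obtain ⟨D, hadm, hD, hDw⟩ := h.exists_vertex_eq ((⟨w, hw⟩ : translationLattice u s₀) +ᵥ
    initialVertex u s₀)
  refine ⟨D, hD, (h.admissible.eq_smul_dir_of_translate_vertex_eq hadm ?_).symm⟩
  rw [hDw, ← h.mk_eq]
  rfl

lemma mem_realElements_of_beltVector_mem (h : IsBeltSeed F n u s₀ D₀) {w : ℝ}
    (hw : F.beltVector w ∈ translationLattice u s₀) :
    w ∈ realElements (cyclotomicSubfield n) := by
  obtain ⟨D, hD, hDw⟩ := h.exists_linked_of_mem_translationLattice hw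
  rw [← F.beltVector_injective hDw]
  exact hD.p_sub_mem_realElements

lemma shiftGroup_le_comap (h : IsBeltSeed F n u s₀ D₀) :
    D₀.shiftGroup n ≤ (translationLattice u s₀).comap F.beltVector := fun _ hw =>
  h.smul_dir_mem_translationLattice (.refl _) hw rfl

lemma comap_beltVector_bijective (h : IsBeltSeed F n u s₀ D₀) :
    Function.Bijective (F.beltVector.addSubgroupComap (translationLattice u s₀)) := by
  refine ⟨fun w w' hww' => Subtype.ext (F.beltVector_injective (congrArg Subtype.val hww')), ?_⟩
  rintro ⟨w, hw⟩
  obtain ⟨D, -, hDw⟩ := h.exists_linked_of_mem_translationLattice hw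
  exact ⟨⟨D.p - D₀.p, by rw [AddSubgroup.mem_comap, hDw]; exact hw⟩, Subtype.ext hDw⟩

theorem finrank_translationLattice (h : IsBeltSeed F n u s₀ D₀)
    (hD₀ : Nat.Coprime D₀.a D₀.c) :
    Module.finrank ℤ (translationLattice u s₀) = Nat.totient (2 * n) / 2 := by
  let e : (translationLattice u s₀).comap F.beltVector ≃ₗ[ℤ] translationLattice u s₀ :=
    (AddEquiv.ofBijective _ h.comap_beltVector_bijective).toIntLinearEquiv
  have := h.finite_translationLattice
  have := Module.Finite.equiv e.symm
  rw [← e.finrank_eq]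
  exact finrank_eq_totient_div_two h.admissible.two_le _
    (fun w hw => h.mem_realElements_of_beltVector_mem hw) fun g hpos hlt hg =>
      h.shiftGroup_le_comap (BeltState.inv_sin_sq_mem_shiftGroup h.admissible hD₀ hpos hlt hg)

end IsBeltSeed

end

theorem theorem6p1 (n : ℕ) (hn : 2 ≤ n) (T : Affine.Triangle ℝ Plane)
    (h₁ : ∠ (T.points 1) (T.points 0) (T.points 2) = Real.pi / (2 * n))
    (h₂ : ∠ (T.points 0) (T.points 1) (T.points 2) = (n - 1) * (Real.pi / (2 * n)))
    (h₃ : ∠ (T.points 0) (T.points 2) (T.points 1) = n * (Real.pi / (2 * n)))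
    (u : ReferencePoint) (hu : u = initialReferencePoint T)
    (s₀ : LabelledSeed) (hs₀ : s₀ = initialSeed n T) :
    (∀ m : Fin 3 → ℕ, m 0 + m 1 + m 2 = 2 * n → Finset.univ.gcd m = 1 →
      ∀ Q : Digraph (Fin 3),
        ((fun x => (Quotient.mk _ x :
            AddAction.orbitRel.Quotient (translationLattice u s₀) (Seed.mutationClass u s₀))) ''
          {x | ∃ ε, x.1.IsOfType (Real.pi / (2 * n)) m Q ε}).encard ≤ 2 ∧
        (∀ (x : Seed.mutationClass u s₀) (ε : SignType),
          x.1.IsOfType (Real.pi / (2 * n)) m Q ε → ε = 1 ∨ ε = -1) ∧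
        ∀ (ε : SignType) (x y : Seed.mutationClass u s₀),
          x.1.IsOfType (Real.pi / (2 * n)) m Q ε → y.1.IsOfType (Real.pi / (2 * n)) m Q ε →
            ∃ w : translationLattice u s₀, w +ᵥ x = y) ∧
    (Module.Finite ℤ (translationLattice u s₀) ∧
      (Module.finrank ℤ (translationLattice u s₀) = Nat.totient (2 * n) / 2 ∨
        Module.finrank ℤ (translationLattice u s₀) = Nat.totient (2 * n))) ∧
    (∀ S : Set (translationLattice u s₀), S.Finite → S = -S → 0 ∉ S →
      AddSubgroup.closure S = ⊤ →
        IsQuasiIsometry (graphDist (SimpleGraph.addCayley S)) (graphDist (exchangeGraph u s₀))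
          (fun w => w +ᵥ initialVertex u s₀)) := by
  subst hu hs₀
  obtain ⟨F, hF, hT⟩ := exists_frame_initialSeed hn h₁ h₃
  have h : IsBeltSeed F n (initialReferencePoint T) (initialSeed n T) (initialState n) :=
    ⟨hF, admissible_initialState hn, by rw [hT, LabelledSeed.mk_relabel, BeltState.vertex]⟩
  obtain ⟨c, hc⟩ := h.exists_isGeometricAction
  exact ⟨fun m _ _ Q => ⟨h.encard_orbits_isOfType_le_two,
      fun _ _ => h.eq_one_or_eq_neg_one_of_isOfType, fun _ _ _ => h.exists_vadd_eq_of_isOfType⟩,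
    ⟨h.finite_translationLattice, .inl (h.finrank_translationLattice (Nat.coprime_one_left _))⟩,
    fun S hS _ _ hS' => hc.isQuasiIsometry hS hS'⟩
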